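/- **Setting.** Let $d\ge 1$ and let $S\subset\mathbb R^d$ be closed with $0\in S$ and $\overline{S^{\mathrm{int}}}=S$. Let $\mathsf S$ be the set of configurations $\mathsf s=\sum_i\delta_{s_i}$ on $S$ with finitely many points in each bounded set, with the vague topology and its Borel $\sigma$-field. For $A\subset S$ put $\pi_A(\mathsf s)=\mathsf s(A\cap\cdot)$. Let $\Phi:S\to\mathbb R\cup\{\infty\}$ and $\Psi:S\times S\to\mathbb R\cup\{\infty\}$ be Borel measurable, $\Psi$ symmetric, $\Phi<\infty$ a.e., and for $\mathsf x=\sum_i\delta_{x_i}$ let $$\mathcal H_A^{\Phi,\Psi}(\mathsf x)=\sum_{x_i\in A}\Phi(x_i)+\sum_{i<j,\;x_i,x_j\in A}\Psi(x_i,x_j).$$ For a strictly increasing sequence $(b_r)$ of natural numbers put $S_r=\{s\in S:|s|\le b_r\}$, $\mathsf S_r^m=\{\mathsf s:\mathsf s(S_r)=m\}$, $\mathcal H_r=\mathcal H^{\Phi,\Psi}_{S_r}$, and let $\Lambda_r$ be the Poisson random point field with intensity $1_{S_r}(x)\,dx$. An $n$-correlation function of a probability measure $\mu$ on $\mathsf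 S$ is a permutation invariant function $\rho^n\ge0$ on $S^n$ with $$\int_{A_1^{k_1}\times\dots\times A_p^{k_p}}\rho^n\,dx_1\cdots dx_n=\int_{\mathsf S}\prod_{i=1}^p\frac{\mathsf s(A_i)!}{(\mathsf s(A_i)-k_i)!}\,d\mu$$ for all disjoint bounded Borel sets $A_1,\dots,A_p\subset S$ and $k_1+\dots+k_p=n$ (the quotient being $0$ if $k_i>\mathsf s(A_i)$). **Quasi-Gibbs measures.** A probability measure $\mu$ on $\mathsf S$ is a $(\Phi,\Psi)$-quasi Gibbs measure if there are a strictly increasing sequence $(b_r)$ of natural numbers and finite measures $\mu_{r,k}^m$ on $\mathsf S$ such that for all $r,m$: $\mu_{r,k}^m\le\mu_{r,k+1}^m$ for all $k$; $\mu_{r,k}^m\to\mu(\cdot\cap\mathsf S_r^m)$ weakly as $k\to\infty$; and for all $k$ and $\mu_{r,k}^m$-a.e. $\mathsf s$, the regular conditional distribution $\mu_{r,k,\mathsf s}^m(d\mathsf x)=\mu_{r,k}^m(\pi_{S_r}\in d\mathsf x\mid\pi_{S_r^c}(\mathsf s))$ satisfies $$c^{-1}e^{-\mathcal H_r(\mathsf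 x)}1_{\mathsf S_r^m}(\mathsf x)\,\Lambda_r(d\mathsf x)\le\mu_{r,k,\mathsf s}^m(d\mathsf x)\le c\,e^{-\mathcal H_r(\mathsf x)}1_{\mathsf S_r^m}(\mathsf x)\,\Lambda_r(d\mathsf x)$$ with a positive finite constant $c=c(r,m,k,\pi_{S_r^c}(\mathsf s))$. **Theorem.** Fix a strictly increasing sequence $(b_r)$ of natural numbers, with $S_r$ as above. Let $\mu$ be a probability measure on $\mathsf S$ satisfying the following two assumptions. (A.4) There are probability measures $\mu^N$ on $\mathsf S$ ($N\in\mathbb N$) and Borel functions $\Phi^N:S\to\mathbb R\cup\{\infty\}$ and symmetric $\Psi^N:S\times S\to\mathbb R\cup\{\infty\}$ such that: * $\mu$ and $\mu^N$ have $n$-correlation functions $\rho^n$ and $\rho^n_N$ for all $n$, with $\rho_N^n\to\rho^n$ a.e. on $S^n$ as $N\to\infty$, and for every $r\in\mathbb N$ there are $c>0$ and $\delta<1$ such that $\sup_N\rho^n_N(x_1,\dots,x_n)\le(c\,n^{\delta})^n$ for all $n$ and all $x_1,\dots,x_n\in S$ with $|x_i|\le r$; * for each $N$ there is $n_N\in\mathbb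 N$ with $\mu^N(\mathsf s(S)\le n_N)=1$; * each $\mu^N$ is a $(\Phi^N,\Psi^N)$-canonical Gibbs measure: for all $r,m$ and $\mu^N(\cdot\cap\mathsf S_r^m)$-a.e. $\mathsf s$, the conditional distribution of $\pi_{S_r}$ given $\pi_{S_r^c}(\mathsf s)$ under $\mu^N(\cdot\cap\mathsf S_r^m)$ is $$\frac1Z\exp\Big(-\mathcal H^{\Phi^N,\Psi^N}_{S_r}(\mathsf x)-\sum_{x_i\in S_r,\,s_j\in S_r^c}\Psi^N(x_i,s_j)\Big)1_{\mathsf S_r^m}(\mathsf x)\,\Lambda_r(d\mathsf x),\qquad 0<Z=Z(\mathsf s)<\infty;$$ * $\Phi^N\to\Phi$ a.e. on $S$ and $\inf_{N,\,x\in S}\Phi^N(x)>-\infty$; * $\Psi^N\in C^1(S\times S\setminus\{x=y\})$ (real valued there), $\Psi^N\to\Psi$ in $C^1(S\times S\setminus\{x=y\})$ uniformly on compact sets, and $\inf_N\inf_{x,y\in S_r}\Psi^N(x,y)>-\infty$ for every $r$. Here $C^1$ means: continuous, differentiable at interior points, with derivative extending continuously to $S\times S\setminus\{x=y\}$. (A.5)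 There are bounded Borel sets $S_r^N$ ($r,N\in\mathbb N$) with $\bigcup_rS_r^N=S$ for all $N$, $S_r^N\subset S_s^N$ for $r<s$, and, for all $r$, $S_r^N\to S_r$ in the Hausdorff distance and $|S_r\setminus S_r^N|\to0$ (Lebesgue measure) as $N\to\infty$, such that $$\lim_{k\to\infty}\liminf_{N\to\infty}\mu^N(\mathsf H_{r,k})=1\quad\text{for all }r.$$ Here, for $\mathsf y=\sum_i\delta_{y_i}$ and $r<s$, $\mathsf h^N_{r,s}(x,\mathsf y)=\sum_{y_i\in S^N_s\setminus S^N_r}\{\Psi^N(x,y_i)-\Psi^N(0,y_i)\}$ and $$\mathsf H_{r,k}=\Big\{\mathsf y\in\mathsf S:\ \sup_{N}\sup_{s>r}\sup_{x\ne x'\in S_r^N}\frac{|\mathsf h^N_{r,s}(x,\mathsf y)-\mathsf h^N_{r,s}(x',\mathsf y)|}{|x-x'|}\le k\Big\}.$$ Then $\mu$ is a $(\Phi,\Psi)$-quasi Gibbs measure. -/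

import Mathlib

open MeasureTheory ProbabilityTheory Filter Topology Set
open scoped ENNReal NNReal CompactlySupported

noncomputable section

namespace QuasiGibbs

/-- The Euclidean space of dimension `d`. -/
abbrev Sp (d : ℕ) : Type := EuclideanSpace ℝ (Fin d)

variable {d : ℕ}

/-- The standing assumptions on the state space: `S` is closed, contains `0`, and is the closure
of its interior. -/
structure IsStateSpace (S : Set (Sp d)) : Prop where
  isClosed : IsClosed S
  zero_mem : (0 : Sp d) ∈ S
  closure_interior : closure (interior S) = S

/-! ### Configurations -/

/-- A configuration `s = ∑ᵢ δ_{sᵢ}` of points of `S` (multiple points are allowed) with finitely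
many points in each ball. It is given by the multiplicities `mult x = s({x})`. -/
@[ext]
structure Conf (S : Set (Sp d)) where
  mult : Sp d → ℕ
  mult_eq_zero : ∀ x, x ∉ S → mult x = 0
  finite_ball : ∀ r : ℕ, {x | mult x ≠ 0 ∧ ‖x‖ ≤ r}.Finite

namespace Conf

variable {S : Set (Sp d)}

/-- The integral `∫ f ds = ∑ᵢ f(sᵢ)` of a compactly supported function
(only finitely many terms are non-zero). -/
def pairing (s : Conf S) (f : C_c(Sp d, ℝ)) : ℝ := ∑ᶠ x, (s.mult x : ℝ) * f x

/-- The vague topology: the coarsest one for which all `s ↦ ∫ f ds`, `f` continuous with compact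
support, are continuous. -/
instance : TopologicalSpace (Conf S) :=
  TopologicalSpace.induced (fun s : Conf S => fun f : C_c(Sp d, ℝ) => s.pairing f) inferInstance

instance : MeasurableSpace (Conf S) := borel _

instance : BorelSpace (Conf S) := ⟨rfl⟩

/-- `s(A)`, the number of points of `s` in `A`. -/
def count (s : Conf S) (A : Set (Sp d)) : ℝ≥0∞ := ∑' x : A, (s.mult x : ℝ≥0∞)

/-- `π_A(s) = s(A ∩ ·)`. -/
def proj (A : Set (Sp d)) (s : Conf S) : Conf S where
  mult := A.indicator s.mult
  mult_eq_zero x hx := by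
    by_cases h : x ∈ A
    · simp [h, s.mult_eq_zero x hx]
    · simp [h]
  finite_ball r := (s.finite_ball r).subset fun x hx => by
    refine ⟨fun h => hx.1 ?_, hx.2⟩
    by_cases hA : x ∈ A <;> simp [hA, h]

open Classical in
/-- The configuration `∑ᵢ δ_{xᵢ}` of finitely many points (points outside `S` are dropped). -/
def ofPoints (S : Set (Sp d)) {n : ℕ} (x : Fin n → Sp d) : Conf S where
  mult y := if y ∈ S then (Finset.univ.filter fun i => x i = y).card else 0
  mult_eq_zero y hy := by simp [hy]
  finite_ball r := (Set.finite_range x).subset fun y hy => by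
    have h := hy.1
    by_cases hS : y ∈ S
    · simp only [hS, if_true, ne_eq, Finset.card_eq_zero, Finset.filter_eq_empty_iff,
        Finset.mem_univ, true_implies, not_forall, not_not] at h
      exact h
    · simp [hS] at h

/-- The points of `s` in `A`, listed with multiplicity. Used only when `s` has finitely many points
in `A`, in particular when `A` is bounded. -/
def points (s : Conf S) (A : Set (Sp d)) : Multiset (Sp d) :=
  ∑ᶠ (x : Sp d) (_ : x ∈ A), s.mult x • ({x} : Multiset (Sp d))

end Conf

/-! ### Correlation functions -/

/-- `ρ` is the `n`-point correlation function of `μ` with respect to Lebesgue measure. A choice of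
the products `A₁^{k₁} × ⋯ × A_m^{k_m}` with `k₁ + ⋯ + k_m = n` is described by the map `c`, the
`j`-th factor being `A_{c(j)}`; `a.descFactorial k = a! / (a - k)!` and
`(s.points (A i)).card = s(A_i)` is finite since `A_i` is bounded. Only the values of `ρ` on
`S^n` matter. -/
structure IsCorrelation {S : Set (Sp d)} (μ : Measure (Conf S)) (n : ℕ)
    (ρ : (Fin n → Sp d) → ℝ≥0) : Prop where
  measurable : Measurable ρ
  symm : ∀ (σ : Equiv.Perm (Fin n)) (x : Fin n → Sp d), ρ (x ∘ σ) = ρ x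
  lintegral_eq : ∀ (m : ℕ) (A : Fin m → Set (Sp d)) (c : Fin n → Fin m),
    (∀ i, MeasurableSet (A i)) → (∀ i, Bornology.IsBounded (A i)) → (∀ i, A i ⊆ S) →
    Pairwise (fun i j => Disjoint (A i) (A j)) →
    ∫⁻ x in Set.univ.pi (fun j => A (c j)), (ρ x : ℝ≥0∞)
      = ∫⁻ s, ∏ i, (((s.points (A i)).card.descFactorial
          (Finset.univ.filter fun j => c j = i).card : ℕ) : ℝ≥0∞) ∂μ

/-! ### Potentials and Hamiltonians -/

/-- A Borel measurable `Φ` with values in `ℝ ∪ {∞}` (only its values on `S` matter). -/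
structure IsFreePotential (Φ : Sp d → EReal) : Prop where
  measurable : Measurable Φ
  ne_bot : ∀ x, Φ x ≠ ⊥

/-- A Borel measurable symmetric `Ψ` with values in `ℝ ∪ {∞}` (only its values on `S × S`
matter). -/
structure IsPairPotential (Ψ : Sp d → Sp d → EReal) : Prop where
  measurable : Measurable (Function.uncurry Ψ)
  symm : ∀ x y, Ψ x y = Ψ y x
  ne_bot : ∀ x y, Ψ x y ≠ ⊥

/-- `∑ᵢ Φ(xᵢ) + ∑_{i<j} Ψ(xᵢ, xⱼ)`. -/
def energy (Φ : Sp d → EReal) (Ψ : Sp d → Sp d → EReal) {n : ℕ} (x : Fin n → Sp d) : EReal :=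
  ∑ i, Φ (x i) + ∑ i, ∑ j ∈ Finset.Ioi i, Ψ (x i) (x j)

/-- The Hamiltonian `H_A(x)` on a bounded set `A`; the order in which the points of `x` in `A` are
listed is irrelevant since `Ψ` is symmetric. -/
def hamiltonian (Φ : Sp d → EReal) (Ψ : Sp d → Sp d → EReal) {S : Set (Sp d)} (A : Set (Sp d))
    (x : Conf S) : EReal :=
  energy Φ Ψ (x.points A).toList.get

/-- The interaction `∑_{xᵢ ∈ A, sⱼ ∈ Aᶜ} Ψ(xᵢ, sⱼ)` between the points of `x` in the bounded set
`A` and the points of `s` outside `A`, for `s` with finitely many points. -/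
def interaction (Ψ : Sp d → Sp d → EReal) {S : Set (Sp d)} (A : Set (Sp d)) (s x : Conf S) :
    EReal :=
  ((x.points A).map fun a => ((s.points Aᶜ).map fun b => Ψ a b).sum).sum

/-- The Poisson random point field with intensity `1_A dx` for a bounded Borel set `A ⊆ S`: the
number of points is Poisson distributed with mean `|A|`, and given it equals `n` the points are
`n` independent uniformly distributed points of `A`. -/
def poisson (S A : Set (Sp d)) : Measure (Conf S) :=
  Measure.sum fun n : ℕ =>
    (ENNReal.ofReal (Real.exp (-(volume A).toReal)) / (n.factorial : ℝ≥0∞)) •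
      (Measure.pi fun _ : Fin n => (volume : Measure (Sp d)).restrict A).map (Conf.ofPoints S)

/-- `S_r = {s ∈ S : |s| ≤ b_r}`. -/
def ball (S : Set (Sp d)) (b : ℕ → ℕ) (r : ℕ) : Set (Sp d) := {s ∈ S | ‖s‖ ≤ b r}

/-- The configurations with exactly `m` points in `A`. -/
def exactly (S A : Set (Sp d)) (m : ℕ) : Set (Conf S) := {s | s.count A = (m : ℝ≥0∞)}

/-! ### Quasi-Gibbs and canonical Gibbs measures -/

/-- `(Φ, Ψ)`-quasi Gibbs measures. Here `κ (π_{S_r^c}(s))` is the regular conditional distribution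
of `π_{S_r}` given `π_{S_r^c}(s)` under `ν r k m` (written `μ_{r,k}^m` in the literature). -/
def IsQuasiGibbs (S : Set (Sp d)) (Φ : Sp d → EReal) (Ψ : Sp d → Sp d → EReal)
    (μ : Measure (Conf S)) [IsProbabilityMeasure μ] : Prop :=
  ∃ (b : ℕ → ℕ) (ν : ℕ → ℕ → ℕ → FiniteMeasure (Conf S)), StrictMono b ∧
    ∀ r m : ℕ,
      (∀ k, (ν r k m : Measure (Conf S)) ≤ ν r (k + 1) m) ∧
      Tendsto (fun k => ν r k m) atTop
        (𝓝 (⟨μ.restrict (exactly S (ball S b r) m), inferInstance⟩ :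
          FiniteMeasure (Conf S))) ∧
      ∀ k : ℕ, ∃ (κ : Kernel (Conf S) (Conf S)) (c : Conf S → ℝ≥0),
        IsMarkovKernel κ ∧
        HasCondDistrib (Conf.proj (ball S b r)) (Conf.proj (ball S b r)ᶜ) κ
          (ν r k m : Measure (Conf S)) ∧
        (∀ η, 0 < c η) ∧
        ∀ᵐ s ∂(ν r k m : Measure (Conf S)),
          let η := Conf.proj (ball S b r)ᶜ s
          let base := ((poisson S (ball S b r)).restrict (exactly S (ball S b r) m)).withDensity
            fun x => EReal.exp (-hamiltonian Φ Ψ (ball S b r) x)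
          (c η)⁻¹ • base ≤ κ η ∧ κ η ≤ c η • base

/-- `μ`, carried by configurations with finitely many points, satisfies the DLR equation of
`(Φ, Ψ)`-canonical Gibbs measures for all `S_r` and all particle numbers `m`. -/
def IsCanonicalGibbs (S : Set (Sp d)) (b : ℕ → ℕ) (Φ : Sp d → EReal) (Ψ : Sp d → Sp d → EReal)
    (μ : Measure (Conf S)) : Prop :=
  ∀ r m : ℕ, ∃ κ : Kernel (Conf S) (Conf S),
    IsMarkovKernel κ ∧
    HasCondDistrib (Conf.proj (ball S b r)) (Conf.proj (ball S b r)ᶜ) κ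
      (μ.restrict (exactly S (ball S b r) m)) ∧
    ∀ᵐ s ∂(μ.restrict (exactly S (ball S b r) m)),
      ∃ Z : ℝ≥0∞, 0 < Z ∧ Z < ∞ ∧
        κ (Conf.proj (ball S b r)ᶜ s) =
          Z⁻¹ • ((poisson S (ball S b r)).restrict (exactly S (ball S b r) m)).withDensity
            fun x => EReal.exp
              (-(hamiltonian Φ Ψ (ball S b r) x + interaction Ψ (ball S b r) s x))

/-! ### The finite-particle approximation -/

/-- `Ψ` is real valued and of class `C¹` on `S × S` off the diagonal, with derivative `D`:
it is continuous there, differentiable at interior points, and the derivative extends to the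
continuous function `D`. Since `S` is the closure of its interior, `D` is unique. -/
structure IsC1OffDiag (S : Set (Sp d)) (Ψ : Sp d → Sp d → EReal)
    (D : Sp d × Sp d → (Sp d × Sp d →L[ℝ] ℝ)) : Prop where
  ne_top : ∀ p ∈ S.offDiag, Ψ p.1 p.2 ≠ ⊤
  continuousOn : ContinuousOn (fun p : Sp d × Sp d => (Ψ p.1 p.2).toReal) S.offDiag
  continuousOn_deriv : ContinuousOn D S.offDiag
  hasFDerivAt : ∀ p ∈ (interior S).offDiag,
    HasFDerivAt (fun p : Sp d × Sp d => (Ψ p.1 p.2).toReal) (D p) p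

/-- `μN` is a finite-particle approximation of `μ` by canonical Gibbs measures with potentials
`ΦN`, `ΨN` converging to `Φ`, `Ψ`. -/
structure IsFiniteParticleApprox (S : Set (Sp d)) (b : ℕ → ℕ)
    (Φ : Sp d → EReal) (Ψ : Sp d → Sp d → EReal) (μ : Measure (Conf S))
    (ΦN : ℕ → Sp d → EReal) (ΨN : ℕ → Sp d → Sp d → EReal) (μN : ℕ → Measure (Conf S)) :
    Prop where
  prob : ∀ N, IsProbabilityMeasure (μN N)
  correlation : ∃ (ρ : (n : ℕ) → (Fin n → Sp d) → ℝ≥0)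
      (ρN : ℕ → (n : ℕ) → (Fin n → Sp d) → ℝ≥0),
    (∀ n, IsCorrelation μ n (ρ n)) ∧
    (∀ N n, IsCorrelation (μN N) n (ρN N n)) ∧
    (∀ n, ∀ᵐ x : Fin n → Sp d, (∀ i, x i ∈ S) →
      Tendsto (fun N => ρN N n x) atTop (𝓝 (ρ n x))) ∧
    ∀ r : ℕ, ∃ c δ : ℝ, 0 < c ∧ δ < 1 ∧ ∀ (N n : ℕ) (x : Fin n → Sp d),
      (∀ i, x i ∈ S ∧ ‖x i‖ ≤ r) → (ρN N n x : ℝ) ≤ (c * (n : ℝ) ^ δ) ^ n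
  finite_particles : ∀ N, ∃ n : ℕ, ∀ᵐ s ∂(μN N), s.count S ≤ (n : ℝ≥0∞)
  free_potential : ∀ N, IsFreePotential (ΦN N)
  pair_potential : ∀ N, IsPairPotential (ΨN N)
  canonical : ∀ N, IsCanonicalGibbs S b (ΦN N) (ΨN N) (μN N)
  tendsto_free : ∀ᵐ x : Sp d, x ∈ S → Tendsto (fun N => ΦN N x) atTop (𝓝 (Φ x))
  free_bddBelow : ∃ C : ℝ, ∀ N, ∀ x ∈ S, (C : EReal) ≤ ΦN N x
  tendsto_pair : ∃ (D : Sp d × Sp d → (Sp d × Sp d →L[ℝ] ℝ))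
      (DN : ℕ → Sp d × Sp d → (Sp d × Sp d →L[ℝ] ℝ)),
    IsC1OffDiag S Ψ D ∧ (∀ N, IsC1OffDiag S (ΨN N) (DN N)) ∧
    ∀ K ⊆ S.offDiag, IsCompact K →
      TendstoUniformlyOn (fun N (p : Sp d × Sp d) => (ΨN N p.1 p.2).toReal)
        (fun p => (Ψ p.1 p.2).toReal) atTop K ∧
      TendstoUniformlyOn DN D atTop K
  pair_bddBelow : ∀ r : ℕ, ∃ C : ℝ, ∀ N, ∀ x ∈ ball S b r, ∀ y ∈ ball S b r,
    (C : EReal) ≤ ΨN N x y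

/-! ### Lipschitz control of the differences of interactions -/

/-- `h_{r,s}(x, y) = ∑_{yᵢ ∈ S_s ∖ S_r} (Ψ(x, yᵢ) - Ψ(0, yᵢ))` for bounded sets `Ss`, `Sr`. -/
def interactionDiff (Ψ : Sp d → Sp d → EReal) {S : Set (Sp d)} (Sr Ss : Set (Sp d)) (x : Sp d)
    (y : Conf S) : ℝ :=
  ((y.points (Ss \ Sr)).map fun a => (Ψ x a).toReal - (Ψ 0 a).toReal).sum

/-- `H_{r,k}`: the configurations `y` for which, for all `N` and all `s > r`, the function
`h_{r,s}^N(·, y)` is Lipschitz on `S_r^N` with constant at most `k`. Here `T r N` is `S_r^N`. -/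
def lipschitzSet (S : Set (Sp d)) (ΨN : ℕ → Sp d → Sp d → EReal) (T : ℕ → ℕ → Set (Sp d))
    (r k : ℕ) : Set (Conf S) :=
  {y | ∀ N s : ℕ, r < s → ∀ x ∈ T r N, ∀ x' ∈ T r N, x ≠ x' →
    |interactionDiff (ΨN N) (T r N) (T s N) x y - interactionDiff (ΨN N) (T r N) (T s N) x' y|
      / ‖x - x'‖ ≤ k}

/-- The differences of the interactions are Lipschitz controlled with high probability, along
bounded Borel sets `T r N = S_r^N` that exhaust `S` and approximate `S_r`. -/
def HasLipschitzControl (S : Set (Sp d)) (b : ℕ → ℕ) (ΨN : ℕ → Sp d → Sp d → EReal)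
    (μN : ℕ → Measure (Conf S)) : Prop :=
  ∃ T : ℕ → ℕ → Set (Sp d),
    (∀ r N, MeasurableSet (T r N) ∧ Bornology.IsBounded (T r N)) ∧
    (∀ N, ⋃ r, T r N = S) ∧
    (∀ N r s, r < s → T r N ⊆ T s N) ∧
    (∀ r, Tendsto (fun N => Metric.hausdorffEDist (T r N) (ball S b r)) atTop (𝓝 0)) ∧
    (∀ r, Tendsto (fun N => volume (ball S b r \ T r N)) atTop (𝓝 0)) ∧
    ∀ r, Tendsto (fun k => liminf (fun N => μN N (lipschitzSet S ΨN T r k)) atTop) atTop (𝓝 1)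

end QuasiGibbs

end

/-!
The measures `μ_{r,k}^m` are limits of finite-particle measures. For fixed `r`, `m` write
`A = S_r`, `T_N = S_r^N`, and let `G_{N,k}` be the set of configurations outside `A` whose points
generate a field `x ↦ ∑ⱼ Ψ^N(x, sⱼ)` that is Lipschitz with constant `k` on `A ∩ T_N`. Under
`μ^N`, restricted to the event that `A` has `m` points and that the outside configuration belongs
to `G_{N,k}`, the interaction of `m` points of `A ∩ T_N` with the outside oscillates by at most
`2 m k b_r`. The canonical DLR equation therefore compares the conditional law of the inside
configuration with the Gibbs weight `exp (-H_r) dΛ_r` of the potentials `Φ^N`, `Ψ^N`, up to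
normalisation and with a constant independent of `N` and of the outside configuration
(`measure_cross_mul_le`).

Three facts allow to pass to the limit in this comparison.

* The bound on the correlation functions makes the factorial moments of the numbers of points
  in bounded sets converge and determine their joint law; hence `μ^N(B) → μ(B)` for every cylinder
  event `B`, that is, for every event defined by the numbers of points in finitely many bounded
  Borel sets (`IsFiniteParticleApprox.tendsto_measure_num`).
* On cylinder events the restricted measures converge along a fixed ultrafilter on the `N`. The
  limit is dominated by `μ(· ∩ S_r^m)`, so it is continuous at `∅` and extends to a measure by
  Carathéodory's theorem (`exists_measure_tendsto_ultrafilter`). Using one ultrafilter for all `k`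
  makes the limits monotone in `k`, and no compactness of the space of configurations is needed.
* The Gibbs weights converge on every event by dominated convergence
  (`PotentialsConverge.tendsto_gibbs`), and configurations with points in `A ∆ T_N` are negligible
  since `|A ∆ T_N| → 0`.

The limiting inequality holds for products of cylinder events; these determine measures, so the
joint law of the inside and the outside configuration is comparable to the product of the Gibbs
weight and the law of the outside configuration. Its density with respect to this product yields
a conditional distribution with the required two-sided bound
(`exists_condDistrib_of_comparable`).

The assumption on the events `H_{r,k}` enters once more to see that no mass is lost as `k → ∞`:
a finite configuration of `H_{r,k}` without points in `A ∆ T_N` has its outside part in `G_{N,k}`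
(`proj_mem_lipschitzField`). The masses of the limits thus increase to `μ(S_r^m)`, and
domination turns this into weak convergence (`tendsto_finiteMeasure_of_le`).
-/

noncomputable section

namespace QuasiGibbs

variable {d : ℕ}

/-! ### Algebras of cylinder sets, limits of measures and conditional distributions -/

section Generic

variable {X : Type*}

/-- The sets defined by a condition on finitely many of the `ℕ`-valued functions in `𝓕`. -/
def cylinders (𝓕 : Set (X → ℕ)) : Set (Set X) :=
  {B | ∃ (p : ℕ) (f : Fin p → X → ℕ) (E : Set (Fin p → ℕ)),
    (∀ i, f i ∈ 𝓕) ∧ B = {x | (fun i => f i x) ∈ E}}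

lemma isSetAlgebra_cylinders (𝓕 : Set (X → ℕ)) : IsSetAlgebra (cylinders 𝓕) where
  empty_mem := ⟨0, Fin.elim0, ∅, fun i => i.elim0, by simp⟩
  compl_mem := by
    rintro _ ⟨p, f, E, hf, rfl⟩
    exact ⟨p, f, Eᶜ, hf, rfl⟩
  union_mem := by
    rintro _ _ ⟨p, f, E, hf, rfl⟩ ⟨q, g, E', hg, rfl⟩
    refine ⟨p + q, Fin.append f g,
      {v | (fun i => v (Fin.castAdd q i)) ∈ E ∨ (fun i => v (Fin.natAdd p i)) ∈ E'}, ?_, ?_⟩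
    · intro i
      refine Fin.addCases (fun i => ?_) (fun i => ?_) i
      · simpa using hf i
      · simpa using hg i
    · ext x
      simp

variable [mX : MeasurableSpace X]

lemma measure_le_of_isSetAlgebra {𝒜 : Set (Set X)} (h𝒜 : IsSetAlgebra 𝒜)
    (hgen : mX = MeasurableSpace.generateFrom 𝒜) (P Q : Measure X) [IsFiniteMeasure P]
    [IsFiniteMeasure Q] (h : ∀ B ∈ 𝒜, P B ≤ Q B) : P ≤ Q := by
  refine Measure.le_iff.2 fun s hs => ?_
  have hd := Measure.MeasureDense.of_generateFrom_isSetAlgebra_finite (μ := P + Q) h𝒜 hgen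
  refine ENNReal.le_of_forall_pos_le_add fun ε hε _ => ?_
  have hε2 : (0 : ℝ) < ε / 2 := by positivity
  obtain ⟨t, ht, hst⟩ := hd.approx s hs (measure_ne_top _ _) (ε / 2) hε2
  have e1 : P (s \ t) ≤ ENNReal.ofReal (ε / 2) := by
    refine (measure_mono (t := symmDiff s t) fun x hx => Or.inl hx).trans (le_trans ?_ hst.le)
    simp
  have e2 : Q (t \ s) ≤ ENNReal.ofReal (ε / 2) := by
    refine (measure_mono (t := symmDiff s t) fun x hx => Or.inr hx).trans (le_trans ?_ hst.le)
    simp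
  have e3 : ENNReal.ofReal (ε / 2) + ENNReal.ofReal (ε / 2) = (ε : ℝ≥0∞) := by
    rw [← ENNReal.ofReal_add hε2.le hε2.le, add_halves, ENNReal.ofReal_coe_nnreal]
  calc P s ≤ P (t ∪ s \ t) := measure_mono fun x hx => by
          by_cases hxt : x ∈ t
          · exact Or.inl hxt
          · exact Or.inr ⟨hx, hxt⟩
    _ ≤ P t + P (s \ t) := measure_union_le _ _
    _ ≤ Q t + ENNReal.ofReal (ε / 2) := add_le_add (h t ht) e1
    _ ≤ Q (s ∪ t \ s) + ENNReal.ofReal (ε / 2) := by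
        gcongr
        intro x hx
        by_cases hxt : x ∈ s
        · exact Or.inl hxt
        · exact Or.inr ⟨hx, hxt⟩
    _ ≤ Q s + ENNReal.ofReal (ε / 2) + ENNReal.ofReal (ε / 2) := by
        gcongr
        exact (measure_union_le _ _).trans (add_le_add le_rfl e2)
    _ = Q s + ε := by rw [add_assoc, e3]

/-- Two finite measures can be compared on the events `{f₁ = n₁, …, f_p = n_p}`, since every
cylinder set is a countable disjoint union of such events. -/
lemma measure_le_of_cylinders {𝓕 : Set (X → ℕ)}
    (hgen : mX = MeasurableSpace.generateFrom (cylinders 𝓕)) (P Q : Measure X)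
    [IsFiniteMeasure P] [IsFiniteMeasure Q]
    (h : ∀ (p : ℕ) (f : Fin p → X → ℕ) (v : Fin p → ℕ), (∀ i, f i ∈ 𝓕) →
      P {x | (fun i => f i x) = v} ≤ Q {x | (fun i => f i x) = v}) : P ≤ Q := by
  refine measure_le_of_isSetAlgebra (isSetAlgebra_cylinders 𝓕) hgen P Q ?_
  rintro _ ⟨p, f, E, hf, rfl⟩
  have hm : ∀ v : Fin p → ℕ, MeasurableSet {x | (fun i => f i x) = v} := fun v => by
    rw [hgen]
    exact MeasurableSpace.measurableSet_generateFrom ⟨p, f, {v}, hf, rfl⟩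
  have hU : {x | (fun i => f i x) ∈ E} = ⋃ v : E, {x | (fun i => f i x) = (v : Fin p → ℕ)} := by
    ext x
    simp
  have hdisj : Pairwise (Function.onFun Disjoint
      fun v : E => {x | (fun i => f i x) = (v : Fin p → ℕ)}) := by
    intro v w hvw
    refine Set.disjoint_left.2 fun x hx hx' => hvw (Subtype.ext ?_)
    exact (show _ = _ from hx).symm.trans hx'
  rw [hU, measure_iUnion hdisj fun v => hm v, measure_iUnion hdisj fun v => hm v]
  exact ENNReal.tsum_le_tsum fun v => h p f v hf

/-- If the limits of the measures `P N` along an ultrafilter are dominated on an algebra by a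
finite measure, then these limits define a measure: the domination gives the continuity at `∅`
that Carathéodory's theorem needs. -/
lemma exists_measure_tendsto_ultrafilter {𝒜 : Set (Set X)} (h𝒜 : IsSetAlgebra 𝒜)
    (hgen : mX = MeasurableSpace.generateFrom 𝒜) (U : Ultrafilter ℕ) (P : ℕ → Measure X)
    (Q : Measure X) [IsFiniteMeasure Q]
    (h : ∀ B ∈ 𝒜, ∀ l, Tendsto (fun N => P N B) U (𝓝 l) → l ≤ Q B) :
    ∃ ν : Measure X, ∀ B ∈ 𝒜, Tendsto (fun N => P N B) U (𝓝 (ν B)) := by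
  have hmeas : ∀ B ∈ 𝒜, MeasurableSet B := fun B hB => by
    rw [hgen]; exact MeasurableSpace.measurableSet_generateFrom hB
  let l : Set X → ℝ≥0∞ := fun B => (U.map fun N => P N B).lim
  have hl : ∀ B, Tendsto (fun N => P N B) U (𝓝 (l B)) := fun B =>
    (U.map fun N => P N B).le_nhds_lim
  let M : AddContent ℝ≥0∞ 𝒜 := h𝒜.isSetRing.addContent_of_union l
    (tendsto_nhds_unique (hl ∅) (by simp)) (by
      intro s t hs ht hst
      refine tendsto_nhds_unique (hl _) (((hl s).add (hl t)).congr fun N => ?_)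
      exact (measure_union hst (hmeas t ht)).symm)
  have hM : ∀ B, M B = l B := fun B => rfl
  have hMle : ∀ B ∈ 𝒜, M B ≤ Q B := fun B hB => h B hB _ (hl B)
  have hsub : M.IsSigmaSubadditive := by
    refine isSigmaSubadditive_of_addContent_iUnion_eq_tsum h𝒜.isSetRing ?_
    intro f hf hfU hdisj
    refine addContent_iUnion_eq_sum_of_tendsto_zero h𝒜.isSetRing M
      (fun s hs => ne_top_of_le_ne_top (measure_ne_top Q s) (hMle s hs)) ?_ hf hfU hdisj
    intro s hs hanti hemp
    have h0 : Tendsto (fun n => Q (s n)) atTop (𝓝 0) := by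
      have := tendsto_measure_iInter_atTop (μ := Q)
        (fun n => (hmeas _ (hs n)).nullMeasurableSet) hanti ⟨0, measure_ne_top _ _⟩
      simpa [hemp, Function.comp_def] using this
    exact tendsto_of_tendsto_of_tendsto_of_le_of_le tendsto_const_nhds h0
      (fun n => zero_le) (fun n => hMle _ (hs n))
  refine ⟨M.measure h𝒜.isSetRing.isSetSemiring hgen.le hsub, fun B hB => ?_⟩
  rw [AddContent.measure_eq M h𝒜.isSetRing.isSetSemiring hgen hsub hB]
  exact hl B

end Generic

/-- If `w` varies on `E` at most by a factor `C`, then the normalised integrals of `h` and of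
`h * w` over subsets of `E` differ at most by this factor. -/
lemma lintegral_cross_mul_le {Y : Type*} [MeasurableSpace Y] (lam : Measure Y) {D E : Set Y}
    (hD : MeasurableSet D) (hE : MeasurableSet E) {h w : Y → ℝ≥0∞}
    (hh : AEMeasurable h lam) (hw : AEMeasurable (fun y => h y * w y) lam) {C : ℝ≥0∞}
    (hC : ∀ x ∈ D, ∀ y ∈ E, w x ≤ C * w y) :
    (∫⁻ x in D, h x * w x ∂lam) * ∫⁻ y in E, h y ∂lam ≤
      C * ((∫⁻ x in D, h x ∂lam) * ∫⁻ y in E, h y * w y ∂lam) := by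
  rw [← lintegral_mul_const'' _ hw.restrict, ← lintegral_mul_const'' _ hh.restrict,
    ← lintegral_const_mul'' C (hh.restrict.mul_const _)]
  refine setLIntegral_mono_ae' hD (Filter.Eventually.of_forall fun x hx => ?_)
  rw [← lintegral_const_mul'' _ hh.restrict, ← lintegral_const_mul'' _ hw.restrict,
    ← lintegral_const_mul'' _ (hw.restrict.const_mul _)]
  refine setLIntegral_mono_ae' hE (Filter.Eventually.of_forall fun y hy => ?_)
  calc h x * w x * h y = h x * h y * w x := by ring
    _ ≤ h x * h y * (C * w y) := by gcongr; exact hC x hx y hy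
    _ = C * (h x * (h y * w y)) := by ring

/-- If the joint law of `X` and `Y` is comparable to the product of the law of `X` with a measure
`base`, then its density gives a conditional distribution of `Y` given `X` that is comparable to
`base`. -/
lemma exists_condDistrib_of_comparable {Ω 𝓧 𝓨 : Type*} [MeasurableSpace Ω] [MeasurableSpace 𝓧]
    [MeasurableSpace 𝓨] [Nonempty 𝓨] {X : Ω → 𝓧} {Y : Ω → 𝓨} (hX : Measurable X)
    (hY : Measurable Y) (ν : Measure Ω) [IsFiniteMeasure ν] (base : Measure 𝓨)
    [IsFiniteMeasure base] {a : ℝ≥0} (ha : a ≠ 0)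
    (h1 : ν.map (fun ω => (X ω, Y ω)) ≤ a • (ν.map X).prod base)
    (h2 : (ν.map X).prod base ≤ a • ν.map (fun ω => (X ω, Y ω))) :
    ∃ κ : Kernel 𝓧 𝓨, IsMarkovKernel κ ∧ HasCondDistrib Y X κ ν ∧
      ∀ᵐ ω ∂ν, a⁻¹ • base ≤ κ (X ω) ∧ κ (X ω) ≤ a • base := by
  have hXY : Measurable fun ω => (X ω, Y ω) := hX.prodMk hY
  set J := ν.map (fun ω => (X ω, Y ω)) with hJ
  set q := ν.map X with hq
  have : IsFiniteMeasure J := Measure.isFiniteMeasure_map _ _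
  have : IsFiniteMeasure q := Measure.isFiniteMeasure_map _ _
  have hac : J ≪ q.prod base :=
    (Measure.absolutelyContinuous_of_le h1).trans Measure.smul_absolutelyContinuous
  set p := J.rnDeriv (q.prod base) with hp
  have hpm : Measurable p := Measure.measurable_rnDeriv _ _
  have hJp : ∀ s, ∫⁻ z in s, p z ∂(q.prod base) = J s := fun s =>
    Measure.setLIntegral_rnDeriv hac s
  have hpa : ∀ᵐ z ∂(q.prod base), p z ≤ a := by
    refine ae_le_of_forall_setLIntegral_le_of_sigmaFinite hpm fun s hs _ => ?_
    rw [hJp, setLIntegral_const]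
    exact h1 s
  have hap : ∀ᵐ z ∂(q.prod base), (a : ℝ≥0∞)⁻¹ ≤ p z := by
    refine ae_le_of_forall_setLIntegral_le_of_sigmaFinite measurable_const fun s hs _ => ?_
    rw [hJp, setLIntegral_const, mul_comm, ← div_eq_mul_inv]
    refine ENNReal.div_le_of_le_mul' ?_
    exact h2 s
  have hone : ∀ᵐ η ∂q, ∫⁻ y, p (η, y) ∂base = 1 := by
    refine ae_eq_of_forall_setLIntegral_eq_of_sigmaFinite hpm.lintegral_prod_right'
      measurable_const fun s hs _ => ?_
    have : ∫⁻ η in s, ∫⁻ y, p (η, y) ∂base ∂q = J (s ×ˢ univ) := by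
      rw [← hJp, ← Measure.prod_restrict, Measure.restrict_univ,
        lintegral_prod _ hpm.aemeasurable]
    rw [this, setLIntegral_one, hJ, Measure.map_apply hXY (hs.prod MeasurableSet.univ), hq,
      Measure.map_apply hX hs]
    congr 1
    ext ω
    simp
  classical
  let good : Set 𝓧 := {η | ∫⁻ y, p (η, y) ∂base = 1}
  have hgood : MeasurableSet good :=
    hpm.lintegral_prod_right' (measurableSet_singleton 1)
  let y0 : 𝓨 := Classical.arbitrary 𝓨
  let κ : Kernel 𝓧 𝓨 := Kernel.piecewise hgood
    (Kernel.withDensity (Kernel.const 𝓧 base) fun η y => p (η, y))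
    (Kernel.const 𝓧 (Measure.dirac y0))
  have hκ : ∀ η ∈ good, κ η = base.withDensity fun y => p (η, y) := fun η hη => by
    simp only [κ, Kernel.piecewise_apply, if_pos hη]
    rw [Kernel.withDensity_apply (f := fun η y => p (η, y)) _ hpm, Kernel.const_apply]
  have hκ' : ∀ η ∉ good, κ η = Measure.dirac y0 := fun η hη => by
    simp only [κ, Kernel.piecewise_apply, if_neg hη, Kernel.const_apply]
  have hMarkov : IsMarkovKernel κ := ⟨fun η => by
    by_cases hη : η ∈ good
    · rw [hκ η hη]
      exact ⟨by rw [withDensity_apply _ MeasurableSet.univ, Measure.restrict_univ]; exact hη⟩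
    · rw [hκ' η hη]; infer_instance⟩
  refine ⟨κ, hMarkov, ⟨hXY.aemeasurable, ?_⟩, ?_⟩
  · change J = q ⊗ₘ κ
    ext s hs
    rw [Measure.compProd_apply hs, ← hJp s, ← lintegral_indicator hs,
      lintegral_prod _ (hpm.indicator hs).aemeasurable]
    refine lintegral_congr_ae ?_
    filter_upwards [hone] with η hη
    rw [hκ η hη, withDensity_apply _ (measurable_prodMk_left hs),
      ← lintegral_indicator (measurable_prodMk_left hs)]
    rfl
  · have hae : ∀ᵐ η ∂q, a⁻¹ • base ≤ κ η ∧ κ η ≤ a • base := by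
      filter_upwards [hone, Measure.ae_ae_of_ae_prod hpa, Measure.ae_ae_of_ae_prod hap]
        with η hη hη1 hη2
      rw [hκ η hη]
      constructor
      · refine Measure.le_iff.2 fun s hs => ?_
        rw [withDensity_apply _ hs]
        refine le_trans ?_ (lintegral_mono_ae (ae_restrict_of_ae hη2))
        rw [setLIntegral_const, Measure.smul_apply, ENNReal.smul_def, smul_eq_mul,
          ENNReal.coe_inv ha]
      · refine Measure.le_iff.2 fun s hs => ?_
        rw [withDensity_apply _ hs]
        refine (lintegral_mono_ae (ae_restrict_of_ae hη1)).trans ?_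
        rw [setLIntegral_const, Measure.smul_apply, ENNReal.smul_def, smul_eq_mul]
    exact ae_of_ae_map hX.aemeasurable hae

/-! ### The Borel structure of the configuration space -/

namespace Conf

variable {S : Set (Sp d)}

lemma finite_inter_of_isBounded (s : Conf S) {A : Set (Sp d)} (hA : Bornology.IsBounded A) :
    {x | x ∈ A ∧ s.mult x ≠ 0}.Finite := by
  obtain ⟨R, hR⟩ := hA.exists_norm_le
  obtain ⟨n, hn⟩ := exists_nat_ge R
  exact (s.finite_ball n).subset fun x hx => ⟨hx.2, (hR x hx.1).trans hn⟩

/-- The configuration `∑ᵢ δ_{sᵢ}` as a measure. -/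
def toMeasure (s : Conf S) : Measure (Sp d) :=
  Measure.sum fun x => (s.mult x : ℝ≥0∞) • Measure.dirac x

lemma lintegral_toMeasure (s : Conf S) (f : Sp d → ℝ≥0∞) :
    ∫⁻ x, f x ∂s.toMeasure = ∑' x, (s.mult x : ℝ≥0∞) * f x := by
  simp [toMeasure, lintegral_sum_measure, lintegral_smul_measure, lintegral_dirac]

lemma toMeasure_apply (s : Conf S) {A : Set (Sp d)} (hA : MeasurableSet A) :
    s.toMeasure A = ∑' x, A.indicator (fun x => (s.mult x : ℝ≥0∞)) x := by
  rw [toMeasure, Measure.sum_apply _ hA]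
  refine tsum_congr fun x => ?_
  by_cases hx : x ∈ A <;> simp [hA, hx]

lemma count_eq_tsum_indicator (s : Conf S) (A : Set (Sp d)) :
    s.count A = ∑' x, A.indicator (fun x => (s.mult x : ℝ≥0∞)) x :=
  tsum_subtype A fun x => (s.mult x : ℝ≥0∞)

lemma toMeasure_eq_count (s : Conf S) {A : Set (Sp d)} (hA : MeasurableSet A) :
    s.toMeasure A = s.count A := by
  rw [toMeasure_apply s hA, count_eq_tsum_indicator]

lemma count_ne_top_of_finite (s : Conf S) {A : Set (Sp d)}
    (hA : {x | x ∈ A ∧ s.mult x ≠ 0}.Finite) : s.count A ≠ ∞ := by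
  rw [count_eq_tsum_indicator, tsum_eq_sum (s := hA.toFinset)]
  · refine ENNReal.sum_ne_top.2 fun x _ => ?_
    by_cases hx : x ∈ A <;> simp [hx]
  · intro x hx
    by_cases hxA : x ∈ A
    · have : s.mult x = 0 := by
        by_contra h
        exact hx (by simpa using ⟨hxA, h⟩)
      simp [this]
    · simp [hxA]

lemma count_ne_top (s : Conf S) {A : Set (Sp d)} (hA : Bornology.IsBounded A) :
    s.count A ≠ ∞ := s.count_ne_top_of_finite (s.finite_inter_of_isBounded hA)

lemma finite_support_mul (s : Conf S) {f : Sp d → ℝ} (hf : HasCompactSupport f) :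
    (Function.support fun x => (s.mult x : ℝ) * f x).Finite := by
  refine (s.finite_inter_of_isBounded hf.isCompact.isBounded).subset fun x hx => ?_
  rw [Function.mem_support] at hx
  refine ⟨subset_tsupport _ (right_ne_zero_of_mul hx), fun h => hx (by simp [h])⟩

lemma lintegral_ofReal_eq (s : Conf S) (f : C_c(Sp d, ℝ)) (hf : ∀ x, 0 ≤ f x) :
    ∫⁻ x, ENNReal.ofReal (f x) ∂s.toMeasure = ENNReal.ofReal (s.pairing f) := by
  have hfin := s.finite_support_mul f.hasCompactSupport
  rw [lintegral_toMeasure, pairing, finsum_eq_sum _ hfin, tsum_eq_sum (s := hfin.toFinset),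
    ENNReal.ofReal_sum_of_nonneg fun x _ => mul_nonneg (Nat.cast_nonneg _) (hf x)]
  · refine Finset.sum_congr rfl fun x _ => ?_
    rw [ENNReal.ofReal_mul (Nat.cast_nonneg _), ENNReal.ofReal_natCast]
  · intro x hx
    have h0 : (s.mult x : ℝ) * f x = 0 := by
      by_contra h
      exact hx (hfin.mem_toFinset.2 h)
    rcases mul_eq_zero.1 h0 with h | h
    · have : s.mult x = 0 := by exact_mod_cast h
      simp [this]
    · simp [h]

lemma pairing_eq (s : Conf S) (f : C_c(Sp d, ℝ)) :
    s.pairing f = (∫⁻ x, ENNReal.ofReal (f x) ∂s.toMeasure).toReal -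
      (∫⁻ x, ENNReal.ofReal (-f x) ∂s.toMeasure).toReal := by
  let p : C_c(Sp d, ℝ) := f.compLeft ⟨fun t : ℝ => max t 0, by fun_prop⟩
  let q : C_c(Sp d, ℝ) := (-f).compLeft ⟨fun t : ℝ => max t 0, by fun_prop⟩
  have hp : ∀ x, p x = max (f x) 0 := fun x =>
    CompactlySupportedContinuousMap.compLeft_apply (by simp) f x
  have hq : ∀ x, q x = max (-f x) 0 := fun x =>
    CompactlySupportedContinuousMap.compLeft_apply (by simp) (-f) x
  have h0 : ∀ (g : C_c(Sp d, ℝ)), (∀ x, 0 ≤ g x) → 0 ≤ s.pairing g := fun g hg =>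
    finsum_nonneg fun x => mul_nonneg (Nat.cast_nonneg _) (hg x)
  have e1 : ∫⁻ x, ENNReal.ofReal (f x) ∂s.toMeasure = ENNReal.ofReal (s.pairing p) := by
    rw [← lintegral_ofReal_eq s p fun x => by simp [hp]]
    refine lintegral_congr fun x => ?_
    simp [hp]
  have e2 : ∫⁻ x, ENNReal.ofReal (-f x) ∂s.toMeasure = ENNReal.ofReal (s.pairing q) := by
    rw [← lintegral_ofReal_eq s q fun x => by simp [hq]]
    refine lintegral_congr fun x => ?_
    simp [hq]
  rw [e1, e2, ENNReal.toReal_ofReal (h0 p fun x => by simp [hp]),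
    ENNReal.toReal_ofReal (h0 q fun x => by simp [hq]), pairing, pairing, pairing,
    ← finsum_sub_distrib (s.finite_support_mul p.hasCompactSupport)
      (s.finite_support_mul q.hasCompactSupport)]
  refine finsum_congr fun x => ?_
  rw [hp, hq, ← mul_sub]
  congr 1
  rcases le_total 0 (f x) with h | h
  · rw [max_eq_left h, max_eq_right (by linarith)]; ring
  · rw [max_eq_right h, max_eq_left (by linarith)]; ring

lemma continuous_pairing (f : C_c(Sp d, ℝ)) : Continuous fun s : Conf S => s.pairing f :=
  (continuous_apply f).comp
    (continuous_induced_dom (f := fun (s : Conf S) (f : C_c(Sp d, ℝ)) => s.pairing f))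

lemma measurable_count_of_isOpen {V : Set (Sp d)} (hV : IsOpen V)
    (hb : Bornology.IsBounded V) : Measurable fun s : Conf S => s.toMeasure V := by
  obtain ⟨F, hFc, hFV, hFU, hFm⟩ := hV.exists_iUnion_isClosed
  have hK : ∀ n, IsCompact (F n) := fun n =>
    Metric.isCompact_of_isClosed_isBounded (hFc n) (hb.subset (hFV n))
  choose g hg1 hg0 hgc hg01 using fun n => exists_continuous_one_zero_of_isCompact (hK n)
    hV.isClosed_compl (disjoint_compl_right_iff_subset.2 (hFV n))
  let f : ℕ → C_c(Sp d, ℝ) := fun n => ⟨g n, hgc n⟩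
  have key : (fun s : Conf S => s.toMeasure V) =
      fun s : Conf S => ⨆ n, ENNReal.ofReal (s.pairing (f n)) := by
    funext s
    refine le_antisymm ?_ (iSup_le fun n => ?_)
    · rw [← hFU, hFm.measure_iUnion]
      refine iSup_mono fun n => ?_
      rw [← lintegral_ofReal_eq s (f n) fun x => (hg01 n x).1,
        ← lintegral_indicator_one (hFc n).measurableSet]
      refine lintegral_mono fun x => ?_
      by_cases hx : x ∈ F n
      · have : (f n) x = 1 := hg1 n hx
        simp [hx, this]
      · simp [hx]
    · rw [← lintegral_ofReal_eq s (f n) fun x => (hg01 n x).1,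
        ← lintegral_indicator_one hV.measurableSet]
      refine lintegral_mono fun x => ?_
      by_cases hx : x ∈ V
      · have : (f n) x ≤ 1 := (hg01 n x).2
        simpa [hx] using this
      · have : (f n) x = 0 := hg0 n hx
        simp [hx, this]
  rw [key]
  exact Measurable.iSup fun n => (continuous_pairing (f n)).measurable.ennreal_ofReal

lemma toMeasure_eq_iSup (s : Conf S) (A : Set (Sp d)) :
    s.toMeasure A = ⨆ n : ℕ, s.toMeasure (A ∩ Metric.ball 0 n) := by
  have hm : Monotone fun n : ℕ => A ∩ Metric.ball (0 : Sp d) n := fun m n hmn =>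
    inter_subset_inter_right _ (Metric.ball_subset_ball (by exact_mod_cast hmn))
  rw [← hm.measure_iUnion, ← inter_iUnion, Metric.iUnion_ball_nat, inter_univ]

lemma measurable_toMeasure : Measurable (toMeasure : Conf S → Measure (Sp d)) := by
  refine Measure.measurable_of_measurable_coe _ fun A hA => ?_
  have h : ∀ n : ℕ, Measurable fun s : Conf S =>
      s.toMeasure.restrict (Metric.ball (0 : Sp d) n) := by
    intro n
    have hfin : ∀ s : Conf S, IsFiniteMeasure (s.toMeasure.restrict (Metric.ball (0 : Sp d) n)) :=
      fun s => ⟨by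
        rw [Measure.restrict_apply_univ, toMeasure_eq_count s Metric.isOpen_ball.measurableSet]
        exact (s.count_ne_top Metric.isBounded_ball).lt_top⟩
    refine Measurable.measure_of_isPiSystem (S := {V | IsOpen V})
      (BorelSpace.measurable_eq (α := Sp d)) isPiSystem_isOpen ?_ ?_
    · intro V hV
      have hV' : IsOpen V := hV
      simp_rw [Measure.restrict_apply hV'.measurableSet]
      exact measurable_count_of_isOpen (hV'.inter Metric.isOpen_ball)
        (Metric.isBounded_ball.subset inter_subset_right)
    · simp_rw [Measure.restrict_apply_univ]
      exact measurable_count_of_isOpen Metric.isOpen_ball Metric.isBounded_ball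
  simp_rw [toMeasure_eq_iSup _ A]
  refine Measurable.iSup fun n => ?_
  have := (Measure.measurable_coe hA).comp (h n)
  simpa [Function.comp_def, Measure.restrict_apply hA] using this

lemma measurable_count {A : Set (Sp d)} (hA : MeasurableSet A) :
    Measurable fun s : Conf S => s.count A := by
  simp_rw [← toMeasure_eq_count _ hA]
  exact (Measure.measurable_coe hA).comp measurable_toMeasure

lemma measurable_pairing_comap (f : C_c(Sp d, ℝ)) :
    Measurable[MeasurableSpace.comap toMeasure inferInstance]
      fun s : Conf S => s.pairing f := by
  have hm : Measurable[MeasurableSpace.comap toMeasure inferInstance]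
      (toMeasure : Conf S → Measure (Sp d)) := comap_measurable _
  simp_rw [pairing_eq]
  refine Measurable.sub ?_ ?_
  · exact ((Measure.measurable_lintegral
      f.continuous.measurable.ennreal_ofReal).comp hm).ennreal_toReal
  · exact ((Measure.measurable_lintegral
      f.continuous.measurable.neg.ennreal_ofReal).comp hm).ennreal_toReal

/-- The pairings with functions vanishing outside a fixed ball can be approximated uniformly, on
configurations with a bounded number of points in a larger ball, by countably many of them. Hence
countably many pairings induce the vague topology. -/
lemma exists_countable_inducing : ∃ f : ℕ → C_c(Sp d, ℝ),
    Topology.IsInducing fun (s : Conf S) (n : ℕ) => s.pairing (f n) := by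
  let V : ℕ → Set C(Sp d, ℝ) := fun R =>
    {g | ∀ x, x ∉ Metric.closedBall (0 : Sp d) R → g x = 0}
  have hne : ∀ R, Nonempty (V R) := fun R => ⟨⟨0, fun _ _ => rfl⟩⟩
  let toC : (R : ℕ) → V R → C_c(Sp d, ℝ) := fun R g =>
    ⟨g.1, HasCompactSupport.intro (isCompact_closedBall (0 : Sp d) R) g.2⟩
  have hχ : ∀ R : ℕ, ∃ g : C_c(Sp d, ℝ), (∀ x ∈ Metric.closedBall (0 : Sp d) R, g x = 1) ∧
      ∀ x, 0 ≤ g x := fun R => by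
    obtain ⟨g, h1, -, hc, h01⟩ := exists_continuous_one_zero_of_isCompact
      (isCompact_closedBall (0 : Sp d) R) isClosed_empty (disjoint_empty _)
    exact ⟨⟨g, hc⟩, h1, fun x => (h01 x).1⟩
  choose χ hχ1 hχ0 using hχ
  let fam : (ℕ × ℕ) ⊕ ℕ → C_c(Sp d, ℝ) :=
    Sum.elim (fun p => toC p.1 (TopologicalSpace.denseSeq (V p.1) p.2)) χ
  obtain ⟨e⟩ : Nonempty (ℕ ≃ (ℕ × ℕ) ⊕ ℕ) := ⟨(nonempty_denumerable _).some.eqv.symm⟩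
  let G : Conf S → ℕ → ℝ := fun s n => s.pairing (fam (e n))
  refine ⟨fun n => fam (e n), ⟨le_antisymm ?_ ?_⟩⟩
  · exact continuous_iff_le_induced.1 (continuous_pi fun n => continuous_pairing _)
  · let t : TopologicalSpace (Conf S) := TopologicalSpace.induced G inferInstance
    have hGc : ∀ i, Continuous[t, _] fun s : Conf S => s.pairing (fam i) := fun i => by
      have h1 : Continuous[t, _] G := continuous_induced_dom
      have h2 := (continuous_apply (A := fun _ : ℕ => ℝ) (e.symm i)).comp h1
      simpa [G, Function.comp_def] using h2
    have hcont : ∀ f : C_c(Sp d, ℝ), Continuous[t, _] fun s : Conf S => s.pairing f := by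
      intro f
      obtain ⟨R, hR⟩ : ∃ R : ℕ, ∀ x, x ∉ Metric.closedBall (0 : Sp d) R → f x = 0 := by
        obtain ⟨r, hr⟩ := f.hasCompactSupport.isCompact.isBounded.subset_closedBall 0
        obtain ⟨n, hn⟩ := exists_nat_ge r
        refine ⟨n, fun x hx => image_eq_zero_of_notMem_tsupport fun h => hx ?_⟩
        exact Metric.closedBall_subset_closedBall hn (hr h)
      let fV : V R := ⟨f.toContinuousMap, hR⟩
      have happ : ∀ ε > 0, ∃ n, ∀ x, |f x - toC R (TopologicalSpace.denseSeq (V R) n) x| ≤ ε := by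
        intro ε hε
        have hcl : fV ∈ closure (range (TopologicalSpace.denseSeq (V R))) :=
          TopologicalSpace.denseRange_denseSeq (V R) fV
        obtain ⟨u, hu, hlim⟩ := mem_closure_iff_seq_limit.1 hcl
        have hlim' : Tendsto (fun n => (u n).1) atTop (𝓝 fV.1) :=
          (continuous_subtype_val.tendsto fV).comp hlim
        have hun := ContinuousMap.tendsto_iff_forall_isCompact_tendstoUniformlyOn.1 hlim'
          (Metric.closedBall 0 R) (isCompact_closedBall _ _)
        obtain ⟨m, hm⟩ := ((Metric.tendstoUniformlyOn_iff.1 hun) ε hε).exists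
        obtain ⟨n, hn⟩ := hu m
        refine ⟨n, fun x => ?_⟩
        rw [hn]
        by_cases hx : x ∈ Metric.closedBall (0 : Sp d) R
        · exact (hm x hx).le
        · have h1 : f x = 0 := hR x hx
          have h2 : toC R (u m) x = 0 := (u m).2 x hx
          simp [h1, h2, hε.le]
      refine continuous_iff_continuousAt.2 fun s₀ => ?_
      rw [ContinuousAt, Metric.tendsto_nhds]
      intro ε hε
      set M := s₀.pairing (χ R) + 1 with hM
      have hMpos : 0 < M := by
        have : 0 ≤ s₀.pairing (χ R) := finsum_nonneg fun x =>
          mul_nonneg (Nat.cast_nonneg _) (hχ0 R x)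
        linarith
      have hε' : 0 < ε / (4 * M) := by positivity
      obtain ⟨n, hn⟩ := happ _ hε'
      set g := toC R (TopologicalSpace.denseSeq (V R) n) with hg
      have hdiff : ∀ s : Conf S, |s.pairing f - s.pairing g| ≤ ε / (4 * M) * s.pairing (χ R) := by
        intro s
        have hfin := s.finite_support_mul (χ R).hasCompactSupport
        have hfs : ∀ (φ : C_c(Sp d, ℝ)), (∀ x, x ∉ Metric.closedBall (0 : Sp d) R → φ x = 0) →
            s.pairing φ = ∑ x ∈ hfin.toFinset, (s.mult x : ℝ) * φ x := by
          intro φ hφ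
          refine finsum_eq_sum_of_support_subset _ fun x hx => ?_
          rw [Function.mem_support] at hx
          have hxR : x ∈ Metric.closedBall (0 : Sp d) R := by
            by_contra h
            exact hx (by simp [hφ x h])
          simp only [Finite.coe_toFinset, Function.mem_support, hχ1 R x hxR, mul_one]
          exact left_ne_zero_of_mul hx
        rw [hfs f hR, hfs g (TopologicalSpace.denseSeq (V R) n).2, ← Finset.sum_sub_distrib,
          pairing, finsum_eq_sum _ hfin, Finset.mul_sum]
        refine (Finset.abs_sum_le_sum_abs _ _).trans (Finset.sum_le_sum fun x _ => ?_)
        rw [← mul_sub, abs_mul, Nat.abs_cast, mul_left_comm]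
        refine mul_le_mul_of_nonneg_left ?_ (Nat.cast_nonneg _)
        by_cases hx : x ∈ Metric.closedBall (0 : Sp d) R
        · rw [hχ1 R x hx, mul_one]; exact hn x
        · have h1 : f x = 0 := hR x hx
          have h2 : g x = 0 := (TopologicalSpace.denseSeq (V R) n).2 x hx
          rw [h1, h2, sub_zero, abs_zero]
          exact mul_nonneg hε'.le (hχ0 R x)
      have ev1 := (Metric.tendsto_nhds.1 ((hGc (Sum.inr R)).tendsto s₀)) 1 one_pos
      have ev2 := (Metric.tendsto_nhds.1 ((hGc (Sum.inl (R, n))).tendsto s₀)) (ε / 2)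
        (by positivity)
      filter_upwards [ev1, ev2] with s h1 h2
      have h1' : s.pairing (χ R) ≤ M := by
        have : |s.pairing (χ R) - s₀.pairing (χ R)| < 1 := h1
        rw [hM]
        linarith [(abs_lt.1 this).2]
      have h2' : |s.pairing g - s₀.pairing g| < ε / 2 := h2
      have a1 : |s.pairing f - s.pairing g| ≤ ε / 4 := (hdiff s).trans <| by
        calc ε / (4 * M) * s.pairing (χ R) ≤ ε / (4 * M) * M := by gcongr
          _ = ε / 4 := by field_simp
      have a2 : |s₀.pairing f - s₀.pairing g| ≤ ε / 4 := (hdiff s₀).trans <| by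
        calc ε / (4 * M) * s₀.pairing (χ R) ≤ ε / (4 * M) * M := by gcongr; linarith
          _ = ε / 4 := by field_simp
      rw [Real.dist_eq, abs_lt]
      have a1' := abs_le.1 a1
      have a2' := abs_le.1 a2
      have a3' := abs_lt.1 h2'
      constructor <;> linarith [a1'.1, a1'.2, a2'.1, a2'.2, a3'.1, a3'.2]
    exact continuous_iff_le_induced.1 (@continuous_pi _ _ _ t _ _ hcont)

instance : SecondCountableTopology (Conf S) := by
  obtain ⟨f, hf⟩ := exists_countable_inducing (S := S)
  exact hf.secondCountableTopology

lemma measurableSpace_eq_comap :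
    (inferInstance : MeasurableSpace (Conf S)) = MeasurableSpace.comap toMeasure inferInstance := by
  refine le_antisymm ?_ measurable_toMeasure.comap_le
  obtain ⟨f, hf⟩ := exists_countable_inducing (S := S)
  rw [BorelSpace.measurable_eq (α := Conf S), borel, MeasurableSpace.generateFrom_le_iff]
  intro V hV
  obtain ⟨W, hW, rfl⟩ := hf.isOpen_iff.1 hV
  have : Measurable[MeasurableSpace.comap toMeasure inferInstance]
      fun (s : Conf S) (n : ℕ) => s.pairing (f n) :=
    @measurable_pi_lambda _ _ _ (MeasurableSpace.comap toMeasure inferInstance) _ _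
      fun n => measurable_pairing_comap (f n)
  exact this hW.measurableSet

lemma measurable_of_count {Ω : Type*} [MeasurableSpace Ω] {g : Ω → Conf S}
    (h : ∀ A, MeasurableSet A → Bornology.IsBounded A → Measurable fun ω => (g ω).count A) :
    Measurable g := by
  have hm : Measurable fun ω => (g ω).toMeasure := by
    refine Measure.measurable_of_measurable_coe _ fun A hA => ?_
    simp_rw [toMeasure_eq_iSup _ A]
    refine Measurable.iSup fun n => ?_
    have hA' : MeasurableSet (A ∩ Metric.ball (0 : Sp d) n) :=
      hA.inter Metric.isOpen_ball.measurableSet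
    simp_rw [toMeasure_eq_count _ hA']
    exact h _ hA' (Metric.isBounded_ball.subset inter_subset_right)
  have e : (inferInstance : MeasurableSpace (Conf S)) =
    MeasurableSpace.comap toMeasure inferInstance := measurableSpace_eq_comap
  intro V hV
  have hV' : MeasurableSet[MeasurableSpace.comap toMeasure inferInstance] V := e ▸ hV
  obtain ⟨W, hW, rfl⟩ := hV'
  exact hm hW

lemma count_proj (s : Conf S) (A B : Set (Sp d)) : (proj A s).count B = s.count (A ∩ B) := by
  simp only [count_eq_tsum_indicator]
  refine tsum_congr fun x => ?_
  by_cases hA : x ∈ A <;> by_cases hB : x ∈ B <;> simp [proj, hA, hB]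

lemma measurable_proj {A : Set (Sp d)} (hA : MeasurableSet A) :
    Measurable (proj A : Conf S → Conf S) := by
  refine measurable_of_count fun B hB _ => ?_
  simp_rw [count_proj]
  exact measurable_count (hA.inter hB)

instance : MeasurableSpace.SeparatesPoints (Conf S) where
  separates s t h := by
    ext x
    have h1 := h {u | u.count {x} = s.count {x}}
      (measurable_count (measurableSet_singleton x) (measurableSet_singleton _)) rfl
    have h2 : ∀ u : Conf S, u.count {x} = (u.mult x : ℝ≥0∞) := fun u => by
      rw [count, tsum_fintype]; simp
    have h3 : t.count {x} = s.count {x} := h1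
    rw [h2, h2] at h3
    exact_mod_cast h3.symm

instance : Nonempty (Conf S) := ⟨⟨0, fun _ _ => rfl, fun r => by simp⟩⟩

end Conf

/-! ### Points of a configuration and configurations given by points -/

namespace Conf

variable {S : Set (Sp d)}

open Classical in
lemma points_eq_sum (s : Conf S) {A : Set (Sp d)} (h : {x | x ∈ A ∧ s.mult x ≠ 0}.Finite) :
    s.points A = ∑ x ∈ h.toFinset, s.mult x • ({x} : Multiset (Sp d)) := by
  refine finsum_mem_eq_sum_of_inter_support_eq _ ?_
  ext x
  simp only [mem_inter_iff, Function.mem_support, Finite.coe_toFinset]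
  constructor
  · rintro ⟨h1, h2⟩
    exact ⟨⟨h1, fun h0 => h2 (by rw [h0, zero_smul])⟩, h2⟩
  · rintro ⟨h1, h2⟩
    exact ⟨h1.1, h2⟩

open Classical in
lemma count_points (s : Conf S) {A : Set (Sp d)} (h : {x | x ∈ A ∧ s.mult x ≠ 0}.Finite)
    (x : Sp d) : (s.points A).count x = A.indicator s.mult x := by
  rw [points_eq_sum s h, Multiset.count_sum']
  simp only [Multiset.count_nsmul, Multiset.count_singleton]
  by_cases hA : x ∈ A
  · by_cases h0 : s.mult x = 0
    · rw [indicator_of_mem hA, h0]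
      refine Finset.sum_eq_zero fun y _ => ?_
      by_cases hxy : x = y
      · simp [← hxy, h0]
      · simp [hxy]
    · rw [Finset.sum_eq_single x]
      · simp [hA]
      · intro y _ hy
        simp [hy.symm]
      · intro hx
        exact absurd (h.mem_toFinset.2 ⟨hA, h0⟩) hx
  · rw [indicator_of_notMem hA]
    refine Finset.sum_eq_zero fun y hy => ?_
    have hyA : y ∈ A := (h.mem_toFinset.1 hy).1
    have : x ≠ y := fun e => hA (e ▸ hyA)
    simp [this]

lemma mem_points (s : Conf S) {A : Set (Sp d)} (h : {x | x ∈ A ∧ s.mult x ≠ 0}.Finite)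
    {x : Sp d} : x ∈ s.points A ↔ x ∈ A ∧ s.mult x ≠ 0 := by
  classical
  rw [← Multiset.count_pos, count_points s h]
  by_cases hA : x ∈ A <;> simp [hA, Nat.pos_iff_ne_zero]

lemma mem_of_mem_points (s : Conf S) {A : Set (Sp d)}
    (h : {x | x ∈ A ∧ s.mult x ≠ 0}.Finite) {x : Sp d} (hx : x ∈ s.points A) : x ∈ S := by
  by_contra hS
  exact ((mem_points s h).1 hx).2 (s.mult_eq_zero x hS)

lemma count_eq_card_of_finite (s : Conf S) {A : Set (Sp d)}
    (h : {x | x ∈ A ∧ s.mult x ≠ 0}.Finite) : s.count A = ((s.points A).card : ℝ≥0∞) := by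
  rw [points_eq_sum s h, count_eq_tsum_indicator, tsum_eq_sum (s := h.toFinset)]
  · rw [Multiset.card_sum, Nat.cast_sum]
    refine Finset.sum_congr rfl fun x hx => ?_
    rw [indicator_of_mem (h.mem_toFinset.1 hx).1]
    simp
  · intro x hx
    by_cases hxA : x ∈ A
    · have : s.mult x = 0 := by
        by_contra h0
        exact hx (h.mem_toFinset.2 ⟨hxA, h0⟩)
      simp [this]
    · simp [hxA]

lemma count_eq_card (s : Conf S) {A : Set (Sp d)} (hA : Bornology.IsBounded A) :
    s.count A = ((s.points A).card : ℝ≥0∞) :=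
  s.count_eq_card_of_finite (s.finite_inter_of_isBounded hA)

lemma finite_of_count_ne_top (s : Conf S) {A : Set (Sp d)} (h : s.count A ≠ ∞) :
    {x | x ∈ A ∧ s.mult x ≠ 0}.Finite := by
  rw [count_eq_tsum_indicator] at h
  refine (ENNReal.finite_const_le_of_tsum_ne_top h one_ne_zero).subset ?_
  rintro x ⟨hxA, hx⟩
  have : 1 ≤ s.mult x := Nat.one_le_iff_ne_zero.2 hx
  simpa [hxA] using this

lemma finite_of_count_univ (s : Conf S) (h : s.count S ≠ ∞) (A : Set (Sp d)) :
    {x | x ∈ A ∧ s.mult x ≠ 0}.Finite := by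
  refine (s.finite_of_count_ne_top h).subset fun x hx => ⟨?_, hx.2⟩
  by_contra hS
  exact hx.2 (s.mult_eq_zero x hS)

lemma points_proj_self (s : Conf S) (A : Set (Sp d)) : (proj A s).points A = s.points A := by
  unfold points
  refine finsum_mem_congr rfl fun x hx => ?_
  simp [proj, hx]

lemma count_mono (s : Conf S) {A B : Set (Sp d)} (h : A ⊆ B) : s.count A ≤ s.count B := by
  simp only [count_eq_tsum_indicator]
  refine ENNReal.tsum_le_tsum fun x => ?_
  exact indicator_le_indicator_of_subset h (fun _ => zero_le) x

lemma count_inter_self (s : Conf S) (A : Set (Sp d)) : s.count (A ∩ S) = s.count A := by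
  simp only [count_eq_tsum_indicator]
  refine tsum_congr fun x => ?_
  by_cases hS : x ∈ S
  · by_cases hA : x ∈ A <;> simp [hA, hS]
  · by_cases hA : x ∈ A <;> simp [hA, hS, s.mult_eq_zero x hS]

lemma count_eq_zero_iff (s : Conf S) {A : Set (Sp d)} :
    s.count A = 0 ↔ ∀ x ∈ A, s.mult x = 0 := by
  rw [count_eq_tsum_indicator, ENNReal.tsum_eq_zero]
  refine forall_congr' fun x => ?_
  by_cases hA : x ∈ A <;> simp [hA]

lemma mult_ofPoints {n : ℕ} {x : Fin n → Sp d} (hx : ∀ i, x i ∈ S) (y : Sp d) [DecidableEq (Sp d)] :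
    (ofPoints S x).mult y = (Finset.univ.val.map x).count y := by
  classical
  have h : (Finset.univ.val.map x).count y = (Finset.univ.filter fun i => x i = y).card := by
    rw [Multiset.count_map, Finset.card_def, Finset.filter_val]
    congr 1
    refine Multiset.filter_congr fun i _ => eq_comm
  rw [h]
  by_cases hy : y ∈ S
  · simp only [ofPoints, hy, if_true]
    congr!
  · have : (Finset.univ.filter fun i => x i = y) = ∅ := by
      rw [Finset.filter_eq_empty_iff]
      exact fun i _ e => hy (e ▸ hx i)
    simp [ofPoints, hy, this]

lemma finite_ofPoints {n : ℕ} (x : Fin n → Sp d) (A : Set (Sp d)) :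
    {y | y ∈ A ∧ (ofPoints S x).mult y ≠ 0}.Finite := by
  classical
  refine (Set.finite_range x).subset fun y hy => ?_
  have h := hy.2
  by_contra hr
  refine h ?_
  have : (Finset.univ.filter fun i => x i = y) = ∅ := by
    rw [Finset.filter_eq_empty_iff]
    exact fun i _ e => hr ⟨i, e⟩
  by_cases hS : y ∈ S
  · simp only [ofPoints, hS, if_true, Finset.card_eq_zero]
    convert this
  · simp [ofPoints, hS]

open Classical in
lemma points_ofPoints {n : ℕ} {x : Fin n → Sp d} (hx : ∀ i, x i ∈ S) (A : Set (Sp d)) :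
    (ofPoints S x).points A = (Finset.univ.val.map x).filter (· ∈ A) := by
  ext y
  rw [count_points _ (finite_ofPoints x A)]
  by_cases hA : y ∈ A
  · rw [indicator_of_mem hA, mult_ofPoints hx, Multiset.count_filter_of_pos hA]
  · rw [indicator_of_notMem hA, Multiset.count_filter_of_neg hA]

lemma points_ofPoints_of_mem {n : ℕ} {x : Fin n → Sp d} {A : Set (Sp d)} (hA : A ⊆ S)
    (hx : ∀ i, x i ∈ A) : (ofPoints S x).points A = Finset.univ.val.map x := by
  classical
  rw [points_ofPoints fun i => hA (hx i)]
  refine Multiset.filter_eq_self.2 fun y hy => ?_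
  obtain ⟨i, -, rfl⟩ := Multiset.mem_map.1 hy
  exact hx i

open Classical in
lemma count_ofPoints {n : ℕ} {x : Fin n → Sp d} (hx : ∀ i, x i ∈ S) (A : Set (Sp d)) :
    (ofPoints S x).count A = ∑ i, A.indicator (fun _ => (1 : ℝ≥0∞)) (x i) := by
  rw [count_eq_card_of_finite _ (finite_ofPoints x A), points_ofPoints hx,
    ← Multiset.countP_eq_card_filter,
    Multiset.countP_map, ← Finset.filter_val, ← Finset.card_def, Finset.card_filter, Nat.cast_sum]
  refine Finset.sum_congr rfl fun i _ => ?_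
  by_cases h : x i ∈ A <;> simp [h]

lemma count_ofPoints_of_mem {n : ℕ} {x : Fin n → Sp d} {A : Set (Sp d)} (hA : A ⊆ S)
    (hx : ∀ i, x i ∈ A) : (ofPoints S x).count A = n := by
  rw [count_ofPoints fun i => hA (hx i)]
  simp [hx]

lemma exists_eq_ofPoints (s : Conf S) {n : ℕ} (hs : s.count S = n) :
    ∃ x : Fin n → Sp d, (∀ i, x i ∈ S) ∧ ofPoints S x = s := by
  classical
  have hfin := s.finite_of_count_ne_top (hs ▸ ENNReal.natCast_ne_top n)
  have hcard : (s.points S).card = n := by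
    rw [count_eq_card_of_finite s hfin] at hs
    exact_mod_cast hs
  have hlen : (s.points S).toList.length = n := by rw [Multiset.length_toList, hcard]
  subst hlen
  have hx : ∀ i, (s.points S).toList.get i ∈ S := fun i =>
    ((mem_points s hfin).1 (Multiset.mem_toList.1 (List.get_mem _ i))).1
  refine ⟨(s.points S).toList.get, hx, ?_⟩
  ext y
  rw [mult_ofPoints hx]
  have : (Finset.univ.val.map (s.points S).toList.get) = s.points S := by
    rw [Fin.univ_val_map, List.ofFn_get, Multiset.coe_toList]
  rw [this, count_points s hfin]
  by_cases h : y ∈ S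
  · simp [h]
  · simp [h, s.mult_eq_zero y h]

open Classical in
lemma measurable_ofPoints (hS : MeasurableSet S) (n : ℕ) :
    Measurable (ofPoints S : (Fin n → Sp d) → Conf S) := by
  refine measurable_of_count fun A hA _ => ?_
  have h : ∀ x : Fin n → Sp d, (ofPoints S x).count A =
      ∑ i, (A ∩ S).indicator (fun _ => (1 : ℝ≥0∞)) (x i) := by
    intro x
    rw [count_eq_tsum_indicator]
    have h1 : ∀ y, A.indicator (fun y => ((ofPoints S x).mult y : ℝ≥0∞)) y =
        ∑ i, if y = x i then (A ∩ S).indicator (fun _ => (1 : ℝ≥0∞)) (x i) else 0 := by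
      intro y
      by_cases hA' : y ∈ A <;> by_cases hS' : y ∈ S
      · simp only [hA', indicator_of_mem, ofPoints, hS', if_true, Finset.card_filter, Nat.cast_sum]
        refine Finset.sum_congr rfl fun i _ => ?_
        by_cases hi : y = x i
        · subst hi; simp [hA', hS']
        · simp [hi, Ne.symm hi]
      all_goals
        rw [Finset.sum_eq_zero fun i _ => ?_]
        · simp [hA', hS', ofPoints]
        · split_ifs with hi
          · subst hi; simp [hA', hS']
          · rfl
    simp_rw [h1]
    rw [Summable.tsum_finsetSum fun i _ => ENNReal.summable]
    exact Finset.sum_congr rfl fun i _ => tsum_ite_eq (x i) _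
  simp_rw [h]
  exact Finset.measurable_sum _ fun i _ =>
    (measurable_const.indicator (hA.inter hS)).comp (measurable_pi_apply i)

lemma measurableSet_forall_mem {n : ℕ} {A : Set (Sp d)} (hA : MeasurableSet A) :
    MeasurableSet {x : Fin n → Sp d | ∀ i, x i ∈ A} := by
  simp only [ofPred_forall]
  exact MeasurableSet.iInter fun i => measurable_pi_apply i hA

lemma range_ofPoints_subtype (n : ℕ) :
    range (fun x : {x : Fin n → Sp d // ∀ i, x i ∈ S} => ofPoints S x.1) =
      {s | s.count S = (n : ℝ≥0∞)} := by
  ext s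
  constructor
  · rintro ⟨x, rfl⟩
    exact count_ofPoints_of_mem subset_rfl x.2
  · intro hs
    obtain ⟨x, hx, rfl⟩ := s.exists_eq_ofPoints hs
    exact ⟨⟨x, hx⟩, rfl⟩

/-- Measurability of a set of finite configurations can be checked in terms of the points: the
configurations with `n` points are the image of the standard Borel space `S^n` under the
measurable map `Conf.ofPoints`, so the Lusin–Souslin theorem applies. -/
lemma measurableSet_inter_of_ofPoints (hS : MeasurableSet S) {E : Set (Conf S)}
    (h : ∀ n, MeasurableSet
      {x : {x : Fin n → Sp d // ∀ i, x i ∈ S} | ofPoints S x.1 ∈ E}) :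
    MeasurableSet (E ∩ {s | s.count S ≠ ∞}) := by
  have hU : E ∩ {s | s.count S ≠ ∞} = ⋃ n : ℕ, E ∩ {s | s.count S = (n : ℝ≥0∞)} := by
    ext s
    simp only [mem_inter_iff, mem_iUnion, mem_ofPred_eq]
    constructor
    · rintro ⟨h1, h2⟩
      exact ⟨(s.points S).card, h1, count_eq_card_of_finite s (s.finite_of_count_ne_top h2)⟩
    · rintro ⟨n, h1, h2⟩
      exact ⟨h1, h2 ▸ ENNReal.natCast_ne_top n⟩
  rw [hU]
  refine MeasurableSet.iUnion fun n => ?_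
  have : StandardBorelSpace {x : Fin n → Sp d // ∀ i, x i ∈ S} :=
    (measurableSet_forall_mem hS).standardBorel
  have hf : Measurable fun x : {x : Fin n → Sp d // ∀ i, x i ∈ S} => ofPoints S x.1 :=
    (measurable_ofPoints hS n).comp measurable_subtype_coe
  rw [← range_ofPoints_subtype n]
  refine (hf.measurableSet_preimage_iff_inter_range ?_).1 (h n)
  rw [range_ofPoints_subtype n]
  exact measurable_count hS (measurableSet_singleton _)

lemma measurable_comp_proj_of_ofPoints (hS : MeasurableSet S) {β : Type*} [MeasurableSpace β]
    {A : Set (Sp d)} (hA : MeasurableSet A) (hb : Bornology.IsBounded A) {g : Conf S → β}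
    (h : ∀ n, Measurable fun x : {x : Fin n → Sp d // ∀ i, x i ∈ S} => g (ofPoints S x.1)) :
    Measurable fun s => g (proj A s) := by
  intro E hE
  have h1 := measurableSet_inter_of_ofPoints hS (E := g ⁻¹' E) fun n => h n hE
  have h2 := measurable_proj hA h1
  convert h2 using 1
  ext s
  simp only [mem_preimage, mem_inter_iff, mem_ofPred_eq, count_proj]
  exact ⟨fun hs => ⟨hs, s.count_ne_top (hb.subset inter_subset_left)⟩, fun hs => hs.1⟩

end Conf

lemma measurableSet_exactly {S A : Set (Sp d)} (hA : MeasurableSet A) (m : ℕ) :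
    MeasurableSet (exactly S A m) :=
  Conf.measurable_count hA (measurableSet_singleton _)

/-! ### Energies and finite-volume Gibbs measures -/

section Energy

variable {Φ : Sp d → EReal} {Ψ : Sp d → Sp d → EReal}

/-- The energy of a list of points. -/
def listEnergy (Φ : Sp d → EReal) (Ψ : Sp d → Sp d → EReal) : List (Sp d) → EReal
  | [] => 0
  | a :: l => (Φ a + (l.map (Ψ a)).sum) + listEnergy Φ Ψ l

lemma energy_eq_listEnergy (Φ : Sp d → EReal) (Ψ : Sp d → Sp d → EReal) {n : ℕ}
    (x : Fin n → Sp d) : energy Φ Ψ x = listEnergy Φ Ψ (List.ofFn x) := by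
  induction n with
  | zero => simp [energy, listEnergy]
  | succ n ih =>
    rw [List.ofFn_succ, listEnergy, ← ih fun i => x i.succ]
    simp only [energy]
    rw [Fin.sum_univ_succ, Fin.sum_univ_succ (f := fun i => ∑ j ∈ Finset.Ioi i, Ψ (x i) (x j)),
      Fin.sum_Ioi_zero]
    simp only [Fin.sum_Ioi_succ]
    rw [List.map_ofFn, List.sum_ofFn]
    simp only [Function.comp_def]
    abel

lemma listEnergy_perm (hΨ : ∀ x y, Ψ x y = Ψ y x) {l l' : List (Sp d)} (h : l.Perm l') :
    listEnergy Φ Ψ l = listEnergy Φ Ψ l' := by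
  induction h with
  | nil => rfl
  | cons a h ih => rw [listEnergy, listEnergy, ih, (h.map _).sum_eq]
  | swap a b l =>
    simp only [listEnergy, List.map_cons, List.sum_cons]
    rw [hΨ b a]
    abel
  | trans _ _ ih1 ih2 => rw [ih1, ih2]

lemma hamiltonian_eq_of_points (hΨ : ∀ x y, Ψ x y = Ψ y x) {S A : Set (Sp d)} {s : Conf S}
    {n : ℕ} {x : Fin n → Sp d} (h : s.points A = Finset.univ.val.map x) :
    hamiltonian Φ Ψ A s = energy Φ Ψ x := by
  rw [hamiltonian, energy_eq_listEnergy, energy_eq_listEnergy, List.ofFn_get]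
  refine listEnergy_perm hΨ (Multiset.coe_eq_coe.1 ?_)
  rw [Multiset.coe_toList, h, Fin.univ_val_map]

lemma hamiltonian_ofPoints (hΨ : ∀ x y, Ψ x y = Ψ y x) {S A : Set (Sp d)} (hA : A ⊆ S) {n : ℕ}
    {x : Fin n → Sp d} (hx : ∀ i, x i ∈ A) :
    hamiltonian Φ Ψ A (Conf.ofPoints S x) = energy Φ Ψ x :=
  hamiltonian_eq_of_points hΨ (Conf.points_ofPoints_of_mem hA hx)

lemma Conf.points_proj_of_subset {S : Set (Sp d)} (s : Conf S) {A B : Set (Sp d)} (h : A ⊆ B) :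
    (Conf.proj A s).points B = s.points A := by
  unfold Conf.points
  refine finsum_congr fun x => ?_
  by_cases hA : x ∈ A
  · simp [hA, h hA, Conf.proj]
  · simp [hA, Conf.proj]

lemma measurable_energy (hΦ : Measurable Φ) (hΨ : Measurable (Function.uncurry Ψ)) (n : ℕ) :
    Measurable (energy Φ Ψ : (Fin n → Sp d) → EReal) := by
  refine Measurable.add ?_ ?_
  · exact Finset.measurable_sum _ fun i _ => hΦ.comp (measurable_pi_apply i)
  · exact Finset.measurable_sum _ fun i _ => Finset.measurable_sum _ fun j _ =>
      Measurable.comp (g := Function.uncurry Ψ) (f := fun x : Fin n → Sp d => (x i, x j)) hΨ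
        ((measurable_pi_apply i).prodMk (measurable_pi_apply j))

lemma measurable_hamiltonian (hΦ : IsFreePotential Φ) (hΨ : IsPairPotential Ψ) {S A : Set (Sp d)}
    (hS : MeasurableSet S) (hAS : A ⊆ S) (hA : MeasurableSet A) (hb : Bornology.IsBounded A) :
    Measurable fun s : Conf S => hamiltonian Φ Ψ A s := by
  have h1 : (fun s : Conf S => hamiltonian Φ Ψ A s) =
      fun s => hamiltonian Φ Ψ S (Conf.proj A s) := by
    funext s
    rw [hamiltonian, hamiltonian, Conf.points_proj_of_subset s hAS]
  rw [h1]
  refine Conf.measurable_comp_proj_of_ofPoints hS hA hb fun n => ?_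
  simp_rw [fun x : {x : Fin n → Sp d // ∀ i, x i ∈ S} =>
    hamiltonian_ofPoints (Φ := Φ) hΨ.symm subset_rfl x.2]
  exact (measurable_energy hΦ.measurable hΨ.measurable n).comp measurable_subtype_coe

lemma sum_ne_bot {ι : Type*} {s : Finset ι} {f : ι → EReal} (h : ∀ i ∈ s, f i ≠ ⊥) :
    ∑ i ∈ s, f i ≠ ⊥ :=
  Finset.sum_induction f (· ≠ ⊥) (fun _ _ h1 h2 => EReal.add_ne_bot_iff.2 ⟨h1, h2⟩) (by simp) h

lemma sum_ne_top {ι : Type*} {s : Finset ι} {f : ι → EReal} (h : ∀ i ∈ s, f i ≠ ⊤) :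
    ∑ i ∈ s, f i ≠ ⊤ :=
  Finset.sum_induction f (· ≠ ⊤) (fun _ _ h1 h2 => EReal.add_ne_top h1 h2) (by simp) h

lemma tendsto_sum_ereal {ι : Type*} {s : Finset ι} {f : ℕ → ι → EReal} {g : ι → EReal}
    (hg : ∀ i ∈ s, g i ≠ ⊥) (h : ∀ i ∈ s, Tendsto (fun N => f N i) atTop (𝓝 (g i))) :
    Tendsto (fun N => ∑ i ∈ s, f N i) atTop (𝓝 (∑ i ∈ s, g i)) := by
  classical
  induction s using Finset.induction_on with
  | empty => simp
  | insert a s ha ih =>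
    simp only [Finset.sum_insert ha]
    have h1 := hg a (Finset.mem_insert_self _ _)
    have h2 : ∑ i ∈ s, g i ≠ ⊥ := sum_ne_bot fun i hi => hg i (Finset.mem_insert_of_mem hi)
    exact (EReal.continuousAt_add (p := (g a, ∑ i ∈ s, g i)) (Or.inr h2) (Or.inl h1)).tendsto.comp
      ((h a (Finset.mem_insert_self _ _)).prodMk_nhds
        (ih (fun i hi => hg i (Finset.mem_insert_of_mem hi))
          fun i hi => h i (Finset.mem_insert_of_mem hi)))

/-- The configuration-independent lower bound of the energy of `n` points. -/
lemma energy_ge {A : Set (Sp d)} {C C' : ℝ} (hΦ : ∀ x ∈ A, (C : EReal) ≤ Φ x)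
    (hΨ : ∀ x ∈ A, ∀ y ∈ A, (C' : EReal) ≤ Ψ x y) {n : ℕ} {x : Fin n → Sp d}
    (hx : ∀ i, x i ∈ A) :
    energy (fun _ : Sp d => (C : EReal)) (fun _ _ => (C' : EReal)) (fun _ : Fin n => 0) ≤
      energy Φ Ψ x :=
  add_le_add (Finset.sum_le_sum fun i _ => hΦ _ (hx i))
    (Finset.sum_le_sum fun i _ => Finset.sum_le_sum fun j _ => hΨ _ (hx i) _ (hx j))

lemma energy_ne_bot (hΦ : ∀ x, Φ x ≠ ⊥) (hΨ : ∀ x y, Ψ x y ≠ ⊥) {n : ℕ} (x : Fin n → Sp d) :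
    energy Φ Ψ x ≠ ⊥ :=
  EReal.add_ne_bot_iff.2 ⟨sum_ne_bot fun _ _ => hΦ _, sum_ne_bot fun _ _ => sum_ne_bot fun _ _ =>
    hΨ _ _⟩

lemma energy_ne_top {n : ℕ} {x : Fin n → Sp d} (hΦ : ∀ i, Φ (x i) ≠ ⊤)
    (hΨ : ∀ i j, i < j → Ψ (x i) (x j) ≠ ⊤) : energy Φ Ψ x ≠ ⊤ :=
  EReal.add_ne_top (sum_ne_top fun _ _ => hΦ _)
    (sum_ne_top fun _ _ => sum_ne_top fun _ hj => hΨ _ _ (Finset.mem_Ioi.1 hj))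

lemma tendsto_energy {ΦN : ℕ → Sp d → EReal} {ΨN : ℕ → Sp d → Sp d → EReal}
    (hΦ : ∀ x, Φ x ≠ ⊥) (hΨ : ∀ x y, Ψ x y ≠ ⊥) {n : ℕ} {x : Fin n → Sp d}
    (h1 : ∀ i, Tendsto (fun N => ΦN N (x i)) atTop (𝓝 (Φ (x i))))
    (h2 : ∀ i j, i < j → Tendsto (fun N => ΨN N (x i) (x j)) atTop (𝓝 (Ψ (x i) (x j)))) :
    Tendsto (fun N => energy (ΦN N) (ΨN N) x) atTop (𝓝 (energy Φ Ψ x)) := by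
  have e1 := tendsto_sum_ereal (s := (Finset.univ : Finset (Fin n)))
    (fun i _ => hΦ (x i)) fun i _ => h1 i
  have e2 := tendsto_sum_ereal (s := (Finset.univ : Finset (Fin n)))
    (g := fun i => ∑ j ∈ Finset.Ioi i, Ψ (x i) (x j))
    (fun i _ => sum_ne_bot fun j _ => hΨ _ _) fun i _ =>
      tendsto_sum_ereal (fun j _ => hΨ (x i) (x j)) fun j hj => h2 i j (Finset.mem_Ioi.1 hj)
  refine (EReal.continuousAt_add (p := (∑ i, Φ (x i), ∑ i, ∑ j ∈ Finset.Ioi i, Ψ (x i) (x j)))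
    (Or.inr (sum_ne_bot fun i _ => sum_ne_bot fun j _ => hΨ _ _))
    (Or.inl (sum_ne_bot fun i _ => hΦ _))).tendsto.comp (e1.prodMk_nhds e2)

/-- The (unnormalised) Gibbs measure of `m` points in `A`. -/
def gibbs (S : Set (Sp d)) (Φ : Sp d → EReal) (Ψ : Sp d → Sp d → EReal) (A : Set (Sp d)) (m : ℕ) :
    Measure (Conf S) :=
  ((poisson S A).restrict (exactly S A m)).withDensity
    fun x => EReal.exp (-hamiltonian Φ Ψ A x)

/-- The weight of `m` points under the Poisson random point field on `A`. -/
def poissonWeight (A : Set (Sp d)) (m : ℕ) : ℝ≥0∞ :=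
  ENNReal.ofReal (Real.exp (-(volume A).toReal)) / (m.factorial : ℝ≥0∞)

lemma poissonWeight_ne_zero (A : Set (Sp d)) (m : ℕ) : poissonWeight A m ≠ 0 := by
  rw [poissonWeight, ne_eq, ENNReal.div_eq_zero_iff, not_or]
  exact ⟨(ENNReal.ofReal_pos.2 (Real.exp_pos _)).ne', ENNReal.natCast_ne_top _⟩

lemma poissonWeight_ne_top (A : Set (Sp d)) (m : ℕ) : poissonWeight A m ≠ ∞ :=
  ENNReal.div_ne_top ENNReal.ofReal_ne_top (by exact_mod_cast m.factorial_ne_zero)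

variable {S A : Set (Sp d)}

lemma measurableSet_pi_const (hA : MeasurableSet A) (n : ℕ) :
    MeasurableSet (univ.pi fun _ : Fin n => A) :=
  MeasurableSet.univ_pi fun _ => hA

lemma poisson_restrict_exactly (hS : MeasurableSet S) (hAS : A ⊆ S) (hA : MeasurableSet A) (m : ℕ) :
    (poisson S A).restrict (exactly S A m) =
      poissonWeight A m • (volume.restrict (univ.pi fun _ : Fin m => A)).map (Conf.ofPoints S) := by
  ext D hD
  have hE := measurableSet_exactly (S := S) hA m
  rw [Measure.restrict_apply hD, poisson, Measure.sum_apply _ (hD.inter hE)]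
  have hpi : ∀ n : ℕ, (Measure.pi fun _ : Fin n => (volume : Measure (Sp d)).restrict A) =
      volume.restrict (univ.pi fun _ : Fin n => A) := fun n =>
    (Measure.restrict_pi_pi (fun _ : Fin n => (volume : Measure (Sp d))) fun _ => A).symm
  simp_rw [hpi, Measure.smul_apply, smul_eq_mul]
  have hpre : ∀ n : ℕ, (volume.restrict (univ.pi fun _ : Fin n => A)).map (Conf.ofPoints S)
      (D ∩ exactly S A m) = if n = m then
        (volume.restrict (univ.pi fun _ : Fin n => A)).map (Conf.ofPoints S) D else 0 := by
    intro n
    rw [Measure.map_apply (Conf.measurable_ofPoints hS n) (hD.inter hE),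
      Measure.map_apply (Conf.measurable_ofPoints hS n) hD]
    have hcount : ∀ᵐ x ∂(volume.restrict (univ.pi fun _ : Fin n => A)),
        (Conf.ofPoints S x).count A = n := by
      refine (ae_restrict_iff' (measurableSet_pi_const hA n)).2
        (Eventually.of_forall fun x hx => ?_)
      exact Conf.count_ofPoints_of_mem hAS fun i => hx i (mem_univ i)
    split_ifs with h
    · refine measure_congr ?_
      filter_upwards [hcount] with x hx
      refine propext ⟨fun h' => h'.1, fun h' => ⟨h', ?_⟩⟩
      change (Conf.ofPoints S x).count A = m
      rw [hx, h]
    · refine measure_mono_null (t := {x | ¬ (Conf.ofPoints S x).count A = n}) ?_ hcount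
      rintro x ⟨-, hx⟩ hx'
      have hx2 : (Conf.ofPoints S x).count A = m := hx
      rw [hx'] at hx2
      exact h (by exact_mod_cast hx2)
  rw [tsum_eq_single m]
  · rw [hpre, if_pos rfl, poissonWeight]
  · intro n hn
    rw [hpre, if_neg hn, mul_zero]

lemma gibbs_apply (hΦ : IsFreePotential Φ) (hΨ : IsPairPotential Ψ) (hS : MeasurableSet S)
    (hAS : A ⊆ S) (hA : MeasurableSet A) (hb : Bornology.IsBounded A) (m : ℕ) {D : Set (Conf S)}
    (hD : MeasurableSet D) :
    gibbs S Φ Ψ A m D = poissonWeight A m * ∫⁻ x in univ.pi fun _ : Fin m => A,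
      (Conf.ofPoints S ⁻¹' D).indicator (fun x => EReal.exp (-energy Φ Ψ x)) x := by
  have hm : Measurable fun s : Conf S => EReal.exp (-hamiltonian Φ Ψ A s) :=
    EReal.measurable_exp.comp (measurable_hamiltonian hΦ hΨ hS hAS hA hb).neg
  rw [gibbs, withDensity_apply _ hD, ← lintegral_indicator hD, poisson_restrict_exactly hS hAS hA,
    lintegral_smul_measure, lintegral_map (hm.indicator hD)
      (Conf.measurable_ofPoints hS m), smul_eq_mul]
  congr 1
  refine setLIntegral_congr_fun (measurableSet_pi_const hA m) fun x hx => ?_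
  by_cases h : Conf.ofPoints S x ∈ D
  · have h' : x ∈ Conf.ofPoints S ⁻¹' D := h
    rw [indicator_of_mem h, indicator_of_mem h',
      hamiltonian_ofPoints hΨ.symm hAS fun i => hx i (mem_univ i)]
  · have h' : x ∉ Conf.ofPoints S ⁻¹' D := h
    rw [indicator_of_notMem h, indicator_of_notMem h']

lemma aemeasurable_indicator_exp_energy (hΦ : IsFreePotential Φ) (hΨ : IsPairPotential Ψ)
    (hS : MeasurableSet S) (m : ℕ) {D : Set (Conf S)} (hD : MeasurableSet D) :
    AEMeasurable ((Conf.ofPoints S ⁻¹' D).indicator fun x => EReal.exp (-energy Φ Ψ x))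
      (volume.restrict (univ.pi fun _ : Fin m => A)) := by
  have h := EReal.measurable_exp.comp (measurable_energy hΦ.measurable hΨ.measurable m).neg
  exact (h.indicator (Conf.measurable_ofPoints hS m hD)).aemeasurable

lemma ae_forall_apply {P : Sp d → Prop} (h : ∀ᵐ y : Sp d, P y) (m : ℕ) :
    ∀ᵐ x : Fin m → Sp d, ∀ i, P (x i) :=
  ae_all_iff.2 fun i =>
    (Measure.tendsto_eval_ae_ae (μ := fun _ : Fin m => (volume : Measure (Sp d)))
      (i := i)).eventually h

lemma ae_pairwise_ne (hd : 0 < d) (m : ℕ) :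
    ∀ᵐ x : Fin m → Sp d, ∀ i j, i ≠ j → x i ≠ x j := by
  refine ae_all_iff.2 fun i => ae_all_iff.2 fun j => ?_
  by_cases hij : i = j
  · exact Eventually.of_forall fun x h => absurd hij h
  let V : Submodule ℝ (Fin m → Sp d) :=
    LinearMap.ker ((LinearMap.proj i : (Fin m → Sp d) →ₗ[ℝ] Sp d) - LinearMap.proj j)
  have hV : V ≠ ⊤ := by
    intro h
    obtain ⟨v, hv⟩ : ∃ v : Sp d, v ≠ 0 := by
      have : Nonempty (Fin d) := ⟨⟨0, hd⟩⟩
      exact exists_ne 0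
    have hmem : (Function.update 0 i v : Fin m → Sp d) ∈ V := h ▸ Submodule.mem_top
    rw [LinearMap.mem_ker] at hmem
    refine hv ?_
    simpa [Function.update_of_ne (Ne.symm hij)] using hmem
  have h0 := Measure.addHaar_submodule (volume : Measure (Fin m → Sp d)) V hV
  refine measure_mono_null (fun x hx => ?_) h0
  have hx' : ¬ (i ≠ j → x i ≠ x j) := hx
  push Not at hx'
  change x ∈ V
  rw [LinearMap.mem_ker, LinearMap.sub_apply, LinearMap.proj_apply, LinearMap.proj_apply, hx'.2,
    sub_self]

lemma volume_pi_const_ne_top (hb : Bornology.IsBounded A) (m : ℕ) :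
    volume (univ.pi fun _ : Fin m => A) ≠ ∞ := by
  rw [volume_pi_pi]
  exact ENNReal.prod_ne_top fun _ _ => hb.measure_lt_top.ne

end Energy

section GibbsLimit

variable {S A : Set (Sp d)} {Φ : Sp d → EReal} {Ψ : Sp d → Sp d → EReal}
  {ΦN : ℕ → Sp d → EReal} {ΨN : ℕ → Sp d → Sp d → EReal}

/-- Potentials that converge almost everywhere on the bounded Borel set `A ⊆ S`, with common lower
bounds on `A`, to a potential that is finite almost everywhere. -/
structure PotentialsConverge (S A : Set (Sp d)) (Φ : Sp d → EReal) (Ψ : Sp d → Sp d → EReal)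
    (ΦN : ℕ → Sp d → EReal) (ΨN : ℕ → Sp d → Sp d → EReal) : Prop where
  pos : 0 < d
  meas_S : MeasurableSet S
  subset : A ⊆ S
  meas : MeasurableSet A
  bdd : Bornology.IsBounded A
  free : IsFreePotential Φ
  pair : IsPairPotential Ψ
  freeN : ∀ N, IsFreePotential (ΦN N)
  pairN : ∀ N, IsPairPotential (ΨN N)
  free_ne_top : ∀ᵐ x : Sp d, x ∈ A → Φ x ≠ ⊤
  pair_ne_top : ∀ x ∈ A, ∀ y ∈ A, x ≠ y → Ψ x y ≠ ⊤
  tendsto_free : ∀ᵐ x : Sp d, x ∈ A → Tendsto (fun N => ΦN N x) atTop (𝓝 (Φ x))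
  tendsto_pair : ∀ x ∈ A, ∀ y ∈ A, x ≠ y → Tendsto (fun N => ΨN N x y) atTop (𝓝 (Ψ x y))
  free_ge : ∃ C : ℝ, ∀ N, ∀ x ∈ A, (C : EReal) ≤ ΦN N x
  pair_ge : ∃ C : ℝ, ∀ N, ∀ x ∈ A, ∀ y ∈ A, (C : EReal) ≤ ΨN N x y

namespace PotentialsConverge

lemma exists_exp_le (h : PotentialsConverge S A Φ Ψ ΦN ΨN)
    (m : ℕ) : ∃ M : ℝ≥0∞, M ≠ ∞ ∧ ∀ N, ∀ x : Fin m → Sp d, (∀ i, x i ∈ A) →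
    EReal.exp (-energy (ΦN N) (ΨN N) x) ≤ M := by
  obtain ⟨C, hC⟩ := h.free_ge
  obtain ⟨C', hC'⟩ := h.pair_ge
  refine ⟨EReal.exp (-energy (fun _ : Sp d => (C : EReal)) (fun _ _ => (C' : EReal))
    (fun _ : Fin m => 0)), ?_, fun N x hx => ?_⟩
  · rw [ne_eq, EReal.exp_eq_top_iff, EReal.neg_eq_top_iff]
    exact energy_ne_bot (fun _ => EReal.coe_ne_bot _) (fun _ _ => EReal.coe_ne_bot _) _
  · exact EReal.exp_monotone (EReal.neg_le_neg_iff.2 (energy_ge (hC N) (hC' N) hx))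

lemma ae_tendsto_exp (h : PotentialsConverge S A Φ Ψ ΦN ΨN)
    (m : ℕ) : ∀ᵐ x : Fin m → Sp d, (∀ i, x i ∈ A) →
    Tendsto (fun N => EReal.exp (-energy (ΦN N) (ΨN N) x)) atTop
      (𝓝 (EReal.exp (-energy Φ Ψ x))) := by
  filter_upwards [ae_pairwise_ne h.pos m, ae_forall_apply h.tendsto_free m] with x h1 h2 hx
  refine ((ENNReal.continuous_exp.comp continuous_neg).tendsto _).comp ?_
  exact tendsto_energy h.free.ne_bot h.pair.ne_bot (fun i => h2 i (hx i))
    fun i j hij => h.tendsto_pair _ (hx i) _ (hx j) (h1 i j hij.ne)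

lemma tendsto_gibbs (h : PotentialsConverge S A Φ Ψ ΦN ΨN)
    (m : ℕ) {D : Set (Conf S)} (hD : MeasurableSet D) :
    Tendsto (fun N => gibbs S (ΦN N) (ΨN N) A m D) atTop (𝓝 (gibbs S Φ Ψ A m D)) := by
  simp_rw [fun N => gibbs_apply (h.freeN N) (h.pairN N) h.meas_S h.subset h.meas h.bdd m hD]
  rw [gibbs_apply h.free h.pair h.meas_S h.subset h.meas h.bdd m hD]
  refine ENNReal.Tendsto.const_mul ?_ (Or.inr (poissonWeight_ne_top A m))
  obtain ⟨M, hM, hle⟩ := h.exists_exp_le m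
  have hpi := measurableSet_pi_const h.meas m
  refine tendsto_lintegral_of_dominated_convergence' (fun _ => M)
    (fun N => aemeasurable_indicator_exp_energy (h.freeN N) (h.pairN N) h.meas_S m hD)
    (fun N => (ae_restrict_iff' hpi).2 (Eventually.of_forall fun x hx => ?_)) ?_ ?_
  · exact (indicator_le_self _ _ x).trans (hle N x fun i => hx i (mem_univ i))
  · rw [setLIntegral_const]
    exact ENNReal.mul_ne_top hM (volume_pi_const_ne_top h.bdd m)
  · refine (ae_restrict_iff' hpi).2 ?_
    filter_upwards [h.ae_tendsto_exp m] with x hx hxA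
    by_cases hxD : x ∈ Conf.ofPoints S ⁻¹' D
    · simp only [indicator_of_mem hxD]
      exact hx fun i => hxA i (mem_univ i)
    · simp only [indicator_of_notMem hxD]
      exact tendsto_const_nhds

lemma gibbs_univ_ne_top (h : PotentialsConverge S A Φ Ψ ΦN ΨN)
    (m : ℕ) : gibbs S Φ Ψ A m univ ≠ ∞ := by
  obtain ⟨M, hM, hle⟩ := h.exists_exp_le m
  have hpi := measurableSet_pi_const h.meas m
  rw [gibbs_apply h.free h.pair h.meas_S h.subset h.meas h.bdd m MeasurableSet.univ]
  refine ENNReal.mul_ne_top (poissonWeight_ne_top A m) ?_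
  have : ∫⁻ x in univ.pi fun _ : Fin m => A, (Conf.ofPoints S ⁻¹' univ).indicator
      (fun x => EReal.exp (-energy Φ Ψ x)) x ≤ ∫⁻ _ in univ.pi fun _ : Fin m => A, M := by
    refine lintegral_mono_ae ((ae_restrict_iff' hpi).2 ?_)
    filter_upwards [h.ae_tendsto_exp m] with x hx hxA
    rw [preimage_univ, indicator_univ]
    exact le_of_tendsto' (hx fun i => hxA i (mem_univ i)) fun N =>
      hle N x fun i => hxA i (mem_univ i)
  refine ne_top_of_le_ne_top ?_ this
  rw [setLIntegral_const]
  exact ENNReal.mul_ne_top hM (volume_pi_const_ne_top h.bdd m)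

lemma gibbs_univ_ne_zero (h : PotentialsConverge S A Φ Ψ ΦN ΨN)
    (hvol : volume A ≠ 0) (m : ℕ) : gibbs S Φ Ψ A m univ ≠ 0 := by
  have hpi := measurableSet_pi_const h.meas m
  rw [gibbs_apply h.free h.pair h.meas_S h.subset h.meas h.bdd m MeasurableSet.univ]
  refine mul_ne_zero (poissonWeight_ne_zero A m) fun h0 => ?_
  rw [lintegral_eq_zero_iff' (aemeasurable_indicator_exp_energy h.free h.pair h.meas_S m
    MeasurableSet.univ)] at h0
  have h1 := (ae_restrict_iff' hpi).1 h0
  have h2 : ∀ᵐ x : Fin m → Sp d, x ∉ (univ.pi fun _ : Fin m => A) := by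
    filter_upwards [h1, ae_forall_apply h.free_ne_top m, ae_pairwise_ne h.pos m]
      with x hx1 hx2 hx3 hxA
    have hxA' : ∀ i, x i ∈ A := fun i => hxA i (mem_univ i)
    have hx := hx1 hxA
    rw [preimage_univ, indicator_univ] at hx
    have hx4 : energy Φ Ψ x = ⊤ := by
      rw [← EReal.neg_eq_bot_iff]
      exact EReal.exp_eq_zero_iff.1 hx
    exact energy_ne_top (fun i => hx2 i (hxA' i))
      (fun i j hij => h.pair_ne_top _ (hxA' i) _ (hxA' j) (hx3 i j hij.ne)) hx4
  have h3 : volume (univ.pi fun _ : Fin m => A) = 0 := by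
    have := ae_iff.1 h2
    simpa only [not_not, ofPred_mem_eq] using this
  rw [volume_pi_pi] at h3
  obtain ⟨i, -, hi⟩ := Finset.prod_eq_zero_iff.1 h3
  exact hvol hi

/-- The Gibbs measures charge less and less the configurations having a point in `B N`, if
`|B N| → 0`. -/
lemma tendsto_gibbs_count_ne_zero (h : PotentialsConverge S A Φ Ψ ΦN ΨN)
    (m : ℕ) {B : ℕ → Set (Sp d)} (hB : ∀ N, MeasurableSet (B N))
    (hlim : Tendsto (fun N => volume (B N)) atTop (𝓝 0)) :
    Tendsto (fun N => gibbs S (ΦN N) (ΨN N) A m {s | s.count (B N) = 0}ᶜ) atTop (𝓝 0) := by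
  obtain ⟨M, hM, hle⟩ := h.exists_exp_le m
  have hpi := measurableSet_pi_const h.meas m
  have hmeas : ∀ N, MeasurableSet ({s : Conf S | s.count (B N) = 0}ᶜ) := fun N =>
    (Conf.measurable_count (hB N) (measurableSet_singleton 0)).compl
  set K : ℝ≥0∞ := poissonWeight A m * (M * (m * volume A ^ (m - 1))) with hK
  have hKtop : K ≠ ∞ := ENNReal.mul_ne_top (poissonWeight_ne_top A m) (ENNReal.mul_ne_top hM
    (ENNReal.mul_ne_top (ENNReal.natCast_ne_top m) (ENNReal.pow_ne_top h.bdd.measure_lt_top.ne)))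
  have hbound : ∀ N, gibbs S (ΦN N) (ΨN N) A m {s | s.count (B N) = 0}ᶜ ≤ K * volume (B N) := by
    intro N
    rw [gibbs_apply (h.freeN N) (h.pairN N) h.meas_S h.subset h.meas h.bdd m (hmeas N), hK,
      mul_assoc, mul_assoc]
    gcongr
    let W : Fin m → Set (Fin m → Sp d) := fun i =>
      univ.pi (Function.update (fun _ => A) i (B N))
    have hW : ∀ i, MeasurableSet (W i) := fun i => MeasurableSet.univ_pi fun j => by
      by_cases hj : j = i
      · subst hj; simpa using hB N
      · simpa [Function.update_of_ne hj] using h.meas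
    calc ∫⁻ x in univ.pi fun _ : Fin m => A,
          (Conf.ofPoints S ⁻¹' {s | s.count (B N) = 0}ᶜ).indicator
            (fun x => EReal.exp (-energy (ΦN N) (ΨN N) x)) x
        ≤ ∫⁻ x in univ.pi fun _ : Fin m => A, (⋃ i, W i).indicator (fun _ => M) x := by
          refine lintegral_mono_ae ((ae_restrict_iff' hpi).2 (Eventually.of_forall fun x hx => ?_))
          have hxA : ∀ i, x i ∈ A := fun i => hx i (mem_univ i)
          by_cases hxB : x ∈ Conf.ofPoints S ⁻¹' {s | s.count (B N) = 0}ᶜ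
          · have hxW : x ∈ ⋃ i, W i := by
              by_contra hno
              refine hxB ?_
              change (Conf.ofPoints S x).count (B N) = 0
              rw [Conf.count_ofPoints fun i => h.subset (hxA i)]
              refine Finset.sum_eq_zero fun i _ => indicator_of_notMem (fun hi => hno ?_) _
              refine mem_iUnion.2 ⟨i, fun j _ => ?_⟩
              by_cases hj : j = i
              · subst hj; simpa using hi
              · simpa [Function.update_of_ne hj] using hxA j
            rw [indicator_of_mem hxB, indicator_of_mem hxW]
            exact hle N x hxA
          · rw [indicator_of_notMem hxB]
            exact zero_le
      _ ≤ ∫⁻ x : Fin m → Sp d, (⋃ i, W i).indicator (fun _ => M) x :=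
          setLIntegral_le_lintegral _ _
      _ = M * volume (⋃ i, W i) := by
          rw [lintegral_indicator (MeasurableSet.iUnion hW), setLIntegral_const]
      _ ≤ M * ∑ i, volume (W i) := by
          gcongr
          exact measure_iUnion_fintype_le _ _
      _ = M * (m * volume A ^ (m - 1) * volume (B N)) := by
          have : ∀ i, volume (W i) = volume A ^ (m - 1) * volume (B N) := by
            intro i
            rw [volume_pi_pi, ← Finset.mul_prod_erase _ _ (Finset.mem_univ i),
              Function.update_self, mul_comm]
            congr 1
            rw [Finset.prod_congr rfl (g := fun _ => volume A) fun j hj => by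
              rw [Function.update_of_ne (Finset.ne_of_mem_erase hj)], Finset.prod_const,
              Finset.card_erase_of_mem (Finset.mem_univ i), Finset.card_univ, Fintype.card_fin]
          simp_rw [this]
          rw [Finset.sum_const, Finset.card_univ, Fintype.card_fin, nsmul_eq_mul, mul_assoc]
  have hz : Tendsto (fun N => K * volume (B N)) atTop (𝓝 0) := by
    simpa using ENNReal.Tendsto.const_mul hlim (Or.inr hKtop)
  exact tendsto_of_tendsto_of_tendsto_of_le_of_le tendsto_const_nhds hz (fun N => zero_le) hbound

lemma tendsto_gibbs_inter (h : PotentialsConverge S A Φ Ψ ΦN ΨN)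
    (m : ℕ) {B : ℕ → Set (Sp d)} (hB : ∀ N, MeasurableSet (B N))
    (hlim : Tendsto (fun N => volume (B N)) atTop (𝓝 0)) {D : Set (Conf S)}
    (hD : MeasurableSet D) :
    Tendsto (fun N => gibbs S (ΦN N) (ΨN N) A m (D ∩ {s | s.count (B N) = 0})) atTop
      (𝓝 (gibbs S Φ Ψ A m D)) := by
  have h1 := h.tendsto_gibbs m hD
  have h2 := h.tendsto_gibbs_count_ne_zero m hB hlim
  have h3 : Tendsto (fun N => gibbs S (ΦN N) (ΨN N) A m D -
      gibbs S (ΦN N) (ΨN N) A m {s | s.count (B N) = 0}ᶜ) atTop (𝓝 (gibbs S Φ Ψ A m D)) := by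
    simpa using ENNReal.Tendsto.sub h1 h2 (Or.inr ENNReal.zero_ne_top)
  refine tendsto_of_tendsto_of_tendsto_of_le_of_le h3 h1 (fun N => ?_)
    fun N => measure_mono inter_subset_left
  rw [tsub_le_iff_right]
  refine (measure_mono fun s hs => ?_).trans (measure_union_le _ _)
  by_cases hs0 : s ∈ {s : Conf S | s.count (B N) = 0}
  · exact Or.inl ⟨hs, hs0⟩
  · exact Or.inr hs0

end PotentialsConverge

end GibbsLimit

/-! ### Convergence of laws from factorial moments -/

section FactorialMoments

lemma summable_prod_pow (p : ℕ) {r : ℝ} (h0 : 0 ≤ r) (h1 : r < 1) :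
    Summable fun k : Fin p → ℕ => ∏ i, r ^ k i := by
  induction p with
  | zero => exact Summable.of_finite
  | succ p ih =>
    rw [← (Fin.consEquiv fun _ => ℕ).summable_iff]
    have := (summable_geometric_of_lt_one h0 h1).mul_of_nonneg ih (fun n => pow_nonneg h0 n)
      fun k => Finset.prod_nonneg fun i _ => pow_nonneg h0 _
    refine this.congr fun q => ?_
    simp [Fin.consEquiv, Fin.prod_univ_succ]

lemma sum_neg_one_pow_choose (a v : ℕ) :
    ∑ j ∈ Finset.range (a + 1), (-1 : ℝ) ^ j * ((v + j).choose v) * (a.choose (v + j)) =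
      if a = v then 1 else 0 := by
  have h : ∀ j, (-1 : ℝ) ^ j * ((v + j).choose v) * (a.choose (v + j)) =
      a.choose v * ((-1) ^ j * (a - v).choose j) := by
    intro j
    have := Nat.choose_mul (n := a) (k := v + j) (s := v) (Nat.le_add_right v j)
    rw [Nat.add_sub_cancel_left] at this
    have h2 : ((a.choose (v + j) : ℕ) : ℝ) * ((v + j).choose v : ℕ) =
        (a.choose v : ℕ) * ((a - v).choose j : ℕ) := by exact_mod_cast this
    linear_combination (-1 : ℝ) ^ j * h2
  simp_rw [h, ← Finset.mul_sum]
  rcases lt_or_ge a v with hav | hav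
  · rw [Nat.choose_eq_zero_of_lt hav, if_neg hav.ne]
    simp
  · have h3 : ∑ j ∈ Finset.range (a + 1), (-1 : ℝ) ^ j * ((a - v).choose j) =
        ∑ j ∈ Finset.range (a - v + 1), (-1 : ℝ) ^ j * ((a - v).choose j) := by
      refine (Finset.sum_subset (Finset.range_subset_range.2 (by omega)) fun j _ hj => ?_).symm
      rw [Nat.choose_eq_zero_of_lt (by simpa using hj)]
      simp
    have h4 : ∑ j ∈ Finset.range (a - v + 1), (-1 : ℝ) ^ j * ((a - v).choose j) =
        if a - v = 0 then 1 else 0 := by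
      have := Int.alternating_sum_range_choose (n := a - v)
      exact_mod_cast congrArg (Int.cast : ℤ → ℝ) this
    rw [h3, h4]
    by_cases hv : a = v
    · subst hv; simp
    · rw [if_neg hv, if_neg (by omega), mul_zero]

/-- The coefficients of the inversion formula expressing the indicator of `{a = v}` by the
binomial coefficients of `a`. -/
def inversionCoeff {p : ℕ} (v j : Fin p → ℕ) : ℝ := ∏ i, (-1) ^ j i * ((v i + j i).choose (v i) : ℝ)

lemma tsum_inversionCoeff {p : ℕ} (a v : Fin p → ℕ) :
    ∑' j : Fin p → ℕ, inversionCoeff v j * ∏ i, ((a i).choose (v i + j i) : ℝ) =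
      if a = v then 1 else 0 := by
  have h0 : ∀ j : Fin p → ℕ, j ∉ Fintype.piFinset (fun i => Finset.range (a i + 1)) →
      inversionCoeff v j * ∏ i, ((a i).choose (v i + j i) : ℝ) = 0 := by
    intro j hj
    simp only [Fintype.mem_piFinset, Finset.mem_range, not_forall, not_lt] at hj
    obtain ⟨i, hi⟩ := hj
    rw [Finset.prod_eq_zero (Finset.mem_univ i), mul_zero]
    rw [Nat.choose_eq_zero_of_lt (by omega), Nat.cast_zero]
  rw [tsum_eq_sum h0]
  simp_rw [inversionCoeff, ← Finset.prod_mul_distrib]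
  rw [← Finset.prod_univ_sum (fun i => Finset.range (a i + 1))
    fun i j => (-1 : ℝ) ^ j * ((v i + j).choose (v i)) * ((a i).choose (v i + j))]
  simp_rw [sum_neg_one_pow_choose]
  by_cases h : a = v
  · simp [h]
  · rw [if_neg h]
    obtain ⟨i, hi⟩ := Function.ne_iff.1 h
    exact Finset.prod_eq_zero (Finset.mem_univ i) (if_neg hi)

lemma abs_inversionCoeff_le {p : ℕ} (v j : Fin p → ℕ) :
    |inversionCoeff v j| ≤ ∏ i, (2 : ℝ) ^ (v i + j i) := by
  rw [inversionCoeff, Finset.abs_prod]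
  refine Finset.prod_le_prod (fun i _ => abs_nonneg _) fun i _ => ?_
  rw [abs_mul, abs_pow, abs_neg, abs_one, one_pow, one_mul, Nat.abs_cast]
  exact_mod_cast Nat.choose_le_two_pow _ _

variable {X : Type*} [MeasurableSpace X] {p : ℕ}

/-- The joint binomial moments of integer valued random variables. -/
def binomialMoment (P : Measure X) (a : Fin p → X → ℕ) (k : Fin p → ℕ) : ℝ≥0∞ :=
  ∫⁻ x, ∏ i, ((a i x).choose (k i) : ℝ≥0∞) ∂P

lemma measurable_prod_choose {a : Fin p → X → ℕ} (ha : ∀ i, Measurable (a i)) (k : Fin p → ℕ) :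
    Measurable fun x => ∏ i, ((a i x).choose (k i) : ℝ≥0∞) :=
  Finset.measurable_prod _ fun i _ =>
    (measurable_from_nat (f := fun n : ℕ => (n.choose (k i) : ℝ≥0∞))).comp (ha i)

lemma tsum_binomialMoment {P : Measure X} {a : Fin p → X → ℕ}
    (ha : ∀ i, Measurable (a i)) {M : ℝ}
    (hM : ∀ k, binomialMoment P a k ≤ ENNReal.ofReal (M * ∏ i, (1 / 4 : ℝ) ^ k i))
    (hM0 : 0 ≤ M) (v : Fin p → ℕ) :
    P.real {x | (fun i => a i x) = v} =
      ∑' j : Fin p → ℕ, inversionCoeff v j * (binomialMoment P a (fun i => v i + j i)).toReal := by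
  have hpos : ∀ k : Fin p → ℕ, 0 ≤ M * ∏ i, (1 / 4 : ℝ) ^ k i := fun k =>
    mul_nonneg hM0 (Finset.prod_nonneg fun i _ => by positivity)
  have hcm : ∀ k : Fin p → ℕ, Measurable fun x => ∏ i, ((a i x).choose (k i) : ℝ) := fun k =>
    Finset.measurable_prod _ fun i _ =>
      (measurable_from_nat (f := fun n : ℕ => (n.choose (k i) : ℝ))).comp (ha i)
  have hof : ∀ (k : Fin p → ℕ) x, ENNReal.ofReal (∏ i, ((a i x).choose (k i) : ℝ)) =
      ∏ i, ((a i x).choose (k i) : ℝ≥0∞) := fun k x => by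
    rw [ENNReal.ofReal_prod_of_nonneg fun i _ => Nat.cast_nonneg _]
    simp
  have hnn : ∀ (k : Fin p → ℕ) x, 0 ≤ ∏ i, ((a i x).choose (k i) : ℝ) := fun k x =>
    Finset.prod_nonneg fun i _ => Nat.cast_nonneg _
  have hint : ∀ k : Fin p → ℕ, Integrable (fun x => ∏ i, ((a i x).choose (k i) : ℝ)) P := by
    intro k
    refine ⟨(hcm k).aestronglyMeasurable, ?_⟩
    rw [hasFiniteIntegral_iff_ofReal (Eventually.of_forall (hnn k))]
    simp_rw [hof]
    exact (hM k).trans_lt ENNReal.ofReal_lt_top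
  have hval : ∀ k : Fin p → ℕ, ∫ x, ∏ i, ((a i x).choose (k i) : ℝ) ∂P =
      (binomialMoment P a k).toReal := by
    intro k
    rw [integral_eq_lintegral_of_nonneg_ae (Eventually.of_forall (hnn k))
      (hcm k).aestronglyMeasurable, binomialMoment]
    simp_rw [hof]
  have hle : ∀ k, (binomialMoment P a k).toReal ≤ M * ∏ i, (1 / 4 : ℝ) ^ k i := fun k =>
    ENNReal.toReal_le_of_le_ofReal (hpos k) (hM k)
  set F : (Fin p → ℕ) → X → ℝ := fun j x =>
    inversionCoeff v j * ∏ i, ((a i x).choose (v i + j i) : ℝ) with hF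
  have hFint : ∀ j, Integrable (F j) P := fun j => (hint fun i => v i + j i).const_mul _
  have hsum : Summable fun j => ∫ x, ‖F j x‖ ∂P := by
    have hs := ((summable_prod_pow p (r := 1 / 2) (by norm_num) (by norm_num)).mul_left
      (M * ∏ i, (1 / 2 : ℝ) ^ v i))
    refine Summable.of_nonneg_of_le (fun j => integral_nonneg fun x => norm_nonneg _)
      (fun j => ?_) hs
    have e1 : ∀ x, ‖F j x‖ = |inversionCoeff v j| * ∏ i, ((a i x).choose (v i + j i) : ℝ) :=
      fun x => by
        rw [hF, Real.norm_eq_abs, abs_mul, abs_of_nonneg (hnn (fun i => v i + j i) x)]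
    simp_rw [e1]
    rw [integral_const_mul, hval fun i => v i + j i]
    calc |inversionCoeff v j| * (binomialMoment P a fun i => v i + j i).toReal
        ≤ (∏ i, (2 : ℝ) ^ (v i + j i)) * (M * ∏ i, (1 / 4 : ℝ) ^ (v i + j i)) :=
          mul_le_mul (abs_inversionCoeff_le v j) (hle _) ENNReal.toReal_nonneg
            (Finset.prod_nonneg fun i _ => by positivity)
      _ = M * ∏ i, ((2 : ℝ) ^ (v i + j i) * (1 / 4 : ℝ) ^ (v i + j i)) := by
          rw [Finset.prod_mul_distrib]; ring
      _ = M * (∏ i, (1 / 2 : ℝ) ^ v i) * ∏ i, (1 / 2 : ℝ) ^ j i := by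
          rw [mul_assoc, ← Finset.prod_mul_distrib]
          congr 1
          refine Finset.prod_congr rfl fun i _ => ?_
          rw [← mul_pow, ← pow_add]
          norm_num
  have key := (hasSum_integral_of_summable_integral_norm hFint hsum).tsum_eq
  have e2 : ∀ j, ∫ x, F j x ∂P =
      inversionCoeff v j * (binomialMoment P a (fun i => v i + j i)).toReal := fun j => by
    rw [hF]
    simp only
    rw [integral_const_mul, hval fun i => v i + j i]
  simp_rw [e2] at key
  rw [key]
  have hmv : MeasurableSet {x | (fun i => a i x) = v} :=
    (measurable_pi_lambda _ ha) (measurableSet_singleton v)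
  have e3 : ∀ x, ∑' j, F j x = {x | (fun i => a i x) = v}.indicator (fun _ => (1 : ℝ)) x := by
    intro x
    rw [hF]
    simp only
    rw [tsum_inversionCoeff (fun i => a i x) v]
    by_cases h : (fun i => a i x) = v
    · rw [if_pos h, indicator_of_mem (show x ∈ {x | (fun i => a i x) = v} from h)]
    · rw [if_neg h, indicator_of_notMem (show x ∉ {x | (fun i => a i x) = v} from h)]
  simp_rw [e3]
  rw [integral_indicator hmv, setIntegral_const, smul_eq_mul, mul_one]

/-- Convergence of the joint laws of integer valued random variables follows from the convergence
of their factorial moments, if the binomial moments decay fast enough for the inversion formula. -/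
lemma tendsto_measure_of_factorialMoments {P : ℕ → Measure X} {Q : Measure X}
    [∀ N, IsFiniteMeasure (P N)] [IsFiniteMeasure Q] {a : Fin p → X → ℕ}
    (ha : ∀ i, Measurable (a i))
    (hlim : ∀ k : Fin p → ℕ, Tendsto
      (fun N => ∫⁻ x, ∏ i, ((a i x).descFactorial (k i) : ℝ≥0∞) ∂(P N)) atTop
      (𝓝 (∫⁻ x, ∏ i, ((a i x).descFactorial (k i) : ℝ≥0∞) ∂Q)))
    {M : ℝ} (hM0 : 0 ≤ M)
    (hM : ∀ N k, binomialMoment (P N) a k ≤ ENNReal.ofReal (M * ∏ i, (1 / 4 : ℝ) ^ k i))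
    (E : Set (Fin p → ℕ)) :
    Tendsto (fun N => P N {x | (fun i => a i x) ∈ E}) atTop
      (𝓝 (Q {x | (fun i => a i x) ∈ E})) := by
  have hpos : ∀ k : Fin p → ℕ, 0 ≤ M * ∏ i, (1 / 4 : ℝ) ^ k i := fun k =>
    mul_nonneg hM0 (Finset.prod_nonneg fun i _ => by positivity)
  have hdesc : ∀ (ν : Measure X) (k : Fin p → ℕ),
      binomialMoment ν a k = (∏ i, ((k i).factorial : ℝ≥0∞))⁻¹ *
        (∫⁻ x, ∏ i, ((a i x).descFactorial (k i) : ℝ≥0∞) ∂ν) := by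
    intro ν k
    have h0 : ∏ i, ((k i).factorial : ℝ≥0∞) ≠ 0 := Finset.prod_ne_zero_iff.2 fun i _ => by
      exact_mod_cast (k i).factorial_ne_zero
    have h1 : ∏ i, ((k i).factorial : ℝ≥0∞) ≠ ∞ :=
      ENNReal.prod_ne_top fun i _ => ENNReal.natCast_ne_top _
    simp_rw [Nat.descFactorial_eq_factorial_mul_choose, Nat.cast_mul, Finset.prod_mul_distrib]
    rw [lintegral_const_mul _ (measurable_prod_choose ha k), ← mul_assoc,
      ENNReal.inv_mul_cancel h0 h1, one_mul, binomialMoment]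
  have hbm : ∀ k, Tendsto (fun N => binomialMoment (P N) a k) atTop (𝓝 (binomialMoment Q a k)) := by
    intro k
    simp_rw [hdesc]
    refine ENNReal.Tendsto.const_mul (hlim k) (Or.inr (ENNReal.inv_ne_top.2 ?_))
    exact Finset.prod_ne_zero_iff.2 fun i _ => by exact_mod_cast (k i).factorial_ne_zero
  have hMQ : ∀ k, binomialMoment Q a k ≤ ENNReal.ofReal (M * ∏ i, (1 / 4 : ℝ) ^ k i) := fun k =>
    le_of_tendsto' (hbm k) fun N => hM N k
  have hle : ∀ N k, (binomialMoment (P N) a k).toReal ≤ M * ∏ i, (1 / 4 : ℝ) ^ k i := fun N k =>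
    ENNReal.toReal_le_of_le_ofReal (hpos k) (hM N k)
  have hmv : ∀ v, MeasurableSet {x | (fun i => a i x) = v} := fun v =>
    (measurable_pi_lambda _ ha) (measurableSet_singleton v)
  -- the point masses converge, by dominated convergence in the inversion formula
  have hpt : ∀ v, Tendsto (fun N => (P N).real {x | (fun i => a i x) = v}) atTop
      (𝓝 (Q.real {x | (fun i => a i x) = v})) := by
    intro v
    simp_rw [fun N => tsum_binomialMoment ha (hM N) hM0 v]
    rw [tsum_binomialMoment ha hMQ hM0 v]
    have hs := ((summable_prod_pow p (r := 1 / 2) (by norm_num) (by norm_num)).mul_left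
      (M * ∏ i, (1 / 2 : ℝ) ^ v i))
    refine tendsto_tsum_of_dominated_convergence hs (fun j => ?_)
      (Eventually.of_forall fun N j => ?_)
    · refine Tendsto.const_mul _ ((ENNReal.tendsto_toReal ?_).comp (hbm _))
      exact ne_top_of_le_ne_top ENNReal.ofReal_ne_top (hMQ _)
    · rw [Real.norm_eq_abs, abs_mul, abs_of_nonneg ENNReal.toReal_nonneg]
      calc |inversionCoeff v j| * (binomialMoment (P N) a fun i => v i + j i).toReal
          ≤ (∏ i, (2 : ℝ) ^ (v i + j i)) * (M * ∏ i, (1 / 4 : ℝ) ^ (v i + j i)) :=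
            mul_le_mul (abs_inversionCoeff_le v j) (hle N _) ENNReal.toReal_nonneg
              (Finset.prod_nonneg fun i _ => by positivity)
        _ = M * ∏ i, ((2 : ℝ) ^ (v i + j i) * (1 / 4 : ℝ) ^ (v i + j i)) := by
            rw [Finset.prod_mul_distrib]; ring
        _ = M * (∏ i, (1 / 2 : ℝ) ^ v i) * ∏ i, (1 / 2 : ℝ) ^ j i := by
            rw [mul_assoc, ← Finset.prod_mul_distrib]
            congr 1
            refine Finset.prod_congr rfl fun i _ => ?_
            rw [← mul_pow, ← pow_add]
            norm_num
  -- the probability of `E` is a sum of point masses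
  have hsumE : ∀ R : Measure X, IsFiniteMeasure R → HasSum
      (fun v : E => R.real {x | (fun i => a i x) = (v : Fin p → ℕ)})
      (R.real {x | (fun i => a i x) ∈ E}) := by
    intro R hR
    have hU : {x | (fun i => a i x) ∈ E} = ⋃ v : E, {x | (fun i => a i x) = (v : Fin p → ℕ)} := by
      ext x
      simp
    rw [hU]
    have hdisj : Pairwise (Function.onFun Disjoint
        fun v : E => {x | (fun i => a i x) = (v : Fin p → ℕ)}) := by
      intro v w hvw
      refine Set.disjoint_left.2 fun x hx hx' => hvw (Subtype.ext ?_)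
      exact (show _ = _ from hx).symm.trans hx'
    have h1 : ∑' v : E, R {x | (fun i => a i x) = (v : Fin p → ℕ)} =
        R (⋃ v : E, {x | (fun i => a i x) = (v : Fin p → ℕ)}) :=
      (measure_iUnion hdisj fun v => hmv v).symm
    have := ENNReal.hasSum_toReal (h1 ▸ measure_ne_top R _)
    rw [← ENNReal.tsum_toReal_eq fun _ => measure_ne_top _ _, h1] at this
    exact this
  have hreal : Tendsto (fun N => (P N).real {x | (fun i => a i x) ∈ E}) atTop
      (𝓝 (Q.real {x | (fun i => a i x) ∈ E})) := by
    simp_rw [fun N => (hsumE (P N) inferInstance).tsum_eq.symm]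
    rw [← (hsumE Q inferInstance).tsum_eq]
    have hs : Summable fun v : E => M * ∏ i, (1 / 4 : ℝ) ^ (v : Fin p → ℕ) i :=
      ((summable_prod_pow p (r := 1 / 4) (by norm_num) (by norm_num)).mul_left M).subtype E
    refine tendsto_tsum_of_dominated_convergence hs (fun v => hpt v)
      (Eventually.of_forall fun N v => ?_)
    rw [Real.norm_eq_abs, abs_of_nonneg measureReal_nonneg]
    refine ENNReal.toReal_le_of_le_ofReal (hpos v) (le_trans ?_ (hM N v))
    rw [binomialMoment, ← lintegral_indicator_one (hmv v)]
    refine lintegral_mono fun x => ?_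
    by_cases h : x ∈ {x | (fun i => a i x) = (v : Fin p → ℕ)}
    · have h' : ∀ i, a i x = (v : Fin p → ℕ) i := fun i => congrFun h i
      rw [indicator_of_mem h]
      simp [h']
    · rw [indicator_of_notMem h]
      exact zero_le
  have h1 := ENNReal.tendsto_ofReal hreal
  simp only [Measure.real, ENNReal.ofReal_toReal (measure_ne_top _ _)] at h1
  exact h1

lemma choose_mul_choose_le (a b k l : ℕ) :
    a.choose k * b.choose l ≤ (a + b).choose (k + l) := by
  rw [Nat.add_choose_eq]
  refine Finset.single_le_sum (f := fun ij : ℕ × ℕ => a.choose ij.1 * b.choose ij.2)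
    (fun _ _ => Nat.zero_le _) (a := (k, l)) ?_
  simp

lemma prod_choose_le (a k : Fin p → ℕ) :
    ∏ i, (a i).choose (k i) ≤ (∑ i, a i).choose (∑ i, k i) := by
  induction p with
  | zero => simp
  | succ p ih =>
    rw [Fin.prod_univ_succ, Fin.sum_univ_succ, Fin.sum_univ_succ]
    exact (Nat.mul_le_mul_left _ (ih _ _)).trans (choose_mul_choose_le _ _ _ _)

/-- For `δ < 1` the factorials beat the growth `(D K^δ)^K`. -/
lemma exists_pow_div_factorial_le (D δ : ℝ) (hD : 0 ≤ D) (hδ : δ < 1) :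
    ∃ M : ℝ, 0 ≤ M ∧ ∀ K : ℕ, (D * (K : ℝ) ^ δ) ^ K / K.factorial ≤ M * (1 / 4) ^ K := by
  have hlim : Tendsto (fun K : ℕ => D * Real.exp 1 * (K : ℝ) ^ (δ - 1)) atTop (𝓝 0) := by
    have h1 : Tendsto (fun x : ℝ => x ^ (-(1 - δ))) atTop (𝓝 0) :=
      tendsto_rpow_neg_atTop (by linarith)
    have h2 := (h1.comp tendsto_natCast_atTop_atTop).const_mul (D * Real.exp 1)
    simpa [Function.comp_def] using h2
  obtain ⟨K₀, hK₀⟩ := eventually_atTop.1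
    (hlim.eventually (gt_mem_nhds (show (0 : ℝ) < 1 / 4 by norm_num)))
  have hterm : ∀ K : ℕ, 0 ≤ (D * (K : ℝ) ^ δ) ^ K / K.factorial * 4 ^ K := fun K => by
    positivity
  refine ⟨1 + ∑ K ∈ Finset.range (K₀ + 1), (D * (K : ℝ) ^ δ) ^ K / K.factorial * 4 ^ K,
    by have := Finset.sum_nonneg fun K (_ : K ∈ Finset.range (K₀ + 1)) => hterm K; linarith,
    fun K => ?_⟩
  rcases le_or_gt K K₀ with hK | hK
  · have h1 := Finset.single_le_sum (f := fun K : ℕ =>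
      (D * (K : ℝ) ^ δ) ^ K / K.factorial * 4 ^ K) (fun K _ => hterm K)
      (Finset.mem_range.2 (Nat.lt_succ_of_le hK))
    calc (D * (K : ℝ) ^ δ) ^ K / K.factorial
        = (D * (K : ℝ) ^ δ) ^ K / K.factorial * 4 ^ K * (1 / 4) ^ K := by
          rw [mul_assoc, ← mul_pow]; norm_num
      _ ≤ _ := by
          gcongr
          linarith
  · have hKpos : (0 : ℝ) < K := by exact_mod_cast (Nat.zero_le K₀).trans_lt hK
    have hle : (D * (K : ℝ) ^ δ) ^ K / K.factorial ≤ (1 / 4) ^ K := by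
      have h2 : (K : ℝ) ^ K / K.factorial ≤ Real.exp 1 ^ K := by
        rw [← Real.exp_nat_mul, mul_one]
        exact Real.pow_div_factorial_le_exp _ hKpos.le K
      calc (D * (K : ℝ) ^ δ) ^ K / K.factorial
          = (D * (K : ℝ) ^ (δ - 1)) ^ K * ((K : ℝ) ^ K / K.factorial) := by
            rw [← mul_div_assoc, ← mul_pow, mul_assoc, Real.rpow_sub_one hKpos.ne',
              div_mul_cancel₀ _ hKpos.ne']
        _ ≤ (D * (K : ℝ) ^ (δ - 1)) ^ K * Real.exp 1 ^ K := by gcongr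
        _ = (D * Real.exp 1 * (K : ℝ) ^ (δ - 1)) ^ K := by rw [← mul_pow]; ring
        _ ≤ (1 / 4) ^ K := by
            gcongr
            exact (hK₀ K hK.le).le
    refine hle.trans (le_mul_of_one_le_left (by positivity) ?_)
    have := Finset.sum_nonneg fun K (_ : K ∈ Finset.range (K₀ + 1)) => hterm K
    linarith

end FactorialMoments

/-! ### Local convergence from correlation functions -/

namespace Conf

variable {S : Set (Sp d)}

/-- The number of points of `s` in `A`, as a natural number; meaningful if it is finite. -/
def num (s : Conf S) (A : Set (Sp d)) : ℕ := (s.points A).card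

lemma natCast_num (s : Conf S) {A : Set (Sp d)} (hA : Bornology.IsBounded A) :
    (s.num A : ℝ≥0∞) = s.count A := (s.count_eq_card hA).symm

lemma measurable_num {A : Set (Sp d)} (hA : MeasurableSet A) (hb : Bornology.IsBounded A) :
    Measurable fun s : Conf S => s.num A := by
  refine measurable_to_countable' fun n => ?_
  have : (fun s : Conf S => s.num A) ⁻¹' {n} = {s | s.count A = (n : ℝ≥0∞)} := by
    ext s
    change s.num A = n ↔ s.count A = n
    rw [← natCast_num s hb]
    exact Nat.cast_inj.symm
  rw [this]
  exact measurable_count hA (measurableSet_singleton _)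

lemma sum_num_le (s : Conf S) {ι : Type*} [Fintype ι] {A : ι → Set (Sp d)} {B : Set (Sp d)}
    (hA : ∀ i, MeasurableSet (A i)) (hB : MeasurableSet B) (hb : Bornology.IsBounded B)
    (hAB : ∀ i, A i ⊆ B) (hdisj : Pairwise fun i j => Disjoint (A i) (A j)) :
    ∑ i, s.num (A i) ≤ s.num B := by
  have h : ((∑ i, s.num (A i) : ℕ) : ℝ≥0∞) ≤ (s.num B : ℝ≥0∞) := by
    rw [Nat.cast_sum, natCast_num s hb, ← toMeasure_eq_count s hB]
    have : ∀ i, (s.num (A i) : ℝ≥0∞) = s.toMeasure (A i) := fun i => by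
      rw [natCast_num s (hb.subset (hAB i)), toMeasure_eq_count s (hA i)]
    simp_rw [this]
    calc ∑ i, s.toMeasure (A i) = s.toMeasure (⋃ i, A i) := by
          rw [measure_iUnion hdisj hA, tsum_fintype]
      _ ≤ s.toMeasure B := measure_mono (iUnion_subset hAB)
  exact_mod_cast h

/-- The atom of the sets `A i` consisting of the points that lie in `A i` exactly for `i ∈ I`; the
points outside all of the sets are left out. -/
def atom {p : ℕ} (A : Fin p → Set (Sp d)) (I : Finset (Fin p)) : Set (Sp d) :=
  {x | x ∈ ⋃ i, A i} ∩ {x | ∀ i, x ∈ A i ↔ i ∈ I}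

lemma num_eq_sum_atom (s : Conf S) {p : ℕ} {A : Fin p → Set (Sp d)}
    (hb : ∀ i, Bornology.IsBounded (A i)) (i : Fin p) :
    s.num (A i) = ∑ I : Finset (Fin p), if i ∈ I then s.num (atom A I) else 0 := by
  classical
  have hbU : Bornology.IsBounded (⋃ i, A i) := Bornology.isBounded_iUnion.2 hb
  have h : (s.num (A i) : ℝ≥0∞) =
      ((∑ I : Finset (Fin p), if i ∈ I then s.num (atom A I) else 0 : ℕ) : ℝ≥0∞) := by
    rw [natCast_num s (hb i), Nat.cast_sum, count_eq_tsum_indicator]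
    have h1 : ∀ I : Finset (Fin p), ((if i ∈ I then s.num (atom A I) else 0 : ℕ) : ℝ≥0∞) =
        ∑' x, if i ∈ I then (atom A I).indicator (fun x => (s.mult x : ℝ≥0∞)) x else 0 := by
      intro I
      split_ifs with hi
      · have hbI : Bornology.IsBounded (atom A I) := hbU.subset inter_subset_left
        rw [natCast_num s hbI, count_eq_tsum_indicator]
      · simp
    simp_rw [h1]
    rw [← Summable.tsum_finsetSum fun I _ => ENNReal.summable]
    refine tsum_congr fun x => ?_
    by_cases hx : x ∈ A i
    · rw [indicator_of_mem hx, Finset.sum_eq_single (Finset.univ.filter fun j => x ∈ A j)]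
      · rw [if_pos (by simpa using hx), indicator_of_mem]
        exact ⟨mem_iUnion.2 ⟨i, hx⟩, fun j => by simp⟩
      · intro I _ hI
        split_ifs with hi
        · refine indicator_of_notMem (fun hxI => hI ?_) _
          ext j
          simpa using (hxI.2 j).symm
        · rfl
      · simp
    · rw [indicator_of_notMem hx]
      refine (Finset.sum_eq_zero fun I _ => ?_).symm
      split_ifs with hi
      · exact indicator_of_notMem (fun hxI => hx ((hxI.2 i).2 hi)) _
      · rfl
  exact_mod_cast h

end Conf

section Correlation

variable {S : Set (Sp d)}

lemma IsCorrelation.lintegral_descFactorial {μ : Measure (Conf S)} {p : ℕ} {k : Fin p → ℕ}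
    {ρ : (Fin (∑ i, k i) → Sp d) → ℝ≥0} (h : IsCorrelation μ (∑ i, k i) ρ)
    {A : Fin p → Set (Sp d)} (hA : ∀ i, MeasurableSet (A i))
    (hb : ∀ i, Bornology.IsBounded (A i)) (hAS : ∀ i, A i ⊆ S)
    (hdisj : Pairwise fun i j => Disjoint (A i) (A j)) :
    ∫⁻ s, ∏ i, ((s.num (A i)).descFactorial (k i) : ℝ≥0∞) ∂μ =
      ∫⁻ x in univ.pi fun j => A (finSigmaFinEquiv.symm j).1, (ρ x : ℝ≥0∞) := by
  rw [h.lintegral_eq p A (fun j => (finSigmaFinEquiv.symm j).1) hA hb hAS hdisj]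
  refine lintegral_congr fun s => Finset.prod_congr rfl fun i _ => ?_
  have hcard : (Finset.univ.filter fun j : Fin (∑ i, k i) =>
      (finSigmaFinEquiv.symm j).1 = i).card = k i := by
    rw [← Fintype.card_fin (k i), ← Fintype.card_subtype]
    refine Fintype.card_congr ?_
    exact (finSigmaFinEquiv.symm.subtypeEquiv (fun _ => Iff.rfl)).trans
      (Equiv.sigmaSubtype (β := fun i => Fin (k i)) i)
  rw [hcard]
  rfl

lemma IsCorrelation.lintegral_descFactorial_one {μ : Measure (Conf S)} {n : ℕ}
    {ρ : (Fin n → Sp d) → ℝ≥0} (h : IsCorrelation μ n ρ) {B : Set (Sp d)}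
    (hB : MeasurableSet B) (hb : Bornology.IsBounded B) (hBS : B ⊆ S) :
    ∫⁻ s, ((s.num B).descFactorial n : ℝ≥0∞) ∂μ =
      ∫⁻ x in univ.pi fun _ : Fin n => B, (ρ x : ℝ≥0∞) := by
  rw [h.lintegral_eq 1 (fun _ => B) (fun _ => 0) (fun _ => hB) (fun _ => hb) (fun _ => hBS)
    fun i j hij => absurd (Subsingleton.elim i j) hij]
  refine lintegral_congr fun s => ?_
  rw [Finset.univ_unique, Finset.prod_singleton]
  simp [Conf.num]

variable {b : ℕ → ℕ} {Φ : Sp d → EReal} {Ψ : Sp d → Sp d → EReal} {μ : Measure (Conf S)}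
  {ΦN : ℕ → Sp d → EReal} {ΨN : ℕ → Sp d → Sp d → EReal} {μN : ℕ → Measure (Conf S)}

lemma exists_forall_norm_le {p : ℕ} {A : Fin p → Set (Sp d)}
    (hb : ∀ i, Bornology.IsBounded (A i)) : ∃ r : ℕ, ∀ i, ∀ x ∈ A i, ‖x‖ ≤ r := by
  obtain ⟨R, hR⟩ := (Bornology.isBounded_iUnion.2 hb).exists_norm_le
  obtain ⟨r, hr⟩ := exists_nat_ge R
  exact ⟨r, fun i x hx => (hR x (mem_iUnion.2 ⟨i, hx⟩)).trans hr⟩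

/-- The probability of a point in `B` is at most the integral of the one-point function over `B`,
and these functions are bounded on bounded sets, uniformly in `N`. -/
lemma IsFiniteParticleApprox.exists_lintegral_count_le
    (h : IsFiniteParticleApprox S b Φ Ψ μ ΦN ΨN μN) (r : ℕ) :
    ∃ c : ℝ, ∀ N, ∀ B : Set (Sp d), MeasurableSet B → B ⊆ S → (∀ x ∈ B, ‖x‖ ≤ r) →
      μN N {s | s.count B ≠ 0} ≤ ENNReal.ofReal c * volume B := by
  obtain ⟨ρ, ρN, -, hρN, -, hbd⟩ := h.correlation
  obtain ⟨c, δ, hc, hδ, hle⟩ := hbd r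
  refine ⟨(c * ((1 : ℕ) : ℝ) ^ δ) ^ 1, fun N B hB hBS hBr => ?_⟩
  have hb : Bornology.IsBounded B :=
    (Metric.isBounded_closedBall (x := (0 : Sp d)) (r := r)).subset fun x hx => by
      simpa using hBr x hx
  have h1 := (hρN N 1).lintegral_descFactorial_one hB hb hBS
  calc μN N {s | s.count B ≠ 0}
      ≤ ∫⁻ s, ((s.num B).descFactorial 1 : ℝ≥0∞) ∂(μN N) := by
        have hm : MeasurableSet {s : Conf S | s.count B ≠ 0} :=
          (Conf.measurable_count hB (measurableSet_singleton 0)).compl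
        rw [← lintegral_indicator_one hm]
        refine lintegral_mono fun s => ?_
        by_cases hs : s ∈ {s : Conf S | s.count B ≠ 0}
        · rw [indicator_of_mem hs]
          have hs' : s.count B ≠ 0 := hs
          rw [← Conf.natCast_num s hb] at hs'
          have : 1 ≤ s.num B := Nat.one_le_iff_ne_zero.2 (by exact_mod_cast hs')
          simpa using this
        · rw [indicator_of_notMem hs]
          exact zero_le
    _ = ∫⁻ x in univ.pi fun _ : Fin 1 => B, (ρN N 1 x : ℝ≥0∞) := h1
    _ ≤ ∫⁻ _ in univ.pi fun _ : Fin 1 => B, ENNReal.ofReal ((c * ((1 : ℕ) : ℝ) ^ δ) ^ 1) := by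
        refine lintegral_mono_ae ((ae_restrict_iff' (measurableSet_pi_const hB 1)).2
          (Eventually.of_forall fun x hx => ?_))
        rw [← ENNReal.ofReal_coe_nnreal]
        exact ENNReal.ofReal_le_ofReal (hle N 1 x fun i =>
          ⟨hBS (hx i (mem_univ i)), hBr _ (hx i (mem_univ i))⟩)
    _ = _ := by
        rw [setLIntegral_const, volume_pi_pi]
        simp

lemma IsFiniteParticleApprox.tendsto_lintegral_correlation
    (h : IsFiniteParticleApprox S b Φ Ψ μ ΦN ΨN μN) {p : ℕ}
    {A : Fin p → Set (Sp d)} (hA : ∀ i, MeasurableSet (A i))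
    (hb : ∀ i, Bornology.IsBounded (A i)) (hAS : ∀ i, A i ⊆ S)
    (hdisj : Pairwise fun i j => Disjoint (A i) (A j)) (k : Fin p → ℕ) :
    Tendsto (fun N => ∫⁻ s, ∏ i, ((s.num (A i)).descFactorial (k i) : ℝ≥0∞) ∂(μN N)) atTop
      (𝓝 (∫⁻ s, ∏ i, ((s.num (A i)).descFactorial (k i) : ℝ≥0∞) ∂μ)) := by
  obtain ⟨ρ, ρN, hρ, hρN, hlim, hbd⟩ := h.correlation
  obtain ⟨r, hr⟩ := exists_forall_norm_le hb
  obtain ⟨c, δ, hc, hδ, hle⟩ := hbd r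
  simp_rw [fun N => (hρN N (∑ i, k i)).lintegral_descFactorial hA hb hAS hdisj]
  rw [(hρ (∑ i, k i)).lintegral_descFactorial hA hb hAS hdisj]
  set n := ∑ i, k i
  set W : Set (Fin n → Sp d) := univ.pi fun j => A (finSigmaFinEquiv.symm j).1 with hW
  have hWm : MeasurableSet W := MeasurableSet.univ_pi fun j => hA _
  refine tendsto_lintegral_of_dominated_convergence
    (fun _ => ENNReal.ofReal ((c * (n : ℝ) ^ δ) ^ n))
    (fun N => (hρN N n).measurable.coe_nnreal_ennreal)
    (fun N => (ae_restrict_iff' hWm).2 (Eventually.of_forall fun x hx => ?_)) ?_ ?_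
  · simp only [← ENNReal.ofReal_coe_nnreal]
    exact ENNReal.ofReal_le_ofReal (hle N n x fun j =>
      ⟨hAS _ (hx j (mem_univ j)), hr _ _ (hx j (mem_univ j))⟩)
  · rw [setLIntegral_const, hW, volume_pi_pi]
    exact ENNReal.mul_ne_top ENNReal.ofReal_ne_top
      (ENNReal.prod_ne_top fun j _ => (hb _).measure_lt_top.ne)
  · refine (ae_restrict_iff' hWm).2 ?_
    filter_upwards [hlim n] with x hx hxW
    exact ENNReal.tendsto_coe.2 (hx fun j => hAS _ (hxW j (mem_univ j)))

lemma IsFiniteParticleApprox.exists_binomialMoment_le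
    (h : IsFiniteParticleApprox S b Φ Ψ μ ΦN ΨN μN) (hS : MeasurableSet S) {p : ℕ}
    {A : Fin p → Set (Sp d)} (hA : ∀ i, MeasurableSet (A i))
    (hb : ∀ i, Bornology.IsBounded (A i)) (hAS : ∀ i, A i ⊆ S)
    (hdisj : Pairwise fun i j => Disjoint (A i) (A j)) :
    ∃ M : ℝ, 0 ≤ M ∧ ∀ N (k : Fin p → ℕ),
      binomialMoment (μN N) (fun i s => s.num (A i)) k ≤
        ENNReal.ofReal (M * ∏ i, (1 / 4 : ℝ) ^ k i) := by
  obtain ⟨ρ, ρN, hρ, hρN, hlim, hbd⟩ := h.correlation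
  obtain ⟨r, hr⟩ := exists_forall_norm_le hb
  obtain ⟨c, δ, hc, hδ, hle⟩ := hbd r
  let B : Set (Sp d) := S ∩ Metric.closedBall 0 r
  have hB : MeasurableSet B := hS.inter Metric.isClosed_closedBall.measurableSet
  have hBb : Bornology.IsBounded B := Metric.isBounded_closedBall.subset inter_subset_right
  have hAB : ∀ i, A i ⊆ B := fun i x hx => ⟨hAS i hx, by simpa using hr i x hx⟩
  set V : ℝ := (volume B).toReal with hV
  have hVB : volume B = ENNReal.ofReal V := (ENNReal.ofReal_toReal hBb.measure_lt_top.ne).symm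
  obtain ⟨M, hM0, hM⟩ := exists_pow_div_factorial_le (V * c) δ
    (mul_nonneg ENNReal.toReal_nonneg hc.le) hδ
  refine ⟨M, hM0, fun N k => ?_⟩
  set K := ∑ i, k i with hK
  have hKf : ((K.factorial : ℕ) : ℝ≥0∞) ≠ 0 := by exact_mod_cast K.factorial_ne_zero
  have h1 : ∫⁻ s, ((s.num B).descFactorial K : ℝ≥0∞) ∂(μN N) ≤
      ENNReal.ofReal ((V * c * (K : ℝ) ^ δ) ^ K) := by
    rw [(hρN N K).lintegral_descFactorial_one hB hBb inter_subset_left]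
    calc ∫⁻ x in univ.pi fun _ : Fin K => B, (ρN N K x : ℝ≥0∞)
        ≤ ∫⁻ _ in univ.pi fun _ : Fin K => B, ENNReal.ofReal ((c * (K : ℝ) ^ δ) ^ K) := by
          refine lintegral_mono_ae ((ae_restrict_iff' (measurableSet_pi_const hB K)).2
            (Eventually.of_forall fun x hx => ?_))
          rw [← ENNReal.ofReal_coe_nnreal]
          exact ENNReal.ofReal_le_ofReal (hle N K x fun i =>
            ⟨(hx i (mem_univ i)).1, by simpa using (hx i (mem_univ i)).2⟩)
      _ = ENNReal.ofReal ((V * c * (K : ℝ) ^ δ) ^ K) := by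
          rw [setLIntegral_const, volume_pi_pi, Finset.prod_const, Finset.card_univ,
            Fintype.card_fin, hVB, ← ENNReal.ofReal_pow ENNReal.toReal_nonneg,
            ← ENNReal.ofReal_mul (by positivity), ← mul_pow]
          congr 2
          ring
  calc binomialMoment (μN N) (fun i s => s.num (A i)) k
      ≤ ∫⁻ s, ((K.factorial : ℕ) : ℝ≥0∞)⁻¹ * ((s.num B).descFactorial K : ℝ≥0∞) ∂(μN N) := by
        refine lintegral_mono fun s => ?_
        rw [Nat.descFactorial_eq_factorial_mul_choose, Nat.cast_mul, ← mul_assoc,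
          ENNReal.inv_mul_cancel hKf (ENNReal.natCast_ne_top _), one_mul]
        have h2 := (prod_choose_le (fun i => s.num (A i)) k).trans
          (Nat.choose_le_choose K (s.sum_num_le hA hB hBb hAB hdisj))
        simp only
        exact_mod_cast h2
    _ = ((K.factorial : ℕ) : ℝ≥0∞)⁻¹ * ∫⁻ s, ((s.num B).descFactorial K : ℝ≥0∞) ∂(μN N) :=
        lintegral_const_mul' _ _ (ENNReal.inv_ne_top.2 hKf)
    _ ≤ ((K.factorial : ℕ) : ℝ≥0∞)⁻¹ * ENNReal.ofReal ((V * c * (K : ℝ) ^ δ) ^ K) := by gcongr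
    _ = ENNReal.ofReal ((V * c * (K : ℝ) ^ δ) ^ K / K.factorial) := by
        rw [ENNReal.ofReal_div_of_pos (by exact_mod_cast K.factorial_pos),
          ENNReal.ofReal_natCast, mul_comm, ← div_eq_mul_inv]
    _ ≤ ENNReal.ofReal (M * ∏ i, (1 / 4 : ℝ) ^ k i) := by
        rw [Finset.prod_pow_eq_pow_sum]
        exact ENNReal.ofReal_le_ofReal (hM K)

/-- Under the assumptions on the correlation functions, the law of the numbers of points in
finitely many bounded Borel sets converges in total variation. -/
lemma IsFiniteParticleApprox.tendsto_measure_num [IsProbabilityMeasure μ]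
    (h : IsFiniteParticleApprox S b Φ Ψ μ ΦN ΨN μN) (hS : MeasurableSet S) {p : ℕ}
    {A : Fin p → Set (Sp d)} (hA : ∀ i, MeasurableSet (A i))
    (hb : ∀ i, Bornology.IsBounded (A i)) (hAS : ∀ i, A i ⊆ S) (E : Set (Fin p → ℕ)) :
    Tendsto (fun N => μN N {s | (fun i => s.num (A i)) ∈ E}) atTop
      (𝓝 (μ {s | (fun i => s.num (A i)) ∈ E})) := by
  have hprob := h.prob
  -- pass to the disjoint atoms of the sets `A i`
  let e : Finset (Fin p) ≃ Fin (Fintype.card (Finset (Fin p))) := Fintype.equivFin _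
  let A' : Fin (Fintype.card (Finset (Fin p))) → Set (Sp d) := fun q => Conf.atom A (e.symm q)
  have hA' : ∀ q, MeasurableSet (A' q) := fun q => by
    refine (MeasurableSet.iUnion hA).inter ?_
    simp only [ofPred_forall]
    refine MeasurableSet.iInter fun i => ?_
    by_cases hi : i ∈ e.symm q
    · simpa [hi] using hA i
    · have : {x | x ∈ A i ↔ i ∈ e.symm q} = (A i)ᶜ := by
        ext x
        simp [hi]
      rw [this]
      exact (hA i).compl
  have hb' : ∀ q, Bornology.IsBounded (A' q) := fun q =>
    (Bornology.isBounded_iUnion.2 hb).subset inter_subset_left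
  have hAS' : ∀ q, A' q ⊆ S := fun q x hx => by
    obtain ⟨i, hi⟩ := mem_iUnion.1 hx.1
    exact hAS i hi
  have hdisj : Pairwise fun q q' => Disjoint (A' q) (A' q') := by
    intro q q' hqq
    refine Set.disjoint_left.2 fun x hx hx' => hqq (e.symm.injective ?_)
    ext i
    exact (hx.2 i).symm.trans (hx'.2 i)
  obtain ⟨M, hM0, hM⟩ := h.exists_binomialMoment_le hS hA' hb' hAS' hdisj
  let E' : Set (Fin (Fintype.card (Finset (Fin p))) → ℕ) :=
    {v | (fun i => ∑ I : Finset (Fin p), if i ∈ I then v (e I) else 0) ∈ E}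
  have key := tendsto_measure_of_factorialMoments
    (fun q => Conf.measurable_num (S := S) (hA' q) (hb' q))
    (h.tendsto_lintegral_correlation hA' hb' hAS' hdisj) hM0 hM E'
  have hset : {s : Conf S | (fun i => s.num (A i)) ∈ E} =
      {s | (fun q => s.num (A' q)) ∈ E'} := by
    ext s
    have : (fun i => s.num (A i)) =
        fun i => ∑ I : Finset (Fin p), if i ∈ I then s.num (A' (e I)) else 0 := by
      funext i
      rw [s.num_eq_sum_atom hb i]
      simp [A']
    change (fun i => s.num (A i)) ∈ E ↔ _
    rw [this]
    rfl
  rw [hset]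
  exact key

end Correlation

/-! ### Cylinder events of configurations -/

section Cylinders

lemma measurable_of_mem_family {X : Type*} {𝓕 : Set (X → ℕ)} {f : X → ℕ} (hf : f ∈ 𝓕) :
    Measurable[MeasurableSpace.generateFrom (cylinders 𝓕)] f := by
  refine @measurable_to_countable' _ _ _ _ (MeasurableSpace.generateFrom (cylinders 𝓕)) f
    fun n => ?_
  refine MeasurableSpace.measurableSet_generateFrom
    ⟨1, fun _ => f, {v | v 0 = n}, fun _ => hf, ?_⟩
  ext x
  simp

lemma generateFrom_cylinders_le {X : Type*} [mX : MeasurableSpace X] {𝓕 : Set (X → ℕ)}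
    (h : ∀ f ∈ 𝓕, Measurable f) : MeasurableSpace.generateFrom (cylinders 𝓕) ≤ mX := by
  refine MeasurableSpace.generateFrom_le ?_
  rintro _ ⟨p, f, E, hf, rfl⟩
  exact (measurable_pi_lambda (fun x i => f i x) fun i => h _ (hf i))
    (Set.to_countable E).measurableSet

/-- The numbers of points in bounded Borel subsets of `S`. -/
def countFns (S : Set (Sp d)) : Set (Conf S → ℕ) :=
  {f | ∃ A : Set (Sp d), (MeasurableSet A ∧ Bornology.IsBounded A ∧ A ⊆ S) ∧ f = fun s => s.num A}

/-- The numbers of points of either component of a pair of configurations. -/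
def pairCountFns (S : Set (Sp d)) : Set (Conf S × Conf S → ℕ) :=
  {f | ∃ A : Set (Sp d), (MeasurableSet A ∧ Bornology.IsBounded A ∧ A ⊆ S) ∧
    ((f = fun z => z.1.num A) ∨ f = fun z => z.2.num A)}

variable {S : Set (Sp d)}

lemma Conf.measurable_of_num (hS : MeasurableSet S) {Ω : Type*} [MeasurableSpace Ω]
    {g : Ω → Conf S} (h : ∀ A, MeasurableSet A → Bornology.IsBounded A → A ⊆ S →
      Measurable fun ω => (g ω).num A) : Measurable g := by
  refine measurable_of_count fun A hA hb => ?_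
  have hb' : Bornology.IsBounded (A ∩ S) := hb.subset inter_subset_left
  have : (fun ω => (g ω).count A) = fun ω => (((g ω).num (A ∩ S) : ℕ) : ℝ≥0∞) := by
    funext ω
    rw [natCast_num _ hb', count_inter_self]
  rw [this]
  exact (measurable_from_nat (f := fun n : ℕ => (n : ℝ≥0∞))).comp
    (h _ (hA.inter hS) hb' inter_subset_right)

lemma generateFrom_countFns (hS : MeasurableSet S) :
    (inferInstance : MeasurableSpace (Conf S)) =
      MeasurableSpace.generateFrom (cylinders (countFns S)) := by
  refine le_antisymm ?_ (generateFrom_cylinders_le ?_)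
  · have : @Measurable _ _ (MeasurableSpace.generateFrom (cylinders (countFns S))) _
        (id : Conf S → Conf S) :=
      @Conf.measurable_of_num _ S hS _ (MeasurableSpace.generateFrom (cylinders (countFns S))) id
        fun A hA hb hAS => measurable_of_mem_family ⟨A, ⟨hA, hb, hAS⟩, rfl⟩
    intro V hV
    exact this hV
  · rintro _ ⟨A, ⟨hA, hb, -⟩, rfl⟩
    exact Conf.measurable_num hA hb

lemma generateFrom_pairCountFns (hS : MeasurableSet S) :
    (inferInstance : MeasurableSpace (Conf S × Conf S)) =
      MeasurableSpace.generateFrom (cylinders (pairCountFns S)) := by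
  refine le_antisymm (sup_le ?_ ?_) (generateFrom_cylinders_le ?_)
  · refine measurable_iff_comap_le.1 ?_
    exact @Conf.measurable_of_num _ S hS _
      (MeasurableSpace.generateFrom (cylinders (pairCountFns S)))
      Prod.fst fun A hA hb hAS => measurable_of_mem_family ⟨A, ⟨hA, hb, hAS⟩, Or.inl rfl⟩
  · refine measurable_iff_comap_le.1 ?_
    exact @Conf.measurable_of_num _ S hS _
      (MeasurableSpace.generateFrom (cylinders (pairCountFns S)))
      Prod.snd fun A hA hb hAS => measurable_of_mem_family ⟨A, ⟨hA, hb, hAS⟩, Or.inr rfl⟩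
  · rintro _ ⟨A, ⟨hA, hb, -⟩, rfl | rfl⟩
    · exact (Conf.measurable_num hA hb).comp measurable_fst
    · exact (Conf.measurable_num hA hb).comp measurable_snd

lemma Conf.num_proj (s : Conf S) (A : Set (Sp d)) {B : Set (Sp d)} (hB : Bornology.IsBounded B) :
    (proj A s).num B = s.num (A ∩ B) := by
  have h : ((proj A s).num B : ℝ≥0∞) = (s.num (A ∩ B) : ℝ≥0∞) := by
    rw [natCast_num _ hB, natCast_num _ (hB.subset inter_subset_right), count_proj]
  exact_mod_cast h

lemma preimage_proj_mem_cylinders {A : Set (Sp d)} (hA : MeasurableSet A) {B : Set (Conf S)}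
    (hB : B ∈ cylinders (countFns S)) : Conf.proj A ⁻¹' B ∈ cylinders (countFns S) := by
  obtain ⟨p, f, E, hf, rfl⟩ := hB
  choose A' hA' hfA using hf
  refine ⟨p, fun i s => s.num (A ∩ A' i), E, fun i => ⟨A ∩ A' i, ⟨hA.inter (hA' i).1,
    (hA' i).2.1.subset inter_subset_right, inter_subset_right.trans (hA' i).2.2⟩, rfl⟩, ?_⟩
  ext s
  have : (fun i => f i (Conf.proj A s)) = fun i => s.num (A ∩ A' i) := by
    funext i
    rw [hfA i]
    exact s.num_proj A (hA' i).2.1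
  change (fun i => f i (Conf.proj A s)) ∈ E ↔ (fun i => s.num (A ∩ A' i)) ∈ E
  rw [this]

lemma exactly_mem_cylinders {A : Set (Sp d)} (hA : MeasurableSet A)
    (hb : Bornology.IsBounded A) (hAS : A ⊆ S) (m : ℕ) :
    exactly S A m ∈ cylinders (countFns S) := by
  refine ⟨1, fun _ s => s.num A, {v | v 0 = m}, fun _ => ⟨A, ⟨hA, hb, hAS⟩, rfl⟩, ?_⟩
  ext s
  change s.count A = m ↔ s.num A = m
  rw [← Conf.natCast_num s hb]
  exact Nat.cast_inj

/-- Elementary events for pairs of configurations are products of cylinder events. -/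
lemma exists_prod_eq_of_pairCountFns {p : ℕ} {f : Fin p → Conf S × Conf S → ℕ} (v : Fin p → ℕ)
    (hf : ∀ i, f i ∈ pairCountFns S) :
    ∃ B ∈ cylinders (countFns S), ∃ B' ∈ cylinders (countFns S),
      {z | (fun i => f i z) = v} = B ×ˢ B' := by
  classical
  choose A hA hfA using hf
  refine ⟨{s | (fun i => s.num (A i)) ∈
      {w : Fin p → ℕ | ∀ i, (f i = fun z => z.1.num (A i)) → w i = v i}},
    ⟨p, fun i s => s.num (A i), _, fun i => ⟨A i, hA i, rfl⟩, rfl⟩,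
    {s | (fun i => s.num (A i)) ∈
      {w : Fin p → ℕ | ∀ i, (f i = fun z => z.2.num (A i)) → w i = v i}},
    ⟨p, fun i s => s.num (A i), _, fun i => ⟨A i, hA i, rfl⟩, rfl⟩, ?_⟩
  ext ⟨s, t⟩
  constructor
  · intro h
    have h' : ∀ i, f i (s, t) = v i := fun i => congrFun h i
    exact ⟨fun i hi => by rw [← h' i, hi], fun i hi => by rw [← h' i, hi]⟩
  · rintro ⟨h1, h2⟩
    refine funext fun i => ?_
    rcases hfA i with hi | hi
    · rw [hi]; exact h1 i hi
    · rw [hi]; exact h2 i hi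

end Cylinders

/-! ### The interaction with the outside -/

section Field

variable {S : Set (Sp d)}

/-- The potential at `x` generated by the points of `s` outside `A`. -/
def outerField (Ψ : Sp d → Sp d → EReal) (A : Set (Sp d)) (x : Sp d) (s : Conf S) : ℝ :=
  ((s.points Aᶜ).map fun y => (Ψ x y).toReal).sum

/-- The finite configurations whose points outside `A` generate a field that is Lipschitz on
`A ∩ T` with constant `k`. -/
def lipschitzField (S : Set (Sp d)) (Ψ : Sp d → Sp d → EReal) (A T : Set (Sp d)) (k : ℝ) :
    Set (Conf S) :=
  {s | s.count S ≠ ∞ ∧ ∀ x ∈ A ∩ T, ∀ x' ∈ A ∩ T,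
    |outerField Ψ A x s - outerField Ψ A x' s| ≤ k * ‖x - x'‖}

lemma outerField_proj (Ψ : Sp d → Sp d → EReal) (A : Set (Sp d)) (x : Sp d) (s : Conf S) :
    outerField Ψ A x (Conf.proj Aᶜ s) = outerField Ψ A x s := by
  rw [outerField, outerField, Conf.points_proj_self]

lemma measurable_outerField_ofPoints {Ψ : Sp d → Sp d → EReal}
    (hΨ : Measurable (Function.uncurry Ψ)) {A : Set (Sp d)} (hA : MeasurableSet A) (u : Sp d)
    (n : ℕ) : Measurable fun x : {x : Fin n → Sp d // ∀ i, x i ∈ S} =>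
      outerField Ψ A u (Conf.ofPoints S x.1) := by
  classical
  have h : ∀ x : {x : Fin n → Sp d // ∀ i, x i ∈ S}, outerField Ψ A u (Conf.ofPoints S x.1) =
      ∑ i, Aᶜ.indicator (fun y => (Ψ u y).toReal) (x.1 i) := by
    intro x
    rw [outerField, Conf.points_ofPoints x.2, Multiset.filter_map, Multiset.map_map,
      Finset.sum_eq_multiset_sum]
    simp only [indicator_apply]
    rw [← Finset.sum_eq_multiset_sum, ← Finset.sum_filter, Finset.sum, Finset.filter_val]
    congr!
  simp_rw [h]
  have hu : Measurable fun y => (Ψ u y).toReal :=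
    (hΨ.comp (measurable_const.prodMk measurable_id)).ereal_toReal
  exact Finset.measurable_sum _ fun i _ => (hu.indicator hA.compl).comp
    ((measurable_pi_apply i).comp measurable_subtype_coe)

lemma continuousOn_outerField {Ψ : Sp d → Sp d → EReal} {A : Set (Sp d)}
    (hc : ∀ y ∈ S, y ∉ A → ContinuousOn (fun x => (Ψ x y).toReal) A) {s : Conf S}
    (hs : s.count S ≠ ∞) : ContinuousOn (fun x => outerField Ψ A x s) A := by
  have hfin := s.finite_of_count_univ hs Aᶜ
  rw [continuousOn_iff_continuous_domRestrict]
  exact continuous_multiset_sum (s.points Aᶜ) fun y hy =>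
    continuousOn_iff_continuous_domRestrict.1
      (hc y (Conf.mem_of_mem_points s hfin hy) ((Conf.mem_points s hfin).1 hy).1)

lemma measurableSet_lipschitzField (hS : MeasurableSet S) {Ψ : Sp d → Sp d → EReal}
    (hΨ : Measurable (Function.uncurry Ψ)) {A : Set (Sp d)} (hA : MeasurableSet A)
    (hc : ∀ y ∈ S, y ∉ A → ContinuousOn (fun x => (Ψ x y).toReal) A) (T : Set (Sp d)) (k : ℝ) :
    MeasurableSet (lipschitzField S Ψ A T k) := by
  rcases (A ∩ T).eq_empty_or_nonempty with he | hne
  · have : lipschitzField S Ψ A T k = {s | s.count S ≠ ∞} := by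
      ext s
      simp [lipschitzField, he]
    rw [this]
    exact (Conf.measurable_count hS (measurableSet_singleton ∞)).compl
  have : Nonempty (A ∩ T : Set (Sp d)) := hne.to_subtype
  let u : ℕ → (A ∩ T : Set (Sp d)) := TopologicalSpace.denseSeq _
  let E : Set (Conf S) := {s | ∀ i j, |outerField Ψ A (u i) s - outerField Ψ A (u j) s| ≤
    k * ‖(u i : Sp d) - u j‖}
  have hE : lipschitzField S Ψ A T k = E ∩ {s | s.count S ≠ ∞} := by
    ext s
    constructor
    · rintro ⟨h1, h2⟩
      exact ⟨fun i j => h2 _ (u i).2 _ (u j).2, h1⟩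
    · rintro ⟨h1, h2⟩
      refine ⟨h2, fun x hx x' hx' => ?_⟩
      have hcont : Continuous fun z : (A ∩ T : Set (Sp d)) => outerField Ψ A z s :=
        continuousOn_iff_continuous_domRestrict.1
          ((continuousOn_outerField hc h2).mono inter_subset_left)
      have hcl : IsClosed {z : (A ∩ T : Set (Sp d)) × (A ∩ T : Set (Sp d)) |
          |outerField Ψ A z.1 s - outerField Ψ A z.2 s| ≤ k * ‖(z.1 : Sp d) - z.2‖} := by
        refine isClosed_le ?_ ?_
        · exact ((hcont.comp continuous_fst).sub (hcont.comp continuous_snd)).abs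
        · fun_prop
      exact (TopologicalSpace.denseRange_denseSeq (A ∩ T : Set (Sp d))).induction_on₂
        (p := fun z z' : (A ∩ T : Set (Sp d)) =>
          |outerField Ψ A z s - outerField Ψ A z' s| ≤ k * ‖(z : Sp d) - z'‖)
        hcl h1 ⟨x, hx⟩ ⟨x', hx'⟩
  rw [hE]
  refine Conf.measurableSet_inter_of_ofPoints hS fun n => ?_
  have hEi : {x : {x : Fin n → Sp d // ∀ i, x i ∈ S} | Conf.ofPoints S x.1 ∈ E} =
      ⋂ i, ⋂ j, {x | |outerField Ψ A (u i) (Conf.ofPoints S x.1) -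
        outerField Ψ A (u j) (Conf.ofPoints S x.1)| ≤ k * ‖(u i : Sp d) - u j‖} := by
    ext x
    simp [E]
  rw [hEi]
  refine MeasurableSet.iInter fun i => MeasurableSet.iInter fun j => ?_
  refine measurableSet_le ?_ measurable_const
  exact ((measurable_outerField_ofPoints hΨ hA _ n).sub
    (measurable_outerField_ofPoints hΨ hA _ n)).abs

lemma sum_map_le_sum_map_add {α : Type*} {f : α → ℝ} {L : ℝ} {u v : Multiset α}
    (hcard : u.card = v.card) (h : ∀ a ∈ u, ∀ a' ∈ v, f a ≤ f a' + L) :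
    (u.map f).sum ≤ (v.map f).sum + u.card * L := by
  induction u using Multiset.induction_on generalizing v with
  | empty =>
    have : v = 0 := Multiset.card_eq_zero.1 (by rw [← hcard, Multiset.card_zero])
    simp [this]
  | cons a u ih =>
    obtain ⟨a', ha'⟩ : ∃ a', a' ∈ v := Multiset.card_pos_iff_exists_mem.1 (by
      rw [← hcard, Multiset.card_cons]; omega)
    obtain ⟨w, rfl⟩ := Multiset.exists_cons_of_mem ha'
    have h1 := ih (v := w) (by simpa using hcard) fun x hx y hy =>
      h x (Multiset.mem_cons_of_mem hx) y (Multiset.mem_cons_of_mem hy)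
    have h2 := h a (Multiset.mem_cons_self a u) a' (Multiset.mem_cons_self a' w)
    simp only [Multiset.map_cons, Multiset.sum_cons, Multiset.card_cons, Nat.cast_add,
      Nat.cast_one]
    linarith

lemma multiset_sum_coe_ereal {α : Type*} (u : Multiset α) {f : α → EReal} {g : α → ℝ}
    (h : ∀ a ∈ u, f a = (g a : EReal)) : (u.map f).sum = (((u.map g).sum : ℝ) : EReal) := by
  induction u using Multiset.induction_on with
  | empty => simp
  | cons a u ih =>
    rw [Multiset.map_cons, Multiset.sum_cons, Multiset.map_cons, Multiset.sum_cons, EReal.coe_add,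
      ih fun x hx => h x (Multiset.mem_cons_of_mem hx), h a (Multiset.mem_cons_self a u)]

lemma interaction_eq_coe {Ψ : Sp d → Sp d → EReal} {A : Set (Sp d)}
    (hb : Bornology.IsBounded A) (htop : ∀ x ∈ S, ∀ y ∈ S, x ≠ y → Ψ x y ≠ ⊤)
    (hbot : ∀ x y, Ψ x y ≠ ⊥) {s : Conf S} (hs : s.count S ≠ ∞) (x : Conf S) :
    interaction Ψ A s x = ((((x.points A).map fun a => outerField Ψ A a s).sum : ℝ) : EReal) := by
  have hfin := s.finite_of_count_univ hs Aᶜ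
  have hfinx := x.finite_inter_of_isBounded hb
  refine multiset_sum_coe_ereal _ fun a ha => ?_
  refine multiset_sum_coe_ereal _ fun y hy => ?_
  have haA := ((Conf.mem_points x hfinx).1 ha).1
  have hyA := ((Conf.mem_points s hfin).1 hy).1
  refine (EReal.coe_toReal (htop a (Conf.mem_of_mem_points x hfinx ha) y
    (Conf.mem_of_mem_points s hfin hy) fun e => hyA (e ▸ haA)) (hbot a y)).symm

/-- If the points of `s` outside `A` generate a Lipschitz field on `A ∩ T`, then the Boltzmann
factor of the interaction with `s` varies at most by a constant factor over the configurations of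
`m` points in `A ∩ T`. -/
lemma exp_interaction_le {Ψ : Sp d → Sp d → EReal} {A T : Set (Sp d)} {k R : ℝ} (hk : 0 ≤ k)
    (hR : ∀ x ∈ A, ‖x‖ ≤ R) (htop : ∀ x ∈ S, ∀ y ∈ S, x ≠ y → Ψ x y ≠ ⊤)
    (hbot : ∀ x y, Ψ x y ≠ ⊥) {s : Conf S} (hs : s ∈ lipschitzField S Ψ A T k) {m : ℕ}
    {x y : Conf S} (hx : x ∈ exactly S A m) (hy : y ∈ exactly S A m)
    (hxT : x.count (A \ T) = 0) (hyT : y.count (A \ T) = 0) :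
    EReal.exp (-interaction Ψ A s x) ≤
      ENNReal.ofReal (Real.exp (m * (k * (2 * R)))) * EReal.exp (-interaction Ψ A s y) := by
  have hb : Bornology.IsBounded A :=
    (Metric.isBounded_closedBall (x := (0 : Sp d)) (r := R)).subset fun x hx => by
      simpa using hR x hx
  have hmem : ∀ z : Conf S, z.count (A \ T) = 0 → ∀ a ∈ z.points A, a ∈ A ∩ T := by
    intro z hz a ha
    have ha' := (Conf.mem_points z (z.finite_inter_of_isBounded hb)).1 ha
    refine ⟨ha'.1, ?_⟩
    by_contra hT
    exact ha'.2 ((Conf.count_eq_zero_iff z).1 hz a ⟨ha'.1, hT⟩)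
  have hcard : ∀ z : Conf S, z ∈ exactly S A m → (z.points A).card = m := fun z hz => by
    have hz' : z.count A = m := hz
    rw [z.count_eq_card hb] at hz'
    exact_mod_cast hz'
  rw [interaction_eq_coe hb htop hbot hs.1, interaction_eq_coe hb htop hbot hs.1,
    ← EReal.coe_neg, ← EReal.coe_neg, EReal.exp_coe, EReal.exp_coe,
    ← ENNReal.ofReal_mul (Real.exp_nonneg _), ← Real.exp_add]
  refine ENNReal.ofReal_le_ofReal (Real.exp_le_exp.2 ?_)
  have h := sum_map_le_sum_map_add (f := fun a => outerField Ψ A a s) (L := k * (2 * R))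
    (u := y.points A) (v := x.points A) (by rw [hcard x hx, hcard y hy]) (by
      intro a ha a' ha'
      have h1 := hs.2 a (hmem y hyT a ha) a' (hmem x hxT a' ha')
      have h2 : ‖a - a'‖ ≤ 2 * R := by
        have := norm_sub_le a a'
        have h3 := hR a (hmem y hyT a ha).1
        have h4 := hR a' (hmem x hxT a' ha').1
        linarith
      have h3 : k * ‖a - a'‖ ≤ k * (2 * R) := by gcongr
      have h4 := le_abs_self (outerField Ψ A a s - outerField Ψ A a' s)
      linarith)
  rw [hcard y hy] at h
  linarith

lemma measurable_interaction {Ψ : Sp d → Sp d → EReal} (hΨ : Measurable (Function.uncurry Ψ))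
    (hS : MeasurableSet S) {A : Set (Sp d)} (hA : MeasurableSet A) (hAS : A ⊆ S)
    (hb : Bornology.IsBounded A) (s : Conf S) :
    Measurable fun x : Conf S => interaction Ψ A s x := by
  let g : Sp d → EReal := fun a => ((s.points Aᶜ).map fun b => Ψ a b).sum
  have hg : Measurable g := by
    have h : ∀ u : Multiset (Sp d), Measurable fun a => (u.map fun b => Ψ a b).sum := by
      intro u
      induction u using Multiset.induction_on with
      | empty => simp
      | cons b u ih =>
        simp only [Multiset.map_cons, Multiset.sum_cons]
        exact (hΨ.comp (measurable_id.prodMk measurable_const)).add ih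
    exact h _
  have h1 : (fun x : Conf S => interaction Ψ A s x) =
      fun x => (((Conf.proj A x).points S).map g).sum := by
    funext x
    rw [interaction, Conf.points_proj_of_subset x hAS]
  rw [h1]
  refine Conf.measurable_comp_proj_of_ofPoints hS hA hb (g := fun x => ((x.points S).map g).sum)
    fun n => ?_
  have h2 : ∀ x : {x : Fin n → Sp d // ∀ i, x i ∈ S},
      (((Conf.ofPoints S x.1).points S).map g).sum = ∑ i, g (x.1 i) := by
    intro x
    rw [Conf.points_ofPoints_of_mem subset_rfl x.2, Multiset.map_map]
    rfl
  simp_rw [h2]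
  exact Finset.measurable_sum _ fun i _ =>
    hg.comp ((measurable_pi_apply i).comp measurable_subtype_coe)

end Field

/-! ### Comparison of conditional distributions with the Gibbs weights -/

section Comparison

variable {S A T : Set (Sp d)} {Φ : Sp d → EReal} {Ψ : Sp d → Sp d → EReal}

lemma interaction_proj (Ψ : Sp d → Sp d → EReal) (A : Set (Sp d)) (s x : Conf S) :
    interaction Ψ A (Conf.proj Aᶜ s) x = interaction Ψ A s x := by
  rw [interaction, interaction, Conf.points_proj_self]

/-- The Gibbs weights with and without the interaction with a configuration `s` that generates a
Lipschitz field are comparable up to normalisation. -/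
lemma withDensity_cross_mul_le (hΦ : IsFreePotential Φ) (hΨ : IsPairPotential Ψ)
    (hS : MeasurableSet S) (hAS : A ⊆ S) (hA : MeasurableSet A) {k R : ℝ} (hk : 0 ≤ k)
    (hR : ∀ x ∈ A, ‖x‖ ≤ R) (htop : ∀ x ∈ S, ∀ y ∈ S, x ≠ y → Ψ x y ≠ ⊤) {s : Conf S}
    (hs : s ∈ lipschitzField S Ψ A T k) (m : ℕ) {D E : Set (Conf S)} (hD : MeasurableSet D)
    (hE : MeasurableSet E) (hDT : ∀ x ∈ D, x.count (A \ T) = 0)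
    (hET : ∀ x ∈ E, x.count (A \ T) = 0) :
    (((poisson S A).restrict (exactly S A m)).withDensity fun x =>
        EReal.exp (-(hamiltonian Φ Ψ A x + interaction Ψ A s x))) D * gibbs S Φ Ψ A m E ≤
      ENNReal.ofReal (Real.exp (m * (k * (2 * R)))) * (gibbs S Φ Ψ A m D *
        (((poisson S A).restrict (exactly S A m)).withDensity fun x =>
          EReal.exp (-(hamiltonian Φ Ψ A x + interaction Ψ A s x))) E) := by
  have hb : Bornology.IsBounded A :=
    (Metric.isBounded_closedBall (x := (0 : Sp d)) (r := R)).subset fun x hx => by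
      simpa using hR x hx
  have hex := measurableSet_exactly (S := S) hA m
  have hH : Measurable fun x : Conf S => EReal.exp (-hamiltonian Φ Ψ A x) :=
    EReal.measurable_exp.comp (measurable_hamiltonian hΦ hΨ hS hAS hA hb).neg
  have hI : Measurable fun x : Conf S => EReal.exp (-interaction Ψ A s x) :=
    EReal.measurable_exp.comp (measurable_interaction hΨ.measurable hS hA hAS hb s).neg
  have hmul : (fun x : Conf S => EReal.exp (-(hamiltonian Φ Ψ A x + interaction Ψ A s x))) =
      fun x => EReal.exp (-hamiltonian Φ Ψ A x) * EReal.exp (-interaction Ψ A s x) := by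
    funext x
    rw [interaction_eq_coe hb htop hΨ.ne_bot hs.1,
      EReal.neg_add (Or.inr (EReal.coe_ne_top _)) (Or.inr (EReal.coe_ne_bot _)), sub_eq_add_neg,
      EReal.exp_add]
  rw [hmul, gibbs, withDensity_apply _ hD, withDensity_apply _ hE, withDensity_apply _ hD,
    withDensity_apply _ hE, Measure.restrict_restrict hD, Measure.restrict_restrict hE]
  refine lintegral_cross_mul_le _ (hD.inter hex) (hE.inter hex) hH.aemeasurable
    (hH.mul hI).aemeasurable fun x hx y hy => ?_
  exact exp_interaction_le hk hR htop hΨ.ne_bot hs hx.2 hy.2 (hDT x hx.1) (hET y hy.1)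

/-- The canonical DLR equation compares the joint law of the configurations inside and outside
`A` with the product of the Gibbs weight and the law of the outside configuration, on the event
that the latter generates a Lipschitz field. -/
lemma measure_cross_mul_le (hΦ : IsFreePotential Φ) (hΨ : IsPairPotential Ψ)
    (hS : MeasurableSet S) (hAS : A ⊆ S) (hA : MeasurableSet A) {k R : ℝ} (hk : 0 ≤ k)
    (hR : ∀ x ∈ A, ‖x‖ ≤ R) (htop : ∀ x ∈ S, ∀ y ∈ S, x ≠ y → Ψ x y ≠ ⊤) (m : ℕ)
    {P : Measure (Conf S)} [IsFiniteMeasure P] {κ : Kernel (Conf S) (Conf S)} [IsMarkovKernel κ]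
    (hκ : HasCondDistrib (Conf.proj A) (Conf.proj Aᶜ) κ P)
    (hZ : ∀ᵐ s ∂P, ∃ Z : ℝ≥0∞, 0 < Z ∧ Z < ∞ ∧ κ (Conf.proj Aᶜ s) =
      Z⁻¹ • ((poisson S A).restrict (exactly S A m)).withDensity fun x =>
        EReal.exp (-(hamiltonian Φ Ψ A x + interaction Ψ A s x)))
    {D E : Set (Conf S)} (hD : MeasurableSet D) (hE : MeasurableSet E)
    (hDT : ∀ x ∈ D, x.count (A \ T) = 0) (hET : ∀ x ∈ E, x.count (A \ T) = 0)
    {B : Set (Conf S)} (hB : MeasurableSet B) (hBT : B ⊆ lipschitzField S Ψ A T k)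
    (hfin : gibbs S Φ Ψ A m D ≠ ∞) (hfin' : gibbs S Φ Ψ A m E ≠ ∞) :
    P (Conf.proj Aᶜ ⁻¹' B ∩ Conf.proj A ⁻¹' D) * gibbs S Φ Ψ A m E ≤
      ENNReal.ofReal (Real.exp (m * (k * (2 * R)))) *
        (gibbs S Φ Ψ A m D * P (Conf.proj Aᶜ ⁻¹' B ∩ Conf.proj A ⁻¹' E)) := by
  have hin : Measurable (Conf.proj A : Conf S → Conf S) := Conf.measurable_proj hA
  have hout : Measurable (Conf.proj Aᶜ : Conf S → Conf S) := Conf.measurable_proj hA.compl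
  have hjoint : ∀ F : Set (Conf S), MeasurableSet F →
      P (Conf.proj Aᶜ ⁻¹' B ∩ Conf.proj A ⁻¹' F) =
        ∫⁻ s in Conf.proj Aᶜ ⁻¹' B, κ (Conf.proj Aᶜ s) F ∂P := by
    intro F hF
    have h1 : P (Conf.proj Aᶜ ⁻¹' B ∩ Conf.proj A ⁻¹' F) =
        P.map (fun s => (Conf.proj Aᶜ s, Conf.proj A s)) (B ×ˢ F) := by
      rw [Measure.map_apply (hout.prodMk hin) (hB.prod hF)]
      rfl
    rw [h1, hκ.map_eq, Measure.compProd_apply_prod hB hF,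
      setLIntegral_map hB (κ.measurable_coe hF) hout]
  rw [hjoint D hD, hjoint E hE, ← mul_assoc, ← lintegral_mul_const' _ _ hfin',
    ← lintegral_const_mul' _ _ (ENNReal.mul_ne_top ENNReal.ofReal_ne_top hfin)]
  refine setLIntegral_mono_ae' (hout hB) ?_
  filter_upwards [hZ] with s ⟨Z, hZ0, hZtop, hZs⟩ hsB
  have h := withDensity_cross_mul_le hΦ hΨ hS hAS hA hk hR htop (hBT hsB) m hD hE hDT hET
  simp only [interaction_proj] at h
  rw [hZs]
  simp only [Measure.smul_apply, smul_eq_mul]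
  calc Z⁻¹ * _ * gibbs S Φ Ψ A m E = Z⁻¹ * (_ * gibbs S Φ Ψ A m E) := mul_assoc _ _ _
    _ ≤ Z⁻¹ * _ := mul_le_mul_right h _
    _ = _ := by ring

end Comparison

/-! ### Weak convergence of dominated measures -/

/-- Finite measures that are dominated by `Q` and whose masses converge to that of `Q` converge
weakly to `Q`. -/
lemma tendsto_finiteMeasure_of_le {X : Type*} [TopologicalSpace X] [MeasurableSpace X]
    [OpensMeasurableSpace X] {ν : ℕ → FiniteMeasure X} {Q : FiniteMeasure X}
    (hle : ∀ k, (ν k : Measure X) ≤ Q)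
    (hmass : Tendsto (fun k => (ν k : Measure X) univ) atTop (𝓝 ((Q : Measure X) univ))) :
    Tendsto ν atTop (𝓝 Q) := by
  rw [FiniteMeasure.tendsto_iff_forall_lintegral_tendsto]
  intro f
  obtain ⟨M, hM⟩ : ∃ M : ℝ≥0, ∀ x, f x ≤ M := ⟨nndist 0 f,
    BoundedContinuousFunction.apply_le_nndist_zero f⟩
  have hsub : ∀ k, ∫⁻ x, f x ∂(Q : Measure X) ≤
      ∫⁻ x, f x ∂(ν k : Measure X) + M * ((Q : Measure X) univ - (ν k : Measure X) univ) := by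
    intro k
    conv_lhs => rw [← Measure.sub_add_cancel_of_le (hle k)]
    rw [lintegral_add_measure, add_comm]
    gcongr
    refine (lintegral_mono (g := fun _ => (M : ℝ≥0∞)) fun x =>
      ENNReal.coe_le_coe.2 (hM x)).trans ?_
    rw [lintegral_const, Measure.sub_apply MeasurableSet.univ (hle k)]
  have h0 : Tendsto (fun k => (M : ℝ≥0∞) * ((Q : Measure X) univ - (ν k : Measure X) univ)) atTop
      (𝓝 0) := by
    have := ENNReal.Tendsto.const_mul (a := (M : ℝ≥0∞)) (ENNReal.Tendsto.sub
      (tendsto_const_nhds (x := (Q : Measure X) univ)) hmass (Or.inl (measure_ne_top _ _)))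
      (Or.inr ENNReal.coe_ne_top)
    simpa using this
  have h1 := ENNReal.Tendsto.sub
    (tendsto_const_nhds (x := ∫⁻ x, f x ∂(Q : Measure X))) h0 (Or.inr ENNReal.zero_ne_top)
  rw [tsub_zero] at h1
  exact tendsto_of_tendsto_of_tendsto_of_le_of_le h1 tendsto_const_nhds
    (fun k => tsub_le_iff_right.2 (hsub k)) fun k => lintegral_mono' (hle k) le_rfl

/-! ### The limit of the finite-particle measures on Lipschitz events -/

section Limit

variable {S A : Set (Sp d)} {Φ : Sp d → EReal} {Ψ : Sp d → Sp d → EReal}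
  {ΦN : ℕ → Sp d → EReal} {ΨN : ℕ → Sp d → Sp d → EReal} {T : ℕ → Set (Sp d)}
  {μ : Measure (Conf S)} {μN : ℕ → Measure (Conf S)}

/-- `ν` is the limit, along the ultrafilter `U` and on cylinder events, of the restrictions of
`μN N` to the event that there are `m` points in `A` and that the points outside `A` form a
configuration of `G N`. -/
def IsCylinderLimit (U : Ultrafilter ℕ) (A : Set (Sp d)) (m : ℕ) (μN : ℕ → Measure (Conf S))
    (G : ℕ → Set (Conf S)) (ν : Measure (Conf S)) : Prop :=
  ∀ B ∈ cylinders (countFns S),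
    Tendsto (fun N => μN N (B ∩ (exactly S A m ∩ Conf.proj Aᶜ ⁻¹' G N))) U (𝓝 (ν B))

lemma measurableSet_of_mem_cylinders (hS : MeasurableSet S) {B : Set (Conf S)}
    (hB : B ∈ cylinders (countFns S)) : MeasurableSet B :=
  (generateFrom_countFns hS).ge B (MeasurableSpace.measurableSet_generateFrom hB)

lemma exists_isCylinderLimit [IsFiniteMeasure μ] (hS : MeasurableSet S) (hAS : A ⊆ S)
    (hA : MeasurableSet A) (hb : Bornology.IsBounded A) (U : Ultrafilter ℕ)
    (hU : (U : Filter ℕ) ≤ atTop)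
    (hlim : ∀ B ∈ cylinders (countFns S), Tendsto (fun N => μN N B) atTop (𝓝 (μ B)))
    {G : ℕ → Set (Conf S)} (m : ℕ) :
    ∃ ν : Measure (Conf S), ν ≤ μ.restrict (exactly S A m) ∧ IsCylinderLimit U A m μN G ν := by
  have halg := isSetAlgebra_cylinders (countFns S)
  have hgen := generateFrom_countFns (d := d) hS
  have hex := exactly_mem_cylinders hA hb hAS m
  have hmeas := fun B hB => measurableSet_of_mem_cylinders (B := B) hS hB
  have hdom : ∀ B ∈ cylinders (countFns S), ∀ l,
      Tendsto (fun N => (μN N).restrict (exactly S A m ∩ Conf.proj Aᶜ ⁻¹' G N) B) U (𝓝 l) →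
      l ≤ μ.restrict (exactly S A m) B := by
    intro B hB l hl
    rw [Measure.restrict_apply (hmeas B hB)]
    refine le_of_tendsto_of_tendsto' hl ((hlim _ (halg.inter_mem hB hex)).mono_left hU)
      fun N => ?_
    rw [Measure.restrict_apply (hmeas B hB)]
    exact measure_mono fun s hs => ⟨hs.1, hs.2.1⟩
  obtain ⟨ν, hν⟩ := exists_measure_tendsto_ultrafilter halg hgen U
    (fun N => (μN N).restrict (exactly S A m ∩ Conf.proj Aᶜ ⁻¹' G N))
    (μ.restrict (exactly S A m)) hdom
  have hνle : ∀ B ∈ cylinders (countFns S), ν B ≤ μ.restrict (exactly S A m) B := fun B hB =>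
    hdom B hB _ (hν B hB)
  have : IsFiniteMeasure ν := ⟨(hνle univ halg.univ_mem).trans_lt (measure_lt_top _ _)⟩
  refine ⟨ν, measure_le_of_isSetAlgebra halg hgen _ _ hνle, fun B hB => ?_⟩
  refine (hν B hB).congr fun N => ?_
  rw [Measure.restrict_apply (hmeas B hB)]

lemma IsCylinderLimit.mono {U : Ultrafilter ℕ} (hS : MeasurableSet S) {m : ℕ}
    {G G' : ℕ → Set (Conf S)} (hG : ∀ N, G N ⊆ G' N) {ν ν' : Measure (Conf S)}
    [IsFiniteMeasure ν] [IsFiniteMeasure ν'] (hν : IsCylinderLimit U A m μN G ν)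
    (hν' : IsCylinderLimit U A m μN G' ν') : ν ≤ ν' := by
  refine measure_le_of_isSetAlgebra (isSetAlgebra_cylinders _) (generateFrom_countFns hS) _ _
    fun B hB => le_of_tendsto_of_tendsto' (hν B hB) (hν' B hB) fun N => ?_
  exact measure_mono fun s hs => ⟨hs.1, hs.2.1, hG N hs.2.2⟩

/-- The mass lost in the limit is controlled by the probability of the events `G N`. -/
lemma IsCylinderLimit.le_measure_univ_add [∀ N, IsProbabilityMeasure (μN N)] {U : Ultrafilter ℕ}
    (hU : (U : Filter ℕ) ≤ atTop) (hAS : A ⊆ S)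
    (hA : MeasurableSet A) (hb : Bornology.IsBounded A) {m : ℕ}
    (hlim : ∀ B ∈ cylinders (countFns S), Tendsto (fun N => μN N B) atTop (𝓝 (μ B)))
    {G : ℕ → Set (Conf S)} (hG : ∀ N, MeasurableSet (G N)) {ν : Measure (Conf S)}
    (hν : IsCylinderLimit U A m μN G ν) :
    μ (exactly S A m) + liminf (fun N => μN N (Conf.proj Aᶜ ⁻¹' G N)) atTop ≤ ν univ + 1 := by
  have h1 : Tendsto (fun N => μN N (Conf.proj Aᶜ ⁻¹' G N)) U
      (𝓝 (U.map fun N => μN N (Conf.proj Aᶜ ⁻¹' G N)).lim) :=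
    (U.map fun N => μN N (Conf.proj Aᶜ ⁻¹' G N)).le_nhds_lim
  have h2 : liminf (fun N => μN N (Conf.proj Aᶜ ⁻¹' G N)) atTop ≤
      (U.map fun N => μN N (Conf.proj Aᶜ ⁻¹' G N)).lim := by
    rw [← h1.liminf_eq]
    exact liminf_le_liminf_of_le hU
  refine (add_le_add_right h2 _).trans ?_
  refine le_of_tendsto_of_tendsto' (((hlim _ (exactly_mem_cylinders hA hb hAS m)).mono_left
    hU).add h1) ((hν univ (isSetAlgebra_cylinders _).univ_mem).add_const 1) fun N => ?_
  have hGm : MeasurableSet (Conf.proj Aᶜ ⁻¹' G N) := Conf.measurable_proj hA.compl (hG N)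
  rw [univ_inter, ← measure_union_add_inter _ hGm, add_comm]
  gcongr
  exact prob_le_one

/-- In the limit, the law of the configuration inside `A` is compared with the Gibbs weight. -/
lemma IsCylinderLimit.cross_mul_le (h : PotentialsConverge S A Φ Ψ ΦN ΨN)
    [∀ N, IsProbabilityMeasure (μN N)] {U : Ultrafilter ℕ} (hU : (U : Filter ℕ) ≤ atTop)
    (hT : ∀ N, MeasurableSet (T N)) (hTvol : Tendsto (fun N => volume (A \ T N)) atTop (𝓝 0))
    (hTμ : Tendsto (fun N => μN N {s | s.count (A \ T N) ≠ 0}) atTop (𝓝 0))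
    {k R : ℝ} (hk : 0 ≤ k) (hR : ∀ x ∈ A, ‖x‖ ≤ R)
    (htop : ∀ N, ∀ x ∈ S, ∀ y ∈ S, x ≠ y → ΨN N x y ≠ ⊤)
    (hG : ∀ N, MeasurableSet (lipschitzField S (ΨN N) A (T N) k)) {m : ℕ}
    (hcan : ∀ N, ∃ κ : Kernel (Conf S) (Conf S), IsMarkovKernel κ ∧
      HasCondDistrib (Conf.proj A) (Conf.proj Aᶜ) κ ((μN N).restrict (exactly S A m)) ∧
      ∀ᵐ s ∂((μN N).restrict (exactly S A m)), ∃ Z : ℝ≥0∞, 0 < Z ∧ Z < ∞ ∧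
        κ (Conf.proj Aᶜ s) = Z⁻¹ • ((poisson S A).restrict (exactly S A m)).withDensity fun x =>
          EReal.exp (-(hamiltonian (ΦN N) (ΨN N) A x + interaction (ΨN N) A s x)))
    {ν : Measure (Conf S)} [IsFiniteMeasure ν]
    (hν : IsCylinderLimit U A m μN (fun N => lipschitzField S (ΨN N) A (T N) k) ν)
    {B D E : Set (Conf S)} (hB : B ∈ cylinders (countFns S)) (hD : D ∈ cylinders (countFns S))
    (hE : E ∈ cylinders (countFns S)) :
    ν (Conf.proj Aᶜ ⁻¹' B ∩ Conf.proj A ⁻¹' D) * gibbs S Φ Ψ A m E ≤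
      ENNReal.ofReal (Real.exp (m * (k * (2 * R)))) *
        (gibbs S Φ Ψ A m D * ν (Conf.proj Aᶜ ⁻¹' B ∩ Conf.proj A ⁻¹' E)) := by
  set C := ENNReal.ofReal (Real.exp (m * (k * (2 * R)))) with hC
  have hS := h.meas_S
  have hA := h.meas
  have halg := isSetAlgebra_cylinders (countFns S)
  let G : ℕ → Set (Conf S) := fun N => lipschitzField S (ΨN N) A (T N) k
  let X : ℕ → Set (Conf S) := fun N => {s | s.count (A \ T N) = 0}
  have hX : ∀ N, MeasurableSet (X N) := fun N =>
    Conf.measurable_count (hA.diff (hT N)) (measurableSet_singleton 0)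
  have hex := measurableSet_exactly (S := S) hA m
  have hfin : ∀ F : Set (Conf S), gibbs S Φ Ψ A m F ≠ ∞ := fun F =>
    ne_top_of_le_ne_top (h.gibbs_univ_ne_top m) (measure_mono (subset_univ F))
  have hg : ∀ F ∈ cylinders (countFns S),
      Tendsto (fun N => gibbs S (ΦN N) (ΨN N) A m (F ∩ X N)) U (𝓝 (gibbs S Φ Ψ A m F)) :=
    fun F hF => (h.tendsto_gibbs_inter m (fun N => hA.diff (hT N)) hTvol
      (measurableSet_of_mem_cylinders hS hF)).mono_left hU
  have hfinN : ∀ F ∈ cylinders (countFns S),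
      ∀ᶠ N in (U : Filter ℕ), gibbs S (ΦN N) (ΨN N) A m (F ∩ X N) ≠ ∞ := fun F hF =>
    (hg F hF).eventually_ne (hfin F)
  have hp : ∀ F ∈ cylinders (countFns S),
      Tendsto (fun N => (μN N).restrict (exactly S A m)
        (Conf.proj Aᶜ ⁻¹' (B ∩ G N) ∩ Conf.proj A ⁻¹' (F ∩ X N))) U
        (𝓝 (ν (Conf.proj Aᶜ ⁻¹' B ∩ Conf.proj A ⁻¹' F))) := by
    intro F hF
    have h1 := hν _ (halg.inter_mem (preimage_proj_mem_cylinders hA.compl hB)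
      (preimage_proj_mem_cylinders hA hF))
    have h2 := ENNReal.Tendsto.sub h1 (hTμ.mono_left hU) (Or.inr ENNReal.zero_ne_top)
    rw [tsub_zero] at h2
    have hXp : ∀ N (s : Conf S), Conf.proj A s ∈ X N ↔ s.count (A \ T N) = 0 := by
      intro N s
      change (Conf.proj A s).count (A \ T N) = 0 ↔ _
      rw [Conf.count_proj, inter_eq_right.2 sdiff_subset]
    have hr : ∀ N, (μN N).restrict (exactly S A m)
        (Conf.proj Aᶜ ⁻¹' (B ∩ G N) ∩ Conf.proj A ⁻¹' (F ∩ X N)) =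
        μN N ((Conf.proj Aᶜ ⁻¹' (B ∩ G N) ∩ Conf.proj A ⁻¹' (F ∩ X N)) ∩ exactly S A m) :=
      fun N => Measure.restrict_apply' hex
    refine tendsto_of_tendsto_of_tendsto_of_le_of_le h2 h1 (fun N => ?_) fun N => ?_
    · refine tsub_le_iff_right.2 ?_
      rw [hr]
      refine (measure_mono ?_).trans (measure_union_le _ _)
      rintro s ⟨⟨hsB, hsF⟩, hse, hsG⟩
      by_cases hsX : s.count (A \ T N) = 0
      · exact Or.inl ⟨⟨⟨hsB, hsG⟩, hsF, (hXp N s).2 hsX⟩, hse⟩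
      · exact Or.inr hsX
    · change (μN N).restrict (exactly S A m) _ ≤ _
      rw [hr]
      exact measure_mono fun s hs => ⟨⟨hs.1.1.1, hs.1.2.1⟩, hs.2, hs.1.1.2⟩
  have hBm := measurableSet_of_mem_cylinders hS hB
  have hDm := measurableSet_of_mem_cylinders hS hD
  have hEm := measurableSet_of_mem_cylinders hS hE
  have hCtop : C ≠ ∞ := ENNReal.ofReal_ne_top
  refine le_of_tendsto_of_tendsto
    (ENNReal.Tendsto.mul (hp D hD) (Or.inr (hfin E)) (hg E hE) (Or.inr (measure_ne_top _ _)))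
    (ENNReal.Tendsto.const_mul (ENNReal.Tendsto.mul (hg D hD) (Or.inr (measure_ne_top _ _))
      (hp E hE) (Or.inr (hfin D))) (Or.inr hCtop)) ?_
  filter_upwards [hfinN D hD, hfinN E hE] with N hN hN'
  obtain ⟨κ, hκM, hκ, hZ⟩ := hcan N
  exact measure_cross_mul_le (h.freeN N) (h.pairN N) hS h.subset hA hk hR (htop N) m hκ hZ
    (hDm.inter (hX N)) (hEm.inter (hX N)) (fun x hx => hx.2) (fun x hx => hx.2)
    (hBm.inter (hG N)) inter_subset_right hN hN'

/-- Comparability on products of cylinder events extends to all events and hence yields a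
comparable conditional distribution. -/
lemma exists_condDistrib_of_cross_mul_le (hS : MeasurableSet S) (hA : MeasurableSet A)
    {ν g : Measure (Conf S)} [IsFiniteMeasure ν] (hg0 : g univ ≠ 0) (hgtop : g univ ≠ ∞)
    {C : ℝ≥0∞} (hC : C ≠ ∞)
    (hcross : ∀ B ∈ cylinders (countFns S), ∀ D ∈ cylinders (countFns S),
      ∀ E ∈ cylinders (countFns S),
      ν (Conf.proj Aᶜ ⁻¹' B ∩ Conf.proj A ⁻¹' D) * g E ≤
        C * (g D * ν (Conf.proj Aᶜ ⁻¹' B ∩ Conf.proj A ⁻¹' E))) :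
    ∃ (κ : Kernel (Conf S) (Conf S)) (a : ℝ≥0), IsMarkovKernel κ ∧
      HasCondDistrib (Conf.proj A) (Conf.proj Aᶜ) κ ν ∧ 0 < a ∧
      ∀ᵐ s ∂ν, a⁻¹ • g ≤ κ (Conf.proj Aᶜ s) ∧ κ (Conf.proj Aᶜ s) ≤ a • g := by
  have : IsFiniteMeasure g := ⟨hgtop.lt_top⟩
  have hin : Measurable (Conf.proj A : Conf S → Conf S) := Conf.measurable_proj hA
  have hout : Measurable (Conf.proj Aᶜ : Conf S → Conf S) := Conf.measurable_proj hA.compl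
  have hgen := generateFrom_pairCountFns (d := d) hS
  have huniv : univ ∈ cylinders (countFns S) := (isSetAlgebra_cylinders _).univ_mem
  let a' : ℝ≥0∞ := C * (g univ)⁻¹ + C * g univ + 1
  have ha' : a' ≠ ∞ := by
    simp only [a', ENNReal.add_ne_top, ENNReal.one_ne_top, ne_eq, not_false_eq_true, and_true]
    exact ⟨ENNReal.mul_ne_top hC (ENNReal.inv_ne_top.2 hg0), ENNReal.mul_ne_top hC hgtop⟩
  have ha1 : (1 : ℝ≥0∞) ≤ a' := le_add_self
  let a : ℝ≥0 := a'.toNNReal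
  have hcoe : (a : ℝ≥0∞) = a' := ENNReal.coe_toNNReal ha'
  have ha : a ≠ 0 := by
    intro h0
    rw [h0, ENNReal.coe_zero] at hcoe
    rw [← hcoe] at ha1
    exact absurd ha1 (by simp)
  have hle1 : C * (g univ)⁻¹ ≤ a' := le_add_right (le_add_right le_rfl)
  have hle2 : C * g univ ≤ a' := le_add_right le_add_self
  have hJ : ∀ B D : Set (Conf S), MeasurableSet B → MeasurableSet D →
      ν.map (fun s => (Conf.proj Aᶜ s, Conf.proj A s)) (B ×ˢ D) =
        ν (Conf.proj Aᶜ ⁻¹' B ∩ Conf.proj A ⁻¹' D) := by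
    intro B D hB hD
    rw [Measure.map_apply (hout.prodMk hin) (hB.prod hD)]
    rfl
  have hP : ∀ B D : Set (Conf S), MeasurableSet B →
      (ν.map (Conf.proj Aᶜ)).prod g (B ×ˢ D) = ν (Conf.proj Aᶜ ⁻¹' B) * g D := by
    intro B D hB
    rw [Measure.prod_prod, Measure.map_apply hout hB]
  have : IsFiniteMeasure (ν.map fun s => (Conf.proj Aᶜ s, Conf.proj A s)) :=
    Measure.isFiniteMeasure_map _ _
  have : IsFiniteMeasure (ν.map (Conf.proj (S := S) Aᶜ)) := Measure.isFiniteMeasure_map _ _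
  have h1 : ν.map (fun s => (Conf.proj Aᶜ s, Conf.proj A s)) ≤
      a • (ν.map (Conf.proj Aᶜ)).prod g := by
    refine measure_le_of_cylinders hgen _ _ fun p f v hf => ?_
    obtain ⟨B, hB, D, hD, hBD⟩ := exists_prod_eq_of_pairCountFns v hf
    have hBm := measurableSet_of_mem_cylinders hS hB
    rw [hBD, hJ B D hBm (measurableSet_of_mem_cylinders hS hD), Measure.smul_apply,
      ENNReal.smul_def, smul_eq_mul, hP B D hBm, hcoe]
    have h := hcross B hB D hD univ huniv
    rw [preimage_univ, inter_univ, ← ENNReal.le_div_iff_mul_le (Or.inl hg0) (Or.inl hgtop)] at h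
    calc _ ≤ _ := h
      _ = C * (g univ)⁻¹ * (ν (Conf.proj Aᶜ ⁻¹' B) * g D) := by rw [div_eq_mul_inv]; ring
      _ ≤ _ := mul_le_mul_left hle1 _
  have h2 : (ν.map (Conf.proj Aᶜ)).prod g ≤
      a • ν.map (fun s => (Conf.proj Aᶜ s, Conf.proj A s)) := by
    refine measure_le_of_cylinders hgen _ _ fun p f v hf => ?_
    obtain ⟨B, hB, D, hD, hBD⟩ := exists_prod_eq_of_pairCountFns v hf
    have hBm := measurableSet_of_mem_cylinders hS hB
    rw [hBD, Measure.smul_apply, ENNReal.smul_def, smul_eq_mul, hP B D hBm,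
      hJ B D hBm (measurableSet_of_mem_cylinders hS hD), hcoe]
    have h := hcross B hB univ huniv D hD
    rw [preimage_univ, inter_univ, ← mul_assoc] at h
    exact h.trans (mul_le_mul_left hle2 _)
  obtain ⟨κ, hκM, hκ, hae⟩ := exists_condDistrib_of_comparable hout hin ν g ha h1 h2
  exact ⟨κ, a, hκM, hκ, pos_iff_ne_zero.2 ha, hae⟩

end Limit

/-! ### Approximation of `S_r` by the sets `S_r^N` -/

section Geometry

variable {S A : Set (Sp d)}

lemma exists_subset_of_finite {T : ℕ → Set (Sp d)} (hT : ∀ r s, r < s → T r ⊆ T s)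
    {F : Set (Sp d)} (hF : F.Finite) (hFT : F ⊆ ⋃ r, T r) (r : ℕ) : ∃ s, r < s ∧ F ⊆ T s := by
  induction F, hF using Set.Finite.induction_on with
  | empty => exact ⟨r + 1, by omega, empty_subset _⟩
  | @insert a F _ _ ih =>
    obtain ⟨s, hrs, hs⟩ := ih ((subset_insert _ _).trans hFT)
    obtain ⟨s', hs'⟩ := mem_iUnion.1 (hFT (mem_insert a F))
    refine ⟨max s s' + 1, by omega, insert_subset (hT _ _ (by omega) hs') ?_⟩
    exact hs.trans (hT _ _ (by omega))

/-- For a finite configuration without points in `A ∆ S_r^N`, all points outside `A` lie in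
`S_s^N \ S_r^N` for large `s`, so that the control of `h_{r,s}^N` becomes a control of the field
generated by these points. -/
lemma proj_mem_lipschitzField {ΨN : ℕ → Sp d → Sp d → EReal} {T : ℕ → ℕ → Set (Sp d)} {N : ℕ}
    (hT : ∀ r s, r < s → T r N ⊆ T s N) (hTS : ⋃ r, T r N = S) {r k : ℕ} {s : Conf S}
    (hs : s ∈ lipschitzSet S ΨN T r k) (hfin : s.count S ≠ ∞) (h1 : s.count (A \ T r N) = 0)
    (h2 : s.count (T r N \ A) = 0) :
    Conf.proj Aᶜ s ∈ lipschitzField S (ΨN N) A (T r N) k := by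
  obtain ⟨s', hrs, hs'⟩ := exists_subset_of_finite hT (s.finite_of_count_univ hfin Aᶜ)
    (fun x hx => by
      rw [hTS]
      by_contra hS
      exact hx.2 (s.mult_eq_zero x hS)) r
  have hpts : s.points (T s' N \ T r N) = s.points Aᶜ := by
    unfold Conf.points
    refine finsum_congr fun x => ?_
    by_cases hx : s.mult x = 0
    · simp [hx]
    have hiff : x ∈ T s' N \ T r N ↔ x ∈ Aᶜ := by
      refine ⟨fun h hA => hx ((Conf.count_eq_zero_iff s).1 h1 x ⟨hA, h.2⟩), fun h => ?_⟩
      exact ⟨hs' ⟨h, hx⟩, fun hr => hx ((Conf.count_eq_zero_iff s).1 h2 x ⟨hr, h⟩)⟩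
    simp only [hiff]
  have hdiff : ∀ x, interactionDiff (ΨN N) (T r N) (T s' N) x s =
      outerField (ΨN N) A x s - outerField (ΨN N) A 0 s := by
    intro x
    rw [interactionDiff, hpts, Multiset.sum_map_sub]
    rfl
  refine ⟨?_, fun x hx x' hx' => ?_⟩
  · rw [Conf.count_proj]
    exact ne_top_of_le_ne_top hfin (s.count_mono inter_subset_right)
  · rw [outerField_proj, outerField_proj]
    rcases eq_or_ne x x' with rfl | hne
    · simp
    have h := hs N s' hrs x hx.2 x' hx'.2 hne
    rw [hdiff, hdiff, sub_sub_sub_cancel_right,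
      div_le_iff₀ (norm_pos_iff.2 (sub_ne_zero.2 hne))] at h
    exact h

/-- Sets that converge to a bounded closed set in the Hausdorff distance have asymptotically no
volume outside this set. -/
lemma tendsto_volume_sdiff_of_hausdorffEDist (hA : IsClosed A) (hb : Bornology.IsBounded A)
    {T : ℕ → Set (Sp d)}
    (hT : Tendsto (fun N => Metric.hausdorffEDist (T N) A) atTop (𝓝 0)) :
    Tendsto (fun N => volume (T N \ A)) atTop (𝓝 0) := by
  have hδ : Tendsto (fun N => (Metric.hausdorffEDist (T N) A).toReal) atTop (𝓝 0) := by
    simpa [Function.comp_def] using (ENNReal.tendsto_toReal ENNReal.zero_ne_top).comp hT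
  have h1 := (tendsto_measure_cthickening_of_isClosed (μ := (volume : Measure (Sp d)))
    ⟨1, one_pos, hb.cthickening.measure_lt_top.ne⟩ hA).comp hδ
  have h2 := ENNReal.Tendsto.sub h1 (tendsto_const_nhds (x := volume A))
    (Or.inl hb.measure_lt_top.ne)
  rw [tsub_self] at h2
  refine tendsto_of_tendsto_of_tendsto_of_le_of_le' tendsto_const_nhds h2
    (Eventually.of_forall fun _ => zero_le) ?_
  filter_upwards [hT.eventually_ne (by simp : (0 : ℝ≥0∞) ≠ ∞)] with N hN
  refine (measure_mono (t := Metric.cthickening (Metric.hausdorffEDist (T N) A).toReal A \ A)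
    fun x hx => ⟨?_, hx.2⟩).trans ?_
  · rw [Metric.mem_cthickening_iff, ENNReal.ofReal_toReal hN]
    exact Metric.infEDist_le_hausdorffEDist_of_mem hx.1
  · rw [measure_sdiff (Metric.self_subset_cthickening A) hA.measurableSet.nullMeasurableSet
      hb.measure_lt_top.ne]
    rfl

lemma eventually_norm_le_of_hausdorffEDist {R : ℝ} (hR : ∀ x ∈ A, ‖x‖ ≤ R) {T : ℕ → Set (Sp d)}
    (hT : Tendsto (fun N => Metric.hausdorffEDist (T N) A) atTop (𝓝 0)) :
    ∀ᶠ N in atTop, ∀ x ∈ T N, ‖x‖ ≤ R + 1 := by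
  filter_upwards [hT.eventually_lt_const (by simp : (0 : ℝ≥0∞) < ENNReal.ofReal 1)] with N hN x hx
  obtain ⟨y, hy, hxy⟩ := Metric.infEDist_lt_iff.1
    ((Metric.infEDist_le_hausdorffEDist_of_mem hx).trans_lt hN)
  rw [edist_lt_ofReal, dist_eq_norm] at hxy
  have h1 := hR y hy
  have h2 : ‖x‖ ≤ ‖x - y‖ + ‖y‖ := by simpa using norm_add_le (x - y) y
  linarith

end Geometry

/-! ### Consequences of the assumptions on `S_r` -/

section Assumptions

variable {S A : Set (Sp d)} {b : ℕ → ℕ} {Φ : Sp d → EReal} {Ψ : Sp d → Sp d → EReal}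
  {ΦN : ℕ → Sp d → EReal} {ΨN : ℕ → Sp d → Sp d → EReal}
  {μ : Measure (Conf S)} {μN : ℕ → Measure (Conf S)}

lemma isClosed_ball (hS : IsClosed S) (b : ℕ → ℕ) (r : ℕ) : IsClosed (ball S b r) :=
  hS.inter (isClosed_le continuous_norm continuous_const)

lemma isBounded_ball (S : Set (Sp d)) (b : ℕ → ℕ) (r : ℕ) : Bornology.IsBounded (ball S b r) :=
  (Metric.isBounded_closedBall (x := (0 : Sp d)) (r := b r)).subset fun x hx => by
    simpa using hx.2

lemma volume_ball_ne_zero (hS : IsStateSpace S) {r : ℕ} (hr : 0 < b r) :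
    volume (ball S b r) ≠ 0 := by
  have hr' : (0 : ℝ) < b r := by exact_mod_cast hr
  have h0 : (0 : Sp d) ∈ closure (interior S) := by
    rw [hS.closure_interior]
    exact hS.zero_mem
  obtain ⟨x, hx⟩ := mem_closure_iff.1 h0 _ Metric.isOpen_ball (Metric.mem_ball_self hr')
  have hpos : 0 < volume (Metric.ball (0 : Sp d) (b r) ∩ interior S) :=
    (Metric.isOpen_ball.inter isOpen_interior).measure_pos _ ⟨x, hx⟩
  have hsub : Metric.ball (0 : Sp d) (b r) ∩ interior S ⊆ ball S b r := fun y hy =>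
    ⟨interior_subset hy.2, by simpa using (Metric.mem_ball.1 hy.1).le⟩
  exact (hpos.trans_le (measure_mono hsub)).ne'

lemma IsFiniteParticleApprox.potentialsConverge (h : IsFiniteParticleApprox S b Φ Ψ μ ΦN ΨN μN)
    (hd : 0 < d) (hS : IsStateSpace S) (hΦ : IsFreePotential Φ) (hΨ : IsPairPotential Ψ)
    (hΦ_fin : ∀ᵐ x : Sp d, x ∈ S → Φ x < ⊤) (r : ℕ) :
    PotentialsConverge S (ball S b r) Φ Ψ ΦN ΨN where
  pos := hd
  meas_S := hS.isClosed.measurableSet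
  subset := fun x hx => hx.1
  meas := (isClosed_ball hS.isClosed b r).measurableSet
  bdd := isBounded_ball S b r
  free := hΦ
  pair := hΨ
  freeN := h.free_potential
  pairN := h.pair_potential
  free_ne_top := hΦ_fin.mono fun x hx hxA => (hx hxA.1).ne
  pair_ne_top x hx y hy hxy := by
    obtain ⟨D, DN, hD, -, -⟩ := h.tendsto_pair
    exact hD.ne_top (x, y) ⟨hx.1, hy.1, hxy⟩
  tendsto_free := h.tendsto_free.mono fun x hx hxA => hx hxA.1
  tendsto_pair x hx y hy hxy := by
    obtain ⟨D, DN, hD, hDN, hlim⟩ := h.tendsto_pair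
    have hp : (x, y) ∈ S.offDiag := ⟨hx.1, hy.1, hxy⟩
    have h1 := (hlim {(x, y)} (singleton_subset_iff.2 hp) isCompact_singleton).1.tendsto_at
      (mem_singleton _)
    have h2 := (continuous_coe_real_ereal.tendsto _).comp h1
    rw [EReal.coe_toReal (hD.ne_top _ hp) (hΨ.ne_bot x y)] at h2
    refine h2.congr fun N => ?_
    exact EReal.coe_toReal ((hDN N).ne_top _ hp) ((h.pair_potential N).ne_bot x y)
  free_ge := by
    obtain ⟨C, hC⟩ := h.free_bddBelow
    exact ⟨C, fun N x hx => hC N x hx.1⟩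
  pair_ge := h.pair_bddBelow r

lemma IsFiniteParticleApprox.pair_ne_top (h : IsFiniteParticleApprox S b Φ Ψ μ ΦN ΨN μN) (N : ℕ)
    {x y : Sp d} (hx : x ∈ S) (hy : y ∈ S) (hxy : x ≠ y) : ΨN N x y ≠ ⊤ := by
  obtain ⟨D, DN, -, hDN, -⟩ := h.tendsto_pair
  exact (hDN N).ne_top (x, y) ⟨hx, hy, hxy⟩

lemma IsFiniteParticleApprox.continuousOn_pair (h : IsFiniteParticleApprox S b Φ Ψ μ ΦN ΨN μN)
    (N : ℕ) (hAS : A ⊆ S) {y : Sp d} (hy : y ∈ S) (hyA : y ∉ A) :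
    ContinuousOn (fun x => (ΨN N x y).toReal) A := by
  obtain ⟨D, DN, -, hDN, -⟩ := h.tendsto_pair
  exact (hDN N).continuousOn.comp (f := fun x => (x, y)) (by fun_prop) fun x hx =>
    ⟨hAS hx, hy, fun (e : x = y) => hyA (e ▸ hx)⟩

lemma IsFiniteParticleApprox.tendsto_measure_of_mem_cylinders [IsProbabilityMeasure μ]
    (h : IsFiniteParticleApprox S b Φ Ψ μ ΦN ΨN μN) (hS : MeasurableSet S) {B : Set (Conf S)}
    (hB : B ∈ cylinders (countFns S)) : Tendsto (fun N => μN N B) atTop (𝓝 (μ B)) := by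
  obtain ⟨p, f, E, hf, rfl⟩ := hB
  choose A hA hfA using hf
  obtain rfl : f = fun i s => s.num (A i) := funext hfA
  exact h.tendsto_measure_num hS (fun i => (hA i).1) (fun i => (hA i).2.1) (fun i => (hA i).2.2) E

lemma IsFiniteParticleApprox.tendsto_measure_count_ne_zero
    (h : IsFiniteParticleApprox S b Φ Ψ μ ΦN ΨN μN) {B : ℕ → Set (Sp d)}
    (hB : ∀ N, MeasurableSet (B N)) (hBS : ∀ N, B N ⊆ S) {R : ℝ}
    (hBR : ∀ᶠ N in atTop, ∀ x ∈ B N, ‖x‖ ≤ R)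
    (hvol : Tendsto (fun N => volume (B N)) atTop (𝓝 0)) :
    Tendsto (fun N => μN N {s | s.count (B N) ≠ 0}) atTop (𝓝 0) := by
  obtain ⟨r, hr⟩ := exists_nat_ge R
  obtain ⟨c, hc⟩ := h.exists_lintegral_count_le r
  have hlim := ENNReal.Tendsto.const_mul (a := ENNReal.ofReal c) hvol
    (Or.inr ENNReal.ofReal_ne_top)
  rw [mul_zero] at hlim
  refine tendsto_of_tendsto_of_tendsto_of_le_of_le' tendsto_const_nhds hlim
    (Eventually.of_forall fun _ => zero_le) ?_
  filter_upwards [hBR] with N hN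
  exact hc N (B N) (hB N) (hBS N) fun x hx => (hN x hx).trans hr

/-- The conditions of a quasi-Gibbs measure for one set `S_r` and one number of particles. -/
lemma exists_quasiGibbs_approximation (hd : 0 < d) (hS : IsStateSpace S)
    [IsProbabilityMeasure μ] (hΦ : IsFreePotential Φ) (hΨ : IsPairPotential Ψ)
    (hΦ_fin : ∀ᵐ x : Sp d, x ∈ S → Φ x < ⊤)
    (h : IsFiniteParticleApprox S b Φ Ψ μ ΦN ΨN μN) (hL : HasLipschitzControl S b ΨN μN)
    {r : ℕ} (hr : 0 < b r) (m : ℕ) :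
    ∃ ν : ℕ → FiniteMeasure (Conf S),
      (∀ k, (ν k : Measure (Conf S)) ≤ ν (k + 1)) ∧
      Tendsto ν atTop (𝓝 (⟨μ.restrict (exactly S (ball S b r) m), inferInstance⟩ :
        FiniteMeasure (Conf S))) ∧
      ∀ k, ∃ (κ : Kernel (Conf S) (Conf S)) (a : ℝ≥0), IsMarkovKernel κ ∧
        HasCondDistrib (Conf.proj (ball S b r)) (Conf.proj (ball S b r)ᶜ) κ
          (ν k : Measure (Conf S)) ∧ 0 < a ∧
        ∀ᵐ s ∂(ν k : Measure (Conf S)),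
          a⁻¹ • gibbs S Φ Ψ (ball S b r) m ≤ κ (Conf.proj (ball S b r)ᶜ s) ∧
          κ (Conf.proj (ball S b r)ᶜ s) ≤ a • gibbs S Φ Ψ (ball S b r) m := by
  have hprob := h.prob
  have hpc := h.potentialsConverge hd hS hΦ hΨ hΦ_fin r
  set A := ball S b r with hAdef
  have hSm := hS.isClosed.measurableSet
  have hAm : MeasurableSet A := hpc.meas
  have hAS : A ⊆ S := hpc.subset
  have hAb : Bornology.IsBounded A := hpc.bdd
  have hAR : ∀ x ∈ A, ‖x‖ ≤ (b r : ℝ) := fun x hx => hx.2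
  obtain ⟨T, hTm, hTU, hTmono, hTH, hTvol, hTlim⟩ := hL
  have hTS : ∀ N, T r N ⊆ S := fun N => (subset_iUnion (fun r => T r N) r).trans (hTU N).subset
  have hbad1 : Tendsto (fun N => μN N {s | s.count (A \ T r N) ≠ 0}) atTop (𝓝 0) :=
    h.tendsto_measure_count_ne_zero (fun N => hAm.diff (hTm r N).1)
      (fun N => sdiff_subset.trans hAS)
      (Eventually.of_forall fun N x hx => hAR x hx.1) (hTvol r)
  have hbad2 : Tendsto (fun N => μN N {s | s.count (T r N \ A) ≠ 0}) atTop (𝓝 0) :=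
    h.tendsto_measure_count_ne_zero (fun N => (hTm r N).1.diff hAm)
      (fun N => sdiff_subset.trans (hTS N))
      ((eventually_norm_le_of_hausdorffEDist hAR (hTH r)).mono fun N hN x hx => hN x hx.1)
      (tendsto_volume_sdiff_of_hausdorffEDist (isClosed_ball hS.isClosed b r) hAb (hTH r))
  -- good outside configurations; up to the events that `A ∆ T_N` contains points, which are
  -- negligible as `N → ∞`, they include the outside parts of the configurations of `H_{r,k}`
  let G : ℕ → ℕ → Set (Conf S) := fun k N => lipschitzField S (ΨN N) A (T r N) k
  have hG : ∀ k N, MeasurableSet (G k N) := fun k N =>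
    measurableSet_lipschitzField hSm (h.pair_potential N).measurable hAm
      (fun y hy hyA => h.continuousOn_pair N hAS hy hyA) _ _
  have hGmono : ∀ k N, G k N ⊆ G (k + 1) N := fun k N s hs => ⟨hs.1, fun x hx x' hx' =>
    (hs.2 x hx x' hx').trans (mul_le_mul_of_nonneg_right (by push_cast; linarith)
      (norm_nonneg _))⟩
  have hliminf : ∀ k, liminf (fun N => μN N (lipschitzSet S ΨN T r k)) atTop ≤
      liminf (fun N => μN N (Conf.proj Aᶜ ⁻¹' G k N)) atTop := by
    intro k
    have h0 := hbad1.add hbad2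
    rw [add_zero] at h0
    refine le_of_le_of_eq ?_ (ENNReal.liminf_add_of_right_tendsto_zero h0 _)
    refine liminf_le_liminf (Eventually.of_forall fun N => ?_)
    obtain ⟨n, hn⟩ := h.finite_particles N
    refine le_trans (measure_mono_ae (t := Conf.proj Aᶜ ⁻¹' G k N ∪
      ({s | s.count (A \ T r N) ≠ 0} ∪ {s | s.count (T r N \ A) ≠ 0})) ?_)
      ((measure_union_le _ _).trans (add_le_add le_rfl (measure_union_le _ _)))
    filter_upwards [hn] with s hsn hs
    by_cases h1 : s.count (A \ T r N) = 0
    · by_cases h2 : s.count (T r N \ A) = 0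
      · exact Or.inl (proj_mem_lipschitzField (hTmono N) (hTU N) hs
          (ne_top_of_le_ne_top (ENNReal.natCast_ne_top n) hsn) h1 h2)
      · exact Or.inr (Or.inr h2)
    · exact Or.inr (Or.inl h1)
  -- the same ultrafilter serves for all `k`, so the limits are monotone in `k`
  let U : Ultrafilter ℕ := hyperfilter ℕ
  have hU : (U : Filter ℕ) ≤ atTop := Nat.hyperfilter_le_atTop
  have hcyl : ∀ B ∈ cylinders (countFns S), Tendsto (fun N => μN N B) atTop (𝓝 (μ B)) :=
    fun B hB => h.tendsto_measure_of_mem_cylinders hSm hB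
  choose ν hνle hν using fun k =>
    exists_isCylinderLimit (G := G k) hSm hAS hAm hAb U hU hcyl m
  have hfin : ∀ k, IsFiniteMeasure (ν k) := fun k => isFiniteMeasure_of_le _ (hνle k)
  refine ⟨fun k => ⟨ν k, hfin k⟩, fun k => ?_, ?_, fun k => ?_⟩
  · have h1 := hfin k
    have h2 := hfin (k + 1)
    change ν k ≤ ν (k + 1)
    exact (hν k).mono hSm (hGmono k) (hν (k + 1))
  · refine tendsto_finiteMeasure_of_le hνle ?_
    have h1 : Tendsto (fun k => μ (exactly S A m) +
        liminf (fun N => μN N (lipschitzSet S ΨN T r k)) atTop - 1) atTop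
        (𝓝 (μ (exactly S A m) + 1 - 1)) :=
      ENNReal.Tendsto.sub ((hTlim r).const_add _) tendsto_const_nhds (Or.inr ENNReal.one_ne_top)
    rw [ENNReal.add_sub_cancel_right ENNReal.one_ne_top] at h1
    change Tendsto (fun k => ν k univ) atTop (𝓝 (μ.restrict (exactly S A m) univ))
    rw [Measure.restrict_apply_univ]
    refine tendsto_of_tendsto_of_tendsto_of_le_of_le h1 tendsto_const_nhds (fun k => ?_)
      fun k => (hνle k univ).trans (Measure.restrict_apply_univ _).le
    exact tsub_le_iff_right.2 ((add_le_add_right (hliminf k) _).trans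
      ((hν k).le_measure_univ_add hU hAS hAm hAb hcyl (hG k)))
  · have := hfin k
    exact exists_condDistrib_of_cross_mul_le (ν := ν k) hSm hAm
      (hpc.gibbs_univ_ne_zero (volume_ball_ne_zero hS hr) m) (hpc.gibbs_univ_ne_top m)
      ENNReal.ofReal_ne_top fun B hB D hD E hE =>
        (hν k).cross_mul_le hpc hU (fun N => (hTm r N).1) (hTvol r) hbad1 k.cast_nonneg hAR
          (fun N x hx y hy hxy => h.pair_ne_top N hx hy hxy) (hG k)
          (fun N => h.canonical N r m) hB hD hE

end Assumptions

end QuasiGibbs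

end

theorem theoreml {d : ℕ} (hd : 0 < d) (S : Set (QuasiGibbs.Sp d))
    (hS : QuasiGibbs.IsStateSpace S)
    (μ : Measure (QuasiGibbs.Conf S)) [IsProbabilityMeasure μ]
    (Φ : QuasiGibbs.Sp d → EReal) (Ψ : QuasiGibbs.Sp d → QuasiGibbs.Sp d → EReal)
    (hΦ : QuasiGibbs.IsFreePotential Φ) (hΨ : QuasiGibbs.IsPairPotential Ψ)
    (hΦ_fin : ∀ᵐ x : QuasiGibbs.Sp d, x ∈ S → Φ x < ⊤)
    (b : ℕ → ℕ) (hb : StrictMono b)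
    (μN : ℕ → Measure (QuasiGibbs.Conf S))
    (ΦN : ℕ → QuasiGibbs.Sp d → EReal)
    (ΨN : ℕ → QuasiGibbs.Sp d → QuasiGibbs.Sp d → EReal)
    (hA4 : QuasiGibbs.IsFiniteParticleApprox S b Φ Ψ μ ΦN ΨN μN)
    (hA5 : QuasiGibbs.HasLipschitzControl S b ΨN μN) :
    QuasiGibbs.IsQuasiGibbs S Φ Ψ μ := by
  -- `S_0` may be a null set, namely if `b 0 = 0`; the sequence is therefore shifted by one.
  have hpos : ∀ r, 0 < b (r + 1) := fun r => (Nat.zero_le _).trans_lt (hb r.lt_succ_self)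
  choose ν hmono hlim hcond using fun r m =>
    QuasiGibbs.exists_quasiGibbs_approximation hd hS hΦ hΨ hΦ_fin hA4 hA5 (hpos r) m
  refine ⟨fun r => b (r + 1), fun r k m => ν r m k, fun r s hrs => hb (Nat.succ_lt_succ hrs),
    fun r m => ⟨hmono r m, hlim r m, fun k => ?_⟩⟩
  obtain ⟨κ, a, hκ, hcd, ha, hae⟩ := hcond r m k
  exact ⟨κ, fun _ => a, hκ, hcd, fun _ => ha, hae⟩
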